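/- Let $q\in[0,1]$, $\alpha\in(0,1]$ and $\beta\in(0,1]$ be constants, with the convention $|t|^0=1$ for $t\neq 0$ and $|0|^q=0$. Let $h$ be a standard normal random variable, and for $\gamma,\nu\ge 0$ and $x\in\mathbb R$ put $$I^{(1)}(x,\gamma,\nu)=E\max_{w\in\mathbb R}\bigl(hw-\nu|x+w|^q+\nu|x|^q-\gamma w^2\bigr),\qquad I^{(2)}(\gamma,\nu)=E\max_{w\in\mathbb R}\bigl(|h||w|-\nu|w|^q-\gamma w^2\bigr)$$ (values in $[0,\infty]$; maxima and minima are read as suprema and infima). Suppose that $$\max_{x\in\mathbb R}\ \min_{\gamma\ge 0,\ \nu\ge 0}\Bigl(\beta I^{(1)}(x,\gamma,\nu)+(1-\beta)I^{(2)}(\gamma,\nu)+\gamma\Bigr)<\sqrt{\alpha}.$$ Then there are constants $C,c>0$ such that the following holds for all non-negative integers $m,n,k$ with $m=\alpha n$ and $k=\beta n$, and for every fixed $\tilde x\in\mathbb R^n$ with $\tilde x_1=\dots=\tilde x_{n-k}=0$. If $A$ is an $m\times n$ matrix with i.i.d. standard normal entries, then with probability at least $1-Ce^{-cn}$ the vector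 $\tilde x$ is the unique solution of $$\min_{z\in\mathbb R^n}\|z\|_q\quad\text{subject to}\quad Az=A\tilde x,$$ where $\|z\|_q=\bigl(\sum_i|z_i|^q\bigr)^{1/q}$ for $q>0$ and $\|z\|_0$ is the number of non-zero coordinates of $z$. -/

import Mathlib

open MeasureTheory ProbabilityTheory
open scoped ENNReal NNReal Matrix

noncomputable section

namespace WeakThreshold

/-- The term `|t|^q` of the `ℓ_q` objective, with the `ℓ_0` convention that for `q = 0` it is the
indicator of `t ≠ 0` (Mathlib's `0 ^ (0 : ℝ)` is `1`). -/
def absPow (q t : ℝ) : ℝ := if t = 0 then 0 else |t| ^ q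

/-- `‖z‖_q`: Mathlib's `PiLp` norm, which is `(∑ i, |z i|^q)^(1/q)` for `0 < q < ∞` and the number
of non-zero coordinates for `q = 0`. -/
def lqNorm {n : ℕ} (q : ℝ) (z : Fin n → ℝ) : ℝ :=
  ‖(WithLp.toLp (ENNReal.ofReal q) z : PiLp (ENNReal.ofReal q) fun _ : Fin n => ℝ)‖

/-- The set of all solutions (global minimizers) of `min ‖z‖_q` subject to `A z = y`. -/
def lqSolutions {m n : ℕ} (q : ℝ) (A : Matrix (Fin m) (Fin n) ℝ) (y : Fin m → ℝ) :
    Set (Fin n → ℝ) :=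
  {z | A *ᵥ z = y ∧ ∀ z' : Fin n → ℝ, A *ᵥ z' = y → lqNorm q z ≤ lqNorm q z'}

/-- The law of an `m × n` matrix with i.i.d. standard normal entries. -/
def gaussianMatrix (m n : ℕ) : Measure (Fin m → Fin n → ℝ) :=
  Measure.pi fun _ => Measure.pi fun _ => gaussianReal 0 1

/-- `E max_w (h w - ν |x + w|^q + ν |x|^q - γ w²)`, `h` standard normal. It may be infinite. Since
`w = 0` gives the value `0`, the maximum is non-negative and the truncation in `ENNReal.ofReal`
does not change it. -/
def I₁ (q : ℝ) (γ ν : ℝ≥0) (x : ℝ) : ℝ≥0∞ :=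
  ∫⁻ h, ⨆ w : ℝ, ENNReal.ofReal
    (h * w - ν * absPow q (x + w) + ν * absPow q x - γ * w ^ 2) ∂(gaussianReal 0 1)

/-- `E max_w (|h| |w| - ν |w|^q - γ w²)`, `h` standard normal. Again `w = 0` gives `0`. -/
def I₂ (q : ℝ) (γ ν : ℝ≥0) : ℝ≥0∞ :=
  ∫⁻ h, ⨆ w : ℝ, ENNReal.ofReal
    (|h| * |w| - ν * absPow q w - γ * w ^ 2) ∂(gaussianReal 0 1)

/-- `max_x min_{γ, ν ≥ 0} (β I₁ + (1 - β) I₂ + γ)`, the maximum and minimum being read as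
supremum and infimum. -/
def weakBound (q β : ℝ) : ℝ≥0∞ :=
  ⨆ x : ℝ, ⨅ (γ : ℝ≥0) (ν : ℝ≥0),
    ENNReal.ofReal β * I₁ q γ ν x + ENNReal.ofReal (1 - β) * I₂ q γ ν + (γ : ℝ≥0∞)

end WeakThreshold

end

namespace WeakThreshold

noncomputable section

open Real Set Filter Topology

/-! ### Scalar Gaussian integrals -/

/-! Failure of recovery means that some nonzero kernel vector of `A` does not increase the sum of
`q`-th powers. After normalization the kernel meets a set of unit descent directions
(`exists_mem_descentSet_of_lqSolutions_ne`). Gordon's comparison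
(`measure_exists_mulVec_eq_zero_le`) replaces `A` by two independent Gaussian vectors: up to a
factor `2`, failure is no more likely than `‖g‖ + ⟨h, w⟩ ≤ 3` for some descent direction `w`. Here
`‖g‖` concentrates near `√m = √α √n`.

The linear form is controlled by weak Lagrangian duality (`exists_scale_of_mem_descentSet`). With
multiplier `ν` for descent and `γ` for the norm, `-√n ⟨h, w⟩` is at most `γ n` plus a sum of scalar
suprema, one per coordinate, evaluated at `s * x i` for some unknown scale `s > 0`. The means of
these suprema are `I₁` and `I₂`, so one wants `β sup_x I₁ + (1 - β) I₂ + γ < √α` for a single pair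
`(γ, ν)`.

The hypothesis only provides a pair for each `x`, so a supremum and an infimum have to be exchanged
(`exists_forall_weakFun_le`). Convexity in `(γ, ν)` is immediate; the substantial point is
`I₁_quasiconcave`, quasiconcavity in `x > 0`. It is monotonicity for `q = 0` and `q = 1`. For `0 < q
< 1` the `x`-derivative is a positive factor times `ν q - R x`, and total positivity of `ker` makes
the derivative of `R` change sign at most once, from plus to minus (`slopeVar_nonpos_of_le`). A
valley of `I₁` would then force unbounded growth at infinity, whereas `I₁` is bounded in `x`.

Finally the empirical sums must be close to their means for all scales `s` at once
(`exists_gaussianVector_supGain_ge_le`). The half-line splits into finitely many cells with good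
envelopes; as `s` grows each coordinate moves through the cells in order, so only linearly many (in
`n`) configurations occur, and Chernoff's bound with a union bound suffices. -/

/-- The standard normal density. -/
def gpdf (z : ℝ) : ℝ := (√(2 * π))⁻¹ * exp (-z ^ 2 / 2)

/-- The odd antiderivative of the standard normal density. -/
def gint (z : ℝ) : ℝ := ∫ t in (0 : ℝ)..z, gpdf t

lemma gpdf_eq (z : ℝ) : gpdf z = gaussianPDFReal 0 1 z := by
  simp [gpdf, gaussianPDFReal]

lemma gpdf_pos (z : ℝ) : 0 < gpdf z := by
  unfold gpdf; positivity

@[fun_prop]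
lemma continuous_gpdf : Continuous gpdf := by
  unfold gpdf; fun_prop

lemma gpdf_neg (z : ℝ) : gpdf (-z) = gpdf z := by simp [gpdf]

/-- By `(z - 1)² ≥ 0`. An exponential tail, though far from sharp, is enough for every domination
and limit argument on the kernels below. -/
lemma gpdf_le_exp (z : ℝ) : gpdf z ≤ exp (1 / 2 - z) := by
  have h1 : (√(2 * π))⁻¹ ≤ 1 := by
    apply inv_le_one_of_one_le₀
    rw [Real.one_le_sqrt]
    nlinarith [pi_gt_three]
  calc gpdf z ≤ 1 * exp (-z ^ 2 / 2) := by
        unfold gpdf; gcongr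
    _ ≤ exp (1 / 2 - z) := by
        rw [one_mul]; apply exp_le_exp.2; nlinarith [sq_nonneg (z - 1)]

lemma hasDerivAt_gpdf (z : ℝ) : HasDerivAt gpdf (-z * gpdf z) z := by
  have h : HasDerivAt (fun z : ℝ => -z ^ 2 / 2) (-z) z := by
    have := ((hasDerivAt_pow 2 z).neg).div_const 2
    convert! this using 1
    push_cast; ring
  have := (h.exp).const_mul (√(2 * π))⁻¹
  convert! this using 1
  unfold gpdf; ring

lemma integrable_gpdf : Integrable gpdf := by
  have := integrable_gaussianPDFReal 0 1
  exact this.congr (ae_of_all _ fun z => (gpdf_eq z).symm)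

lemma hasDerivAt_gint (z : ℝ) : HasDerivAt gint (gpdf z) z :=
  intervalIntegral.integral_hasDerivAt_right (continuous_gpdf.intervalIntegrable _ _)
    (continuous_gpdf.stronglyMeasurableAtFilter _ _) continuous_gpdf.continuousAt

@[fun_prop]
lemma continuous_gint : Continuous gint :=
  continuous_iff_continuousAt.2 fun z => (hasDerivAt_gint z).continuousAt

lemma gint_neg (z : ℝ) : gint (-z) = -gint z := by
  have := intervalIntegral.integral_comp_neg (a := 0) (b := z) gpdf
  simp only [gpdf_neg, neg_zero] at this
  rw [gint, gint, this, intervalIntegral.integral_symm]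

lemma integral_Ioi_gpdf : ∫ z in Ioi (0 : ℝ), gpdf z = 1 / 2 := by
  have h := integral_gaussian_Ioi (1 / 2)
  have h2 : ∀ z : ℝ, gpdf z = (√(2 * π))⁻¹ * exp (-(1 / 2) * z ^ 2) := by
    intro z; unfold gpdf; congr 2; ring
  simp_rw [h2]
  rw [integral_const_mul, h]
  have : π / (1 / 2) = 2 * π := by ring
  rw [this]
  have : √(2 * π) ≠ 0 := by positivity
  field_simp

lemma tendsto_gint_atTop : Tendsto gint atTop (𝓝 (1 / 2)) := by
  rw [← integral_Ioi_gpdf]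
  exact intervalIntegral_tendsto_integral_Ioi 0 integrable_gpdf.integrableOn tendsto_id

lemma gint_strictMono : StrictMono gint :=
  strictMono_of_deriv_pos fun z => by rw [(hasDerivAt_gint z).deriv]; exact gpdf_pos z

lemma gint_sub_le {a b : ℝ} (hab : a ≤ b) : gint b - gint a ≤ (b - a) * exp (1 / 2 - a) := by
  have h := Convex.image_sub_le_mul_sub_of_deriv_le (convex_Icc a b) (f := gint)
    continuous_gint.continuousOn
    (fun z _ => (hasDerivAt_gint z).differentiableAt.differentiableWithinAt)
    (C := exp (1 / 2 - a)) (fun z hz => by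
      rw [(hasDerivAt_gint z).deriv]
      refine (gpdf_le_exp z).trans (exp_le_exp.2 ?_)
      rw [interior_Icc] at hz
      linarith [hz.1])
    a (left_mem_Icc.2 hab) b (right_mem_Icc.2 hab) hab
  linarith

lemma tendsto_gpdf_atTop : Tendsto gpdf atTop (𝓝 0) := by
  refine squeeze_zero (fun z => (gpdf_pos z).le) gpdf_le_exp ?_
  exact tendsto_exp_atBot.comp (tendsto_atBot_add_const_left _ _ tendsto_neg_atTop_atBot)

/-- `E (h - a)₊` for a standard normal `h`. -/
def gpos (a : ℝ) : ℝ := gpdf a - a * (1 / 2 - gint a)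

lemma hasDerivAt_gpos (a : ℝ) : HasDerivAt gpos (gint a - 1 / 2) a := by
  have := (hasDerivAt_gpdf a).sub ((hasDerivAt_id a).mul ((hasDerivAt_gint a).const_sub (1 / 2)))
  convert! this using 1
  simp

lemma integrableOn_gpos (a : ℝ) : IntegrableOn (fun h => (h - a) * gpdf h) (Ioi a) ∧
    ∫ h in Ioi a, (h - a) * gpdf h = gpos a := by
  have hd : ∀ h ∈ Ici a, HasDerivAt (fun h => -gpdf h - a * gint h) ((h - a) * gpdf h) h := by
    intro h _
    have := (hasDerivAt_gpdf h).neg.sub ((hasDerivAt_gint h).const_mul a)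
    convert! this using 1
    ring
  have hn : ∀ h ∈ Ioi a, 0 ≤ (h - a) * gpdf h := fun h hh =>
    mul_nonneg (sub_nonneg.2 (le_of_lt hh)) (gpdf_pos h).le
  have ht : Tendsto (fun h => -gpdf h - a * gint h) atTop (𝓝 (-0 - a * (1 / 2))) :=
    tendsto_gpdf_atTop.neg.sub (tendsto_gint_atTop.const_mul a)
  refine ⟨integrableOn_Ioi_deriv_of_nonneg' hd hn ht, ?_⟩
  rw [integral_Ioi_of_hasDerivAt_of_nonneg' hd hn ht, gpos]
  ring

lemma lintegral_gaussianReal (f : ℝ → ℝ≥0∞) (hf : Measurable f) :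
    ∫⁻ h, f h ∂(gaussianReal 0 1) = ∫⁻ h, ENNReal.ofReal (gpdf h) * f h := by
  rw [gaussianReal_of_var_ne_zero 0 one_ne_zero,
    lintegral_withDensity_eq_lintegral_mul _ (measurable_gaussianPDF 0 1) hf]
  simp [gaussianPDF, gpdf_eq]

lemma integral_gaussianReal (f : ℝ → ℝ) :
    ∫ h, f h ∂(gaussianReal 0 1) = ∫ h, gpdf h * f h := by
  rw [integral_gaussianReal_eq_integral_smul one_ne_zero]
  simp [gpdf_eq]

lemma lintegral_pos_part (a : ℝ) :
    ∫⁻ h, ENNReal.ofReal (h - a) ∂(gaussianReal 0 1) = ENNReal.ofReal (gpos a) := by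
  rw [lintegral_gaussianReal _ (by fun_prop), ← (integrableOn_gpos a).2,
    ofReal_integral_eq_lintegral_ofReal (integrableOn_gpos a).1
      ((ae_restrict_mem measurableSet_Ioi).mono fun h hh =>
        mul_nonneg (sub_nonneg.2 (le_of_lt hh)) (gpdf_pos h).le),
    ← lintegral_indicator measurableSet_Ioi]
  refine lintegral_congr fun h => ?_
  by_cases hh : a < h
  · rw [indicator_of_mem (by exact hh), mul_comm (h - a), ENNReal.ofReal_mul (gpdf_pos h).le]
  · rw [indicator_of_notMem (by exact hh), ENNReal.ofReal_of_nonpos (p := h - a) (by linarith [not_lt.1 hh]),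
      mul_zero]

lemma stdNormal_map_neg : (gaussianReal 0 1).map (fun h => -h) = gaussianReal 0 1 := by
  simpa using gaussianReal_map_neg (μ := 0) (v := 1)

lemma lintegral_gaussianReal_neg (f : ℝ → ℝ≥0∞) (hf : Measurable f) :
    ∫⁻ h, f (-h) ∂(gaussianReal 0 1) = ∫⁻ h, f h ∂(gaussianReal 0 1) := by
  conv_rhs => rw [← stdNormal_map_neg]
  rw [lintegral_map hf measurable_neg]

lemma gpos_nonneg (a : ℝ) : 0 ≤ gpos a := by
  rw [← (integrableOn_gpos a).2]
  exact setIntegral_nonneg measurableSet_Ioi fun h hh =>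
    mul_nonneg (sub_nonneg.2 (le_of_lt hh)) (gpdf_pos h).le

/-- Pointwise `h - a ≤ exp (h - a)`, and the standard normal has exponential moment `exp (1 / 2)` at
`1`. -/
lemma gpos_le_exp (a : ℝ) : gpos a ≤ exp (1 / 2 - a) := by
  have h1 : ENNReal.ofReal (gpos a) ≤ ENNReal.ofReal (exp (1 / 2 - a)) := by
    rw [← lintegral_pos_part]
    calc ∫⁻ h, ENNReal.ofReal (h - a) ∂(gaussianReal 0 1)
        ≤ ∫⁻ h, ENNReal.ofReal (exp (-a) * exp (1 * h)) ∂(gaussianReal 0 1) := by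
          refine lintegral_mono fun h => ENNReal.ofReal_le_ofReal ?_
          rw [← exp_add]
          linarith [add_one_le_exp (-a + 1 * h)]
      _ = ENNReal.ofReal (exp (1 / 2 - a)) := by
          rw [← ofReal_integral_eq_lintegral_ofReal
            ((integrable_exp_mul_gaussianReal 1).const_mul _) (ae_of_all _ fun h => by positivity),
            integral_const_mul]
          have := congrFun (mgf_id_gaussianReal (μ := 0) (v := 1)) 1
          simp only [mgf, id] at this
          rw [this, ← exp_add]
          congr 2
          push_cast
          ring
  exact (ENNReal.ofReal_le_ofReal_iff (exp_pos _).le).1 h1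

/-! ### The kernels `E (|x + h| - t)₊` and its derivatives -/

/-- `E (|x + h| - t)₊`. -/
def kerC (x t : ℝ) : ℝ := gpos (t - x) + gpos (t + x)
/-- The `x`-derivative of `kerC`. -/
def kerQ (x t : ℝ) : ℝ := gint (t + x) - gint (t - x)
/-- The `x`-derivative of `kerQ`. -/
def kerE (x t : ℝ) : ℝ := gpdf (t - x) + gpdf (t + x)
/-- Minus the `t`-derivative of `kerQ`. -/
def ker (x t : ℝ) : ℝ := gpdf (t - x) - gpdf (t + x)
/-- The antiderivative of `t ↦ t * ker x t` vanishing at `0`. -/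
def kerK (x t : ℝ) : ℝ := -ker x t + x * (gint (t - x) + gint (t + x))

lemma lintegral_kerC {x t : ℝ} (ht : 0 ≤ t) :
    ∫⁻ h, ENNReal.ofReal (|x + h| - t) ∂(gaussianReal 0 1) = ENNReal.ofReal (kerC x t) := by
  -- Since `t ≥ 0`, at most one of the two one-sided excesses is positive, so they add without
  -- overlap.
  have h1 : ∀ h : ℝ, ENNReal.ofReal (|x + h| - t) =
      ENNReal.ofReal (h - (t - x)) + ENNReal.ofReal (-h - (t + x)) := by
    intro h
    rcases le_total 0 (x + h) with hx | hx
    · rw [abs_of_nonneg hx, ENNReal.ofReal_of_nonpos (p := -h - (t + x)) (by linarith), add_zero]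
      congr 1; ring
    · rw [abs_of_nonpos hx, ENNReal.ofReal_of_nonpos (p := h - (t - x)) (by linarith), zero_add]
      congr 1; ring
  simp_rw [h1]
  rw [lintegral_add_left (by fun_prop), lintegral_pos_part,
    lintegral_gaussianReal_neg (fun h => ENNReal.ofReal (h - (t + x))) (by fun_prop),
    lintegral_pos_part, kerC, ENNReal.ofReal_add (gpos_nonneg _) (gpos_nonneg _)]

lemma hasDerivAt_kerC (x t : ℝ) : HasDerivAt (fun x => kerC x t) (kerQ x t) x := by
  have h1 := (hasDerivAt_gpos (t - x)).comp x ((hasDerivAt_id x).const_sub t)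
  have h2 := (hasDerivAt_gpos (t + x)).comp x ((hasDerivAt_id x).const_add t)
  convert! h1.add h2 using 1
  simp [kerQ]

lemma hasDerivAt_kerQ (x t : ℝ) : HasDerivAt (fun x => kerQ x t) (kerE x t) x := by
  have h1 := (hasDerivAt_gint (t - x)).comp x ((hasDerivAt_id x).const_sub t)
  have h2 := (hasDerivAt_gint (t + x)).comp x ((hasDerivAt_id x).const_add t)
  convert! h2.sub h1 using 1
  simp [kerE]; ring

lemma hasDerivAt_kerQ_right (x t : ℝ) : HasDerivAt (fun t => kerQ x t) (-ker x t) t := by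
  have h1 := (hasDerivAt_gint (t - x)).comp t ((hasDerivAt_id t).sub_const x)
  have h2 := (hasDerivAt_gint (t + x)).comp t ((hasDerivAt_id t).add_const x)
  convert! h2.sub h1 using 1
  simp [ker]

lemma hasDerivAt_ker_right (x t : ℝ) :
    HasDerivAt (fun t => ker x t) (x * kerE x t - t * ker x t) t := by
  have h1 := (hasDerivAt_gpdf (t - x)).comp t ((hasDerivAt_id t).sub_const x)
  have h2 := (hasDerivAt_gpdf (t + x)).comp t ((hasDerivAt_id t).add_const x)
  convert! h1.sub h2 using 1
  simp [ker, kerE]; ring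

lemma hasDerivAt_kerK_right (x t : ℝ) : HasDerivAt (fun t => kerK x t) (t * ker x t) t := by
  have h1 := (hasDerivAt_gint (t - x)).comp t ((hasDerivAt_id t).sub_const x)
  have h2 := (hasDerivAt_gint (t + x)).comp t ((hasDerivAt_id t).add_const x)
  convert! (hasDerivAt_ker_right x t).neg.add ((h1.add h2).const_mul x) using 1
  simp [ker, kerE]

lemma kerK_zero (x : ℝ) : kerK x 0 = 0 := by
  simp [kerK, ker, gpdf_neg, gint_neg]

lemma kerK_eq_integral (x t : ℝ) : kerK x t = ∫ s in (0 : ℝ)..t, s * ker x s := by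
  have hc : Continuous fun s => s * ker x s := by unfold ker; fun_prop
  rw [intervalIntegral.integral_eq_sub_of_hasDerivAt (fun s _ => hasDerivAt_kerK_right x s)
    (hc.intervalIntegrable _ _), kerK_zero, sub_zero]

lemma kerE_pos (x t : ℝ) : 0 < kerE x t := add_pos (gpdf_pos _) (gpdf_pos _)

lemma kerE_le (x t : ℝ) (hx : 0 ≤ x) : kerE x t ≤ 2 * exp (1 / 2 + x - t) := by
  have h1 := gpdf_le_exp (t - x)
  have h2 := gpdf_le_exp (t + x)
  have h3 : exp (1 / 2 - (t + x)) ≤ exp (1 / 2 + x - t) := exp_le_exp.2 (by linarith)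
  have h4 : 1 / 2 - (t - x) = 1 / 2 + x - t := by ring
  rw [h4] at h1
  unfold kerE; linarith

lemma kerQ_nonneg {x : ℝ} (t : ℝ) (hx : 0 ≤ x) : 0 ≤ kerQ x t :=
  sub_nonneg.2 (gint_strictMono.monotone (by linarith))

lemma kerQ_le {x : ℝ} (t : ℝ) (hx : 0 ≤ x) : kerQ x t ≤ 2 * x * exp (1 / 2 + x - t) := by
  have := gint_sub_le (a := t - x) (b := t + x) (by linarith)
  have h4 : 1 / 2 - (t - x) = 1 / 2 + x - t := by ring
  rw [h4] at this
  unfold kerQ; linarith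

lemma kerC_nonneg (x t : ℝ) : 0 ≤ kerC x t := add_nonneg (gpos_nonneg _) (gpos_nonneg _)

lemma kerC_le {x : ℝ} (t : ℝ) (hx : 0 ≤ x) : kerC x t ≤ 2 * exp (1 / 2 + x - t) := by
  have h1 := gpos_le_exp (t - x)
  have h2 := gpos_le_exp (t + x)
  have h3 : exp (1 / 2 - (t + x)) ≤ exp (1 / 2 + x - t) := exp_le_exp.2 (by linarith)
  have h4 : 1 / 2 - (t - x) = 1 / 2 + x - t := by ring
  rw [h4] at h1
  unfold kerC; linarith

/-- Up to a factor that splits into a function of `x` times a function of `t`, the kernel is `sinh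
(x * t)`; such a factor is irrelevant for total positivity. -/
lemma ker_eq_sinh (x t : ℝ) :
    ker x t = 2 * (√(2 * π))⁻¹ * exp (-(x ^ 2 + t ^ 2) / 2) * sinh (x * t) := by
  have h1 : exp (-(t - x) ^ 2 / 2) = exp (-(x ^ 2 + t ^ 2) / 2) * exp (x * t) := by
    rw [← exp_add]; congr 1; ring
  have h2 : exp (-(t + x) ^ 2 / 2) = exp (-(x ^ 2 + t ^ 2) / 2) * exp (-(x * t)) := by
    rw [← exp_add]; congr 1; ring
  rw [ker, gpdf, gpdf, h1, h2, sinh_eq]; ring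

lemma kerE_eq_cosh (x t : ℝ) :
    kerE x t = 2 * (√(2 * π))⁻¹ * exp (-(x ^ 2 + t ^ 2) / 2) * cosh (x * t) := by
  have h1 : exp (-(t - x) ^ 2 / 2) = exp (-(x ^ 2 + t ^ 2) / 2) * exp (x * t) := by
    rw [← exp_add]; congr 1; ring
  have h2 : exp (-(t + x) ^ 2 / 2) = exp (-(x ^ 2 + t ^ 2) / 2) * exp (-(x * t)) := by
    rw [← exp_add]; congr 1; ring
  rw [kerE, gpdf, gpdf, h1, h2, cosh_eq]; ring

lemma ker_pos {x t : ℝ} (hx : 0 < x) (ht : 0 < t) : 0 < ker x t := by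
  rw [ker_eq_sinh]
  have : 0 < sinh (x * t) := sinh_pos_iff.2 (mul_pos hx ht)
  positivity

lemma ker_le (x t : ℝ) : ker x t ≤ exp (1 / 2 + x - t) := by
  have h1 := gpdf_le_exp (t - x)
  have h4 : 1 / 2 - (t - x) = 1 / 2 + x - t := by ring
  rw [h4] at h1
  have := gpdf_pos (t + x)
  unfold ker; linarith

/-! ### Total positivity of the kernels. -/

/-- Monotonicity of `t ↦ t coth t`. -/
lemma mul_cosh_mul_sinh_le {s t : ℝ} (hs : 0 < s) (hst : s ≤ t) :
    s * cosh s * sinh t ≤ t * cosh t * sinh s := by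
  have hmono : MonotoneOn (fun t => t * cosh t / sinh t) (Ioi 0) := by
    have hd : ∀ t ∈ Ioi (0 : ℝ), HasDerivAt (fun t => t * cosh t / sinh t)
        (((1 * cosh t + t * sinh t) * sinh t - t * cosh t * cosh t) / sinh t ^ 2) t := fun t ht =>
      ((hasDerivAt_id t).mul (hasDerivAt_cosh t)).div (hasDerivAt_sinh t)
        (sinh_pos_iff.2 ht).ne'
    refine monotoneOn_of_deriv_nonneg (convex_Ioi 0)
      (fun t ht => (hd t ht).continuousAt.continuousWithinAt)
      (fun t ht => (hd t (interior_subset ht)).differentiableAt.differentiableWithinAt) ?_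
    intro t ht
    rw [interior_Ioi] at ht
    rw [(hd t ht).deriv]
    -- By `cosh² = 1 + sinh²` the numerator of the derivative equals `sinh t * cosh t - t`.
    have h1 : t ≤ sinh t := self_le_sinh_iff.2 (le_of_lt ht)
    have h2 := one_le_cosh t
    have h3 := cosh_sq t
    have h0 : (0 : ℝ) < t := ht
    apply div_nonneg _ (sq_nonneg _)
    nlinarith
  have h := hmono (mem_Ioi.2 hs) (mem_Ioi.2 (hs.trans_le hst)) hst
  have h1 : 0 < sinh s := sinh_pos_iff.2 hs
  have h2 : 0 < sinh t := sinh_pos_iff.2 (hs.trans_le hst)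
  simp only at h
  rwa [div_le_div_iff₀ h1 h2] at h

/-- The quotient `sinh (x₂ y) / sinh (x₁ y)` increases in `y`: its logarithmic derivative is `x₂
coth (x₂ y) - x₁ coth (x₁ y)`, nonnegative because `t coth t` increases. -/
lemma sinh_totally_positive {x₁ x₂ y₁ y₂ : ℝ} (hx₁ : 0 < x₁) (hx : x₁ ≤ x₂) (hy₁ : 0 < y₁)
    (hy : y₁ ≤ y₂) :
    sinh (x₁ * y₂) * sinh (x₂ * y₁) ≤ sinh (x₁ * y₁) * sinh (x₂ * y₂) := by
  have hx₂ := hx₁.trans_le hx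
  have hpos : ∀ y ∈ Ioi (0 : ℝ), 0 < sinh (x₁ * y) := fun y hy => sinh_pos_iff.2 (mul_pos hx₁ hy)
  have hmono : MonotoneOn (fun y => sinh (x₂ * y) / sinh (x₁ * y)) (Ioi 0) := by
    have hd : ∀ t ∈ Ioi (0 : ℝ), HasDerivAt (fun y => sinh (x₂ * y) / sinh (x₁ * y))
        ((cosh (x₂ * t) * x₂ * sinh (x₁ * t) - sinh (x₂ * t) * (cosh (x₁ * t) * x₁))
          / sinh (x₁ * t) ^ 2) t := fun t ht => by
      have h1 : HasDerivAt (fun y => sinh (x₂ * y)) (cosh (x₂ * t) * x₂) t := by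
        simpa using ((hasDerivAt_id t).const_mul x₂).sinh
      have h2 : HasDerivAt (fun y => sinh (x₁ * y)) (cosh (x₁ * t) * x₁) t := by
        simpa using ((hasDerivAt_id t).const_mul x₁).sinh
      exact h1.div h2 (hpos t ht).ne'
    refine monotoneOn_of_deriv_nonneg (convex_Ioi 0)
      (fun t ht => (hd t ht).continuousAt.continuousWithinAt)
      (fun t ht => (hd t (interior_subset ht)).differentiableAt.differentiableWithinAt) ?_
    intro t ht
    rw [interior_Ioi] at ht
    rw [(hd t ht).deriv]
    apply div_nonneg _ (sq_nonneg _)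
    have h0 : (0 : ℝ) < t := ht
    have h := mul_cosh_mul_sinh_le (mul_pos hx₁ h0) (mul_le_mul_of_nonneg_right hx h0.le)
    have : t * (sinh (x₂ * t) * (cosh (x₁ * t) * x₁)) ≤
        t * (cosh (x₂ * t) * x₂ * sinh (x₁ * t)) := by nlinarith
    linarith [le_of_mul_le_mul_left this h0]
  have h := hmono (mem_Ioi.2 hy₁) (mem_Ioi.2 (hy₁.trans_le hy)) hy
  simp only at h
  rw [div_le_div_iff₀ (hpos _ hy₁) (hpos _ (hy₁.trans_le hy))] at h
  linarith

/-- The Gaussian factors on both sides have the same product, so only the `sinh` determinant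
remains. -/
lemma ker_totally_positive {x₁ x₂ y₁ y₂ : ℝ} (hx₁ : 0 < x₁) (hx : x₁ ≤ x₂) (hy₁ : 0 < y₁)
    (hy : y₁ ≤ y₂) : ker x₁ y₂ * ker x₂ y₁ ≤ ker x₁ y₁ * ker x₂ y₂ := by
  have h := sinh_totally_positive hx₁ hx hy₁ hy
  simp only [ker_eq_sinh]
  have e1 : exp (-(x₁ ^ 2 + y₂ ^ 2) / 2) * exp (-(x₂ ^ 2 + y₁ ^ 2) / 2) =
      exp (-(x₁ ^ 2 + y₁ ^ 2) / 2) * exp (-(x₂ ^ 2 + y₂ ^ 2) / 2) := by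
    rw [← exp_add, ← exp_add]; congr 1; ring
  calc _ = (2 * (√(2 * π))⁻¹) ^ 2 * (exp (-(x₁ ^ 2 + y₂ ^ 2) / 2) * exp (-(x₂ ^ 2 + y₁ ^ 2) / 2))
        * (sinh (x₁ * y₂) * sinh (x₂ * y₁)) := by ring
    _ ≤ (2 * (√(2 * π))⁻¹) ^ 2 * (exp (-(x₁ ^ 2 + y₂ ^ 2) / 2) * exp (-(x₂ ^ 2 + y₁ ^ 2) / 2))
        * (sinh (x₁ * y₁) * sinh (x₂ * y₂)) := by gcongr
    _ = _ := by rw [e1]; ring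

/-- The quotient `x * kerE x t / ker x t` is `x coth (x t)`, which increases in `x`. -/
lemma kerE_mul_ker_le {x₁ x₂ t : ℝ} (hx₁ : 0 < x₁) (hx : x₁ ≤ x₂) (ht : 0 < t) :
    x₁ * kerE x₁ t * ker x₂ t ≤ x₂ * kerE x₂ t * ker x₁ t := by
  have h := mul_cosh_mul_sinh_le (mul_pos hx₁ ht) (mul_le_mul_of_nonneg_right hx ht.le)
  have h' : x₁ * (cosh (x₁ * t) * sinh (x₂ * t)) ≤ x₂ * (cosh (x₂ * t) * sinh (x₁ * t)) := by
    have : t * (x₁ * (cosh (x₁ * t) * sinh (x₂ * t))) ≤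
        t * (x₂ * (cosh (x₂ * t) * sinh (x₁ * t))) := by nlinarith
    exact le_of_mul_le_mul_left this ht
  simp only [ker_eq_sinh, kerE_eq_cosh]
  calc _ = (2 * (√(2 * π))⁻¹) ^ 2 * (exp (-(x₁ ^ 2 + t ^ 2) / 2) * exp (-(x₂ ^ 2 + t ^ 2) / 2))
        * (x₁ * (cosh (x₁ * t) * sinh (x₂ * t))) := by ring
    _ ≤ (2 * (√(2 * π))⁻¹) ^ 2 * (exp (-(x₁ ^ 2 + t ^ 2) / 2) * exp (-(x₂ ^ 2 + t ^ 2) / 2))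
        * (x₂ * (cosh (x₂ * t) * sinh (x₁ * t))) := by gcongr
    _ = _ := by ring

/-! ### The conjugate of `u ↦ u² / 2 + ν |u|^q` -/

/-- The ratio `φ'(u) / u` for `φ(u) = ν u ^ q`. -/
def ratio (q ν u : ℝ) : ℝ := ν * q * u ^ (q - 2)

/-- `u + φ'(u)` for `φ(u) = ν u ^ q`. -/
def knot (q ν u : ℝ) : ℝ := u + ν * q * u ^ (q - 1)

/-- The smallest positive maximizer of `y u - u² / 2 - ν |u|^q` over all `y`. -/
def jump (q ν : ℝ) : ℝ := (2 * ν * (1 - q)) ^ (1 / (2 - q))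

/-- The value of `y` from which on `y u - u² / 2 - ν |u|^q` has a nonzero maximizer. -/
def level (q ν : ℝ) : ℝ := knot q ν (jump q ν)

section

variable {q ν : ℝ}

lemma jump_pos (hq : q < 1) (hν : 0 < ν) : 0 < jump q ν := by
  unfold jump
  have : 0 < 1 - q := by linarith
  positivity

lemma jump_rpow (hq : q < 1) (hν : 0 < ν) : jump q ν ^ (2 - q) = 2 * ν * (1 - q) := by
  have : 0 < 1 - q := by linarith
  rw [jump, ← rpow_mul (by positivity), one_div, inv_mul_cancel₀ (by linarith), rpow_one]

lemma knot_eq {u : ℝ} (hu : 0 < u) : knot q ν u = u * (1 + ratio q ν u) := by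
  have : u ^ (q - 1) = u * u ^ (q - 2) := by
    rw [mul_comm, ← rpow_add_one hu.ne']
    congr 1; ring
  rw [knot, ratio, this]; ring

lemma ratio_pos (hq : 0 < q) (hν : 0 < ν) {u : ℝ} (hu : 0 < u) : 0 < ratio q ν u := by
  unfold ratio; positivity

/-- Past the jump the ratio only decreases, so the derivative `1 - (1 - q) * ratio` of `knot` stays
above `1 / 2`. Hence `knot` is invertible there, with reciprocal derivative at most `2`. -/
lemma ratio_jump (hq : q < 1) (hν : 0 < ν) : (1 - q) * ratio q ν (jump q ν) = q / 2 := by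
  have h1 : 0 < 1 - q := by linarith
  have h : jump q ν ^ (q - 2) = (2 * ν * (1 - q))⁻¹ := by
    rw [← jump_rpow hq hν, ← rpow_neg (jump_pos hq hν).le]; congr 1; ring
  rw [ratio, h]
  field_simp

lemma ratio_anti (hq0 : 0 < q) (hq : q < 1) (hν : 0 < ν) {u v : ℝ} (hu : 0 < u) (huv : u ≤ v) :
    ratio q ν v ≤ ratio q ν u := by
  unfold ratio
  exact mul_le_mul_of_nonneg_left (rpow_le_rpow_of_nonpos hu huv (by linarith)) (by positivity)

lemma ratio_le (hq0 : 0 < q) (hq : q < 1) (hν : 0 < ν) {u : ℝ} (hu : jump q ν ≤ u) :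
    (1 - q) * ratio q ν u ≤ q / 2 := by
  rw [← ratio_jump hq hν]
  exact mul_le_mul_of_nonneg_left (ratio_anti hq0 hq hν (jump_pos hq hν) hu) (by linarith)

lemma hasDerivAt_ratio {u : ℝ} (hu : 0 < u) :
    HasDerivAt (ratio q ν) ((q - 2) * ratio q ν u / u) u := by
  have := ((hasDerivAt_id u).rpow_const (p := q - 2) (Or.inl hu.ne')).const_mul (ν * q)
  convert! this using 1
  simp only [ratio, id, one_mul]
  rw [rpow_sub_one hu.ne' (q - 2)]
  field_simp

lemma hasDerivAt_knot {u : ℝ} (hu : 0 < u) :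
    HasDerivAt (knot q ν) (1 - (1 - q) * ratio q ν u) u := by
  have := (hasDerivAt_id u).add
    (((hasDerivAt_id u).rpow_const (p := q - 1) (Or.inl hu.ne')).const_mul (ν * q))
  convert! this using 1
  simp only [ratio, id]
  have : q - 1 - 1 = q - 2 := by ring
  rw [this]; ring

lemma le_knot (hq0 : 0 < q) (hν : 0 < ν) {u : ℝ} (hu : 0 < u) : u ≤ knot q ν u := by
  unfold knot
  have : 0 ≤ ν * q * u ^ (q - 1) := by positivity
  linarith

lemma knot_strictMonoOn (hq0 : 0 < q) (hq : q < 1) (hν : 0 < ν) :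
    StrictMonoOn (knot q ν) (Ici (jump q ν)) := by
  have hp := jump_pos hq hν
  refine strictMonoOn_of_deriv_pos (convex_Ici _)
    (fun u hu => (hasDerivAt_knot (hp.trans_le hu)).continuousAt.continuousWithinAt) ?_
  intro u hu
  rw [interior_Ici] at hu
  rw [(hasDerivAt_knot (hp.trans hu)).deriv]
  have := ratio_le hq0 hq hν (le_of_lt hu)
  linarith

lemma level_pos (hq0 : 0 < q) (hq : q < 1) (hν : 0 < ν) : 0 < level q ν :=
  (jump_pos hq hν).trans_le (le_knot hq0 hν (jump_pos hq hν))

lemma continuousOn_knot (hq : q < 1) (hν : 0 < ν) : ContinuousOn (knot q ν) (Ici (jump q ν)) :=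
  fun _ hu => (hasDerivAt_knot ((jump_pos hq hν).trans_le hu)).continuousAt.continuousWithinAt

lemma integrableOn_of_le_exp {f : ℝ → ℝ} {p C : ℝ} (hf : ContinuousOn f (Ioi p))
    (h : ∀ u ∈ Ioi p, |f u| ≤ C * exp (-u)) : IntegrableOn f (Ioi p) := by
  refine Integrable.mono' ((integrableOn_exp_neg_Ioi p).const_mul C)
    (hf.aestronglyMeasurable measurableSet_Ioi) ?_
  exact (ae_restrict_mem measurableSet_Ioi).mono fun u hu => h u hu

lemma exp_knot_le (hq0 : 0 < q) (hν : 0 < ν) {x K u : ℝ} (hx : x ≤ K) (hu : 0 < u) :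
    exp (1 / 2 + x - knot q ν u) ≤ exp (1 / 2 + K) * exp (-u) := by
  rw [← exp_add]
  exact exp_le_exp.2 (by linarith [le_knot hq0 hν hu])

lemma continuous_kerC (x : ℝ) : Continuous (kerC x) := by
  unfold kerC gpos; fun_prop
lemma continuous_kerQ (x : ℝ) : Continuous (kerQ x) := by
  unfold kerQ; fun_prop
lemma continuous_kerE (x : ℝ) : Continuous (kerE x) := by
  unfold kerE; fun_prop
lemma continuous_ker (x : ℝ) : Continuous (ker x) := by
  unfold ker; fun_prop

lemma continuousOn_comp_knot (hq : q < 1) (hν : 0 < ν) {f : ℝ → ℝ} (hf : Continuous f) :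
    ContinuousOn (fun u => f (knot q ν u)) (Ioi (jump q ν)) :=
  hf.comp_continuousOn ((continuousOn_knot hq hν).mono Ioi_subset_Ici_self)

lemma integrableOn_kerC (hq0 : 0 < q) (hq : q < 1) (hν : 0 < ν) {x : ℝ} (hx : 0 ≤ x) :
    IntegrableOn (fun u => kerC x (knot q ν u)) (Ioi (jump q ν)) := by
  refine integrableOn_of_le_exp (C := 2 * exp (1 / 2 + x))
    (continuousOn_comp_knot hq hν (continuous_kerC x)) fun u hu => ?_
  rw [abs_of_nonneg (kerC_nonneg _ _)]
  have := exp_knot_le hq0 hν (le_refl x) ((jump_pos hq hν).trans hu)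
  linarith [kerC_le (knot q ν u) hx]

lemma integrableOn_kerQ (hq0 : 0 < q) (hq : q < 1) (hν : 0 < ν) {x : ℝ} (hx : 0 ≤ x) :
    IntegrableOn (fun u => kerQ x (knot q ν u)) (Ioi (jump q ν)) := by
  refine integrableOn_of_le_exp (C := 2 * x * exp (1 / 2 + x))
    (continuousOn_comp_knot hq hν (continuous_kerQ x)) fun u hu => ?_
  rw [abs_of_nonneg (kerQ_nonneg _ hx)]
  have := mul_le_mul_of_nonneg_left
    (exp_knot_le hq0 hν (le_refl x) ((jump_pos hq hν).trans hu)) (by positivity : 0 ≤ 2 * x)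
  linarith [kerQ_le (knot q ν u) hx]

lemma hasDerivAt_integral_kerC (hq0 : 0 < q) (hq : q < 1) (hν : 0 < ν) {x : ℝ} (hx : 0 < x) :
    HasDerivAt (fun x => ∫ u in Ioi (jump q ν), kerC x (knot q ν u))
      (∫ u in Ioi (jump q ν), kerQ x (knot q ν u)) x := by
  -- The neighbourhood keeps the parameter nonnegative, as the kernel bounds require, and below `x +
  -- 1`, which makes the dominating function independent of it.
  have hs : Ioo 0 (x + 1) ∈ 𝓝 x := Ioo_mem_nhds hx (by linarith)
  refine (hasDerivAt_integral_of_dominated_loc_of_deriv_le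
    (μ := volume.restrict (Ioi (jump q ν))) (F := fun x u => kerC x (knot q ν u))
    (F' := fun x u => kerQ x (knot q ν u)) (bound := fun u => 2 * (x + 1) * exp (1 / 2 + (x + 1)) * exp (-u)) hs ?_
    (integrableOn_kerC hq0 hq hν hx.le)
    (integrableOn_kerQ hq0 hq hν hx.le).aestronglyMeasurable ?_
    ((integrableOn_exp_neg_Ioi _).const_mul _) ?_).2
  · filter_upwards [hs] with y hy
    exact (integrableOn_kerC hq0 hq hν hy.1.le).aestronglyMeasurable
  · filter_upwards [ae_restrict_mem measurableSet_Ioi] with u hu y hy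
    have h1 := exp_knot_le hq0 hν hy.2.le ((jump_pos hq hν).trans hu)
    rw [Real.norm_eq_abs, abs_of_nonneg (kerQ_nonneg _ hy.1.le)]
    calc kerQ y (knot q ν u) ≤ 2 * y * exp (1 / 2 + y - knot q ν u) := kerQ_le _ hy.1.le
      _ ≤ 2 * (x + 1) * (exp (1 / 2 + (x + 1)) * exp (-u)) := by
          gcongr
          exact hy.2.le
      _ = _ := by ring
  · exact ae_of_all _ fun u y _ => hasDerivAt_kerC y _

lemma hasDerivAt_integral_kerQ (hq0 : 0 < q) (hq : q < 1) (hν : 0 < ν) {x : ℝ} (hx : 0 < x) :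
    IntegrableOn (fun u => kerE x (knot q ν u)) (Ioi (jump q ν)) ∧
    HasDerivAt (fun x => ∫ u in Ioi (jump q ν), kerQ x (knot q ν u))
      (∫ u in Ioi (jump q ν), kerE x (knot q ν u)) x := by
  have hs : Ioo 0 (x + 1) ∈ 𝓝 x := Ioo_mem_nhds hx (by linarith)
  refine hasDerivAt_integral_of_dominated_loc_of_deriv_le
    (μ := volume.restrict (Ioi (jump q ν))) (F := fun x u => kerQ x (knot q ν u))
    (F' := fun x u => kerE x (knot q ν u)) (bound := fun u => 2 * exp (1 / 2 + (x + 1)) * exp (-u)) hs ?_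
    (integrableOn_kerQ hq0 hq hν hx.le)
    ((continuousOn_comp_knot hq hν (continuous_kerE x)).aestronglyMeasurable measurableSet_Ioi) ?_
    ((integrableOn_exp_neg_Ioi _).const_mul _) ?_
  · filter_upwards [hs] with y hy
    exact (integrableOn_kerQ hq0 hq hν hy.1.le).aestronglyMeasurable
  · filter_upwards [ae_restrict_mem measurableSet_Ioi] with u hu y hy
    have h1 := exp_knot_le hq0 hν hy.2.le ((jump_pos hq hν).trans hu)
    rw [Real.norm_eq_abs, abs_of_pos (kerE_pos _ _)]
    calc kerE y (knot q ν u) ≤ 2 * exp (1 / 2 + y - knot q ν u) := kerE_le _ _ hy.1.le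
      _ ≤ 2 * (exp (1 / 2 + (x + 1)) * exp (-u)) := by gcongr
      _ = _ := by ring
  · exact ae_of_all _ fun u y _ => hasDerivAt_kerQ y _

/-! ### The single sign change of the slope. -/

/-- `x` minus the derivative of `E max_u ((x + h) u - u² / 2 - ν |u|^q)`. -/
def slopeGap (q ν x : ℝ) : ℝ :=
  x - jump q ν * kerQ x (level q ν) - ∫ u in Ioi (jump q ν), kerQ x (knot q ν u)

/-- `(1 - q) * slopeGap + x * slopeGap'`. -/
def slopeVar (q ν x : ℝ) : ℝ :=
  (1 - q) * slopeGap q ν x +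
    x * (1 - jump q ν * kerE x (level q ν) - ∫ u in Ioi (jump q ν), kerE x (knot q ν u))

lemma hasDerivAt_slopeGap (hq0 : 0 < q) (hq : q < 1) (hν : 0 < ν) {x : ℝ} (hx : 0 < x) :
    HasDerivAt (slopeGap q ν)
      (1 - jump q ν * kerE x (level q ν) - ∫ u in Ioi (jump q ν), kerE x (knot q ν u)) x :=
  ((hasDerivAt_id x).sub ((hasDerivAt_kerQ x _).const_mul _)).sub
    (hasDerivAt_integral_kerQ hq0 hq hν hx).2

/-- The reciprocal derivative of `knot`. -/
def knotInv (q ν u : ℝ) : ℝ := (1 - (1 - q) * ratio q ν u)⁻¹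

/-- The coefficient of the kernel in the sign analysis of `slopeVar`. -/
def varCoeff (q ν u : ℝ) : ℝ :=
  (1 - q) * (2 - q) * (ratio q ν u / u * knotInv q ν u ^ 2 + u * ratio q ν u ^ 2)

lemma one_sub_ratio_ge (hq0 : 0 < q) (hq : q < 1) (hν : 0 < ν) {u : ℝ} (hu : jump q ν ≤ u) :
    1 / 2 ≤ 1 - (1 - q) * ratio q ν u := by
  linarith [ratio_le hq0 hq hν hu]

lemma knotInv_mem (hq0 : 0 < q) (hq : q < 1) (hν : 0 < ν) {u : ℝ} (hu : jump q ν ≤ u) :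
    0 < knotInv q ν u ∧ knotInv q ν u ≤ 2 := by
  have h := one_sub_ratio_ge hq0 hq hν hu
  refine ⟨inv_pos.2 (by linarith), ?_⟩
  have := inv_anti₀ (by norm_num) h
  simpa [knotInv] using this

lemma hasDerivAt_knotInv (hq0 : 0 < q) (hq : q < 1) (hν : 0 < ν) {u : ℝ} (hu : jump q ν ≤ u) :
    HasDerivAt (knotInv q ν) (-((1 - q) * (2 - q)) * (ratio q ν u / u * knotInv q ν u ^ 2)) u := by
  have hu0 := (jump_pos hq hν).trans_le hu
  have h := one_sub_ratio_ge hq0 hq hν hu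
  have hne : 1 - (1 - q) * ratio q ν u ≠ 0 := by linarith
  have := (((hasDerivAt_ratio (q := q) (ν := ν) hu0).const_mul (1 - q)).const_sub 1).inv hne
  convert! this using 1
  simp only [knotInv]
  field_simp
  ring

lemma varCoeff_nonneg (hq0 : 0 < q) (hq : q < 1) (hν : 0 < ν) {u : ℝ} (hu : jump q ν ≤ u) :
    0 ≤ varCoeff q ν u := by
  have hu0 := (jump_pos hq hν).trans_le hu
  have := ratio_pos hq0 hν hu0
  have h1 : 0 < 1 - q := by linarith
  have h2 : 0 < 2 - q := by linarith
  unfold varCoeff; positivity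

lemma varCoeff_le (hq0 : 0 < q) (hq : q < 1) (hν : 0 < ν) :
    ∃ C, 0 ≤ C ∧ ∀ u, jump q ν ≤ u → varCoeff q ν u ≤ C := by
  have hp := jump_pos hq hν
  have hrp := ratio_pos hq0 hν hp
  have h1 : 0 < 1 - q := by linarith
  have h2 : 0 < 2 - q := by linarith
  refine ⟨(1 - q) * (2 - q) * (ratio q ν (jump q ν) / jump q ν * 2 ^ 2 +
    ν * q * jump q ν ^ (q - 1) * ratio q ν (jump q ν)), by positivity, fun u hu => ?_⟩
  have hu0 := hp.trans_le hu
  have hr := ratio_pos hq0 hν hu0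
  have hk := knotInv_mem hq0 hq hν hu
  have hra := ratio_anti hq0 hq hν hp hu
  have e1 : u * ratio q ν u ^ 2 = ν * q * u ^ (q - 1) * ratio q ν u := by
    have := knot_eq (q := q) (ν := ν) hu0
    unfold knot at this
    have h3 : ν * q * u ^ (q - 1) = u * ratio q ν u := by linarith
    rw [h3]; ring
  have e2 : u ^ (q - 1) ≤ jump q ν ^ (q - 1) := rpow_le_rpow_of_nonpos hp hu (by linarith)
  unfold varCoeff
  rw [e1]
  have := hk.1
  have := hk.2
  gcongr

lemma tendsto_knot_atTop (hq0 : 0 < q) (hν : 0 < ν) : Tendsto (knot q ν) atTop atTop :=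
  tendsto_atTop_mono' _ ((eventually_gt_atTop 0).mono fun _ hu => le_knot hq0 hν hu) tendsto_id

lemma tendsto_kerK (x : ℝ) : Tendsto (kerK x) atTop (𝓝 x) := by
  have h1 : Tendsto (fun t => t - x) atTop atTop := tendsto_atTop_add_const_right _ _ tendsto_id
  have h2 : Tendsto (fun t => t + x) atTop atTop := tendsto_atTop_add_const_right _ _ tendsto_id
  have := ((tendsto_gpdf_atTop.comp h1).sub (tendsto_gpdf_atTop.comp h2)).neg.add
    (((tendsto_gint_atTop.comp h1).add (tendsto_gint_atTop.comp h2)).const_mul x)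
  convert! this using 2
  norm_num

/-- Integration by parts trades `kerQ` and the integrated `kerE` for `ker`. Since `kerK` integrates
`s * ker x s` over `[0, level]`, the kernel enters with positive weight at arguments up to `level`
and negative weight beyond it, apart from a `kerE` term at `level` itself. This one-crossing pattern
is what total positivity can exploit. -/
lemma slopeVar_eq (hq0 : 0 < q) (hq : q < 1) (hν : 0 < ν) {x : ℝ} (hx : 0 < x) :
    IntegrableOn (fun u => varCoeff q ν u * ker x (knot q ν u)) (Ioi (jump q ν)) ∧
    slopeVar q ν x = (2 - q) * kerK x (level q ν) - jump q ν * (x * kerE x (level q ν)) +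
      knotInv q ν (jump q ν) * ker x (level q ν) -
      ∫ u in Ioi (jump q ν), varCoeff q ν u * ker x (knot q ν u) := by
  have hp := jump_pos hq hν
  have hiQ := integrableOn_kerQ hq0 hq hν hx.le
  have hiE := (hasDerivAt_integral_kerQ hq0 hq hν hx).1
  obtain ⟨C, hC0, hC⟩ := varCoeff_le hq0 hq hν
  have hkpos : ∀ u ∈ Ici (jump q ν), 0 < ker x (knot q ν u) := fun u hu =>
    ker_pos hx ((hp.trans_le hu).trans_le (le_knot hq0 hν (hp.trans_le hu)))
  have hiK : IntegrableOn (fun u => varCoeff q ν u * ker x (knot q ν u)) (Ioi (jump q ν)) := by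
    refine integrableOn_of_le_exp (C := C * exp (1 / 2 + x)) (ContinuousOn.mul ?_
      (continuousOn_comp_knot hq hν (continuous_ker x))) fun u hu => ?_
    · intro u hu
      have hu0 : 0 < u := hp.trans hu
      have c1 := (hasDerivAt_ratio (q := q) (ν := ν) hu0).continuousAt
      have c2 := (hasDerivAt_knotInv hq0 hq hν (le_of_lt hu)).continuousAt
      refine ContinuousAt.continuousWithinAt (ContinuousAt.mul continuousAt_const ?_)
      exact ((c1.div continuousAt_id hu0.ne').mul (c2.pow 2)).add (continuousAt_id.mul (c1.pow 2))
    · have h1 := varCoeff_nonneg hq0 hq hν (le_of_lt hu)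
      have h2 := hkpos u (Ioi_subset_Ici_self hu)
      rw [abs_of_nonneg (by positivity), mul_assoc]
      exact mul_le_mul (hC u (le_of_lt hu)) ((ker_le _ _).trans
        (exp_knot_le hq0 hν le_rfl (hp.trans hu))) h2.le hC0
  refine ⟨hiK, ?_⟩
  -- The factor `knotInv` cancels the inner derivative of `knot`, so differentiating the first term
  -- produces `x * kerE` exactly; the other two terms produce `kerQ` and turn the remaining
  -- multiples of `ker` into `varCoeff`. The limit `-(2 - q) * x` at infinity cancels the linear
  -- part of `slopeVar`.
  let W : ℝ → ℝ := fun u => -(knotInv q ν u * ker x (knot q ν u)) -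
    (1 - q) * (u * kerQ x (knot q ν u)) - (2 - q) * kerK x (knot q ν u)
  have hW : ∀ u ∈ Ici (jump q ν), HasDerivAt W
      (varCoeff q ν u * ker x (knot q ν u) -
        ((1 - q) * kerQ x (knot q ν u) + x * kerE x (knot q ν u))) u := by
    intro u hu
    have hu0 := hp.trans_le hu
    have hk := hasDerivAt_knot (q := q) (ν := ν) hu0
    have d1 := (hasDerivAt_knotInv hq0 hq hν hu).mul ((hasDerivAt_ker_right x _).comp u hk)
    have d2 := (hasDerivAt_id u).mul ((hasDerivAt_kerQ_right x _).comp u hk)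
    have d3 := (hasDerivAt_kerK_right x _).comp u hk
    have := (d1.neg.sub (d2.const_mul (1 - q))).sub (d3.const_mul (2 - q))
    convert! this using 1
    have hne : 1 - (1 - q) * ratio q ν u ≠ 0 := by linarith [one_sub_ratio_ge hq0 hq hν hu]
    have hinv : knotInv q ν u * (1 - (1 - q) * ratio q ν u) = 1 := inv_mul_cancel₀ hne
    simp only [Function.comp_apply, id, varCoeff]
    rw [show knotInv q ν u * ((x * kerE x (knot q ν u) - knot q ν u * ker x (knot q ν u)) *
        (1 - (1 - q) * ratio q ν u)) = x * kerE x (knot q ν u) - knot q ν u * ker x (knot q ν u) by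
      rw [mul_comm, mul_assoc, mul_comm (1 - _), hinv, mul_one]]
    rw [knot_eq hu0]
    ring
  have hlim : Tendsto W atTop (𝓝 (-(2 - q) * x)) := by
    have hexp : Tendsto (fun u : ℝ => exp (1 / 2 + x) * exp (-u)) atTop (𝓝 0) := by
      simpa using (tendsto_exp_neg_atTop_nhds_zero).const_mul (exp (1 / 2 + x))
    have huexp : Tendsto (fun u : ℝ => 2 * x * exp (1 / 2 + x) * (u ^ 1 * exp (-u))) atTop
        (𝓝 0) := by
      simpa using (tendsto_pow_mul_exp_neg_atTop_nhds_zero 1).const_mul (2 * x * exp (1 / 2 + x))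
    have t1 : Tendsto (fun u => knotInv q ν u * ker x (knot q ν u)) atTop (𝓝 0) := by
      have h0 : Tendsto (fun u : ℝ => 2 * (exp (1 / 2 + x) * exp (-u))) atTop (𝓝 0) := by
        simpa using hexp.const_mul 2
      refine squeeze_zero' ?_ ?_ h0
      · filter_upwards [eventually_ge_atTop (jump q ν)] with u hu
        exact mul_nonneg (knotInv_mem hq0 hq hν hu).1.le (hkpos u hu).le
      · filter_upwards [eventually_ge_atTop (jump q ν)] with u hu
        exact mul_le_mul (knotInv_mem hq0 hq hν hu).2 ((ker_le _ _).trans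
          (exp_knot_le hq0 hν le_rfl (hp.trans_le hu))) (hkpos u hu).le (by norm_num)
    have t2 : Tendsto (fun u => u * kerQ x (knot q ν u)) atTop (𝓝 0) := by
      refine squeeze_zero' ?_ ?_ huexp
      · filter_upwards [eventually_ge_atTop (jump q ν)] with u hu
        exact mul_nonneg (hp.trans_le hu).le (kerQ_nonneg _ hx.le)
      · filter_upwards [eventually_ge_atTop (jump q ν)] with u hu
        have hu0 := hp.trans_le hu
        calc u * kerQ x (knot q ν u)
            ≤ u * (2 * x * (exp (1 / 2 + x) * exp (-u))) := by
              refine mul_le_mul_of_nonneg_left ((kerQ_le _ hx.le).trans ?_) hu0.le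
              exact mul_le_mul_of_nonneg_left (exp_knot_le hq0 hν le_rfl hu0) (by positivity)
          _ = _ := by ring
    have t3 := (tendsto_kerK x).comp (tendsto_knot_atTop hq0 hν)
    have := (t1.neg.sub (t2.const_mul (1 - q))).sub (t3.const_mul (2 - q))
    convert! this using 2
    ring
  have hint : IntegrableOn (fun u => (1 - q) * kerQ x (knot q ν u) + x * kerE x (knot q ν u))
      (Ioi (jump q ν)) := (hiQ.const_mul (1 - q)).add (hiE.const_mul x)
  have hftc := integral_Ioi_of_hasDerivAt_of_tendsto' hW (hiK.sub hint) hlim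
  rw [integral_sub hiK hint, integral_add (hiQ.const_mul (1 - q)) (hiE.const_mul x),
    integral_const_mul, integral_const_mul] at hftc
  simp only [W] at hftc
  rw [slopeVar, slopeGap]
  have hl : knot q ν (jump q ν) = level q ν := rfl
  rw [hl] at hftc
  linarith

/-- Divided by `ker x τ` with `τ = level q ν`, each term of `slopeVar_eq` is nonincreasing in `x`:
kernel values below `τ` lose weight relative to `ker x τ`, those above gain weight but carry a minus
sign, and `x * kerE / ker` increases. A nonincreasing function stays nonpositive. -/
lemma slopeVar_nonpos_of_le (hq0 : 0 < q) (hq : q < 1) (hν : 0 < ν) {x₁ x₂ : ℝ} (hx₁ : 0 < x₁)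
    (hx : x₁ ≤ x₂) (h : slopeVar q ν x₁ ≤ 0) : slopeVar q ν x₂ ≤ 0 := by
  have hx₂ := hx₁.trans_le hx
  have hp := jump_pos hq hν
  have hτ := level_pos hq0 hq hν
  obtain ⟨hi1, he1⟩ := slopeVar_eq hq0 hq hν hx₁
  obtain ⟨hi2, he2⟩ := slopeVar_eq hq0 hq hν hx₂
  have hk1 := ker_pos hx₁ hτ
  have hk2 := ker_pos hx₂ hτ
  set τ := level q ν with hτdef
  have t1 : kerK x₂ τ * ker x₁ τ ≤ kerK x₁ τ * ker x₂ τ := by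
    rw [kerK_eq_integral, kerK_eq_integral, ← intervalIntegral.integral_mul_const,
      ← intervalIntegral.integral_mul_const]
    have hc : ∀ x y : ℝ, Continuous fun s => s * ker x s * ker y τ := by
      intro x y; unfold ker; fun_prop
    refine intervalIntegral.integral_mono_on_of_le_Ioo hτ.le ((hc _ _).intervalIntegrable _ _)
      ((hc _ _).intervalIntegrable _ _) fun s hs => ?_
    have := mul_le_mul_of_nonneg_left (ker_totally_positive hx₁ hx hs.1 hs.2.le) hs.1.le
    linarith
  have t2 := kerE_mul_ker_le hx₁ hx hτ
  have t3 : (∫ u in Ioi (jump q ν), varCoeff q ν u * ker x₁ (knot q ν u)) * ker x₂ τ ≤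
      (∫ u in Ioi (jump q ν), varCoeff q ν u * ker x₂ (knot q ν u)) * ker x₁ τ := by
    rw [← integral_mul_const, ← integral_mul_const]
    refine setIntegral_mono_on (hi1.mul_const _) (hi2.mul_const _) measurableSet_Ioi fun u hu => ?_
    have hle : τ ≤ knot q ν u :=
      (knot_strictMonoOn hq0 hq hν).monotoneOn (mem_Ici.2 le_rfl) (Ioi_subset_Ici_self hu)
        (le_of_lt hu)
    have := mul_le_mul_of_nonneg_left (ker_totally_positive hx₁ hx hτ hle)
      (varCoeff_nonneg hq0 hq hν (le_of_lt hu))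
    linarith
  have key : slopeVar q ν x₂ * ker x₁ τ ≤ slopeVar q ν x₁ * ker x₂ τ := by
    rw [he1, he2]
    have t1' := mul_le_mul_of_nonneg_left t1 (by linarith : 0 ≤ 2 - q)
    have t2' := mul_le_mul_of_nonneg_left t2 hp.le
    nlinarith [mul_comm (ker x₁ τ) (ker x₂ τ)]
  by_contra hcon
  push Not at hcon
  have h1 := mul_pos hcon hk1
  have h2 := mul_nonpos_of_nonpos_of_nonneg h hk2.le
  linarith

/-- `ν x ^ q - x² / 2 + E max_u ((x + h) u - u² / 2 - ν |u|^q)`. -/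
def gainFun (q ν x : ℝ) : ℝ :=
  ν * x ^ q - x ^ 2 / 2 + (jump q ν * kerC x (level q ν) +
    ∫ u in Ioi (jump q ν), kerC x (knot q ν u))

lemma hasDerivAt_gainFun (hq0 : 0 < q) (hq : q < 1) (hν : 0 < ν) {x : ℝ} (hx : 0 < x) :
    HasDerivAt (gainFun q ν) (x ^ (q - 1) * (ν * q - x ^ (1 - q) * slopeGap q ν x)) x := by
  have h1 := ((hasDerivAt_id x).rpow_const (p := q) (Or.inl hx.ne')).const_mul ν
  have h2 := (hasDerivAt_pow 2 x).div_const 2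
  have h3 := ((hasDerivAt_kerC x (level q ν)).const_mul (jump q ν)).add
    (hasDerivAt_integral_kerC hq0 hq hν hx)
  convert! (h1.sub h2).add h3 using 1
  have : x ^ (q - 1) * x ^ (1 - q) = 1 := by
    rw [← rpow_add hx]; simp
  simp only [id, slopeGap]
  rw [mul_sub, ← mul_assoc (x ^ (q - 1)) (x ^ (1 - q)), this]
  push_cast
  ring

lemma hasDerivAt_rpow_mul_slopeGap (hq0 : 0 < q) (hq : q < 1) (hν : 0 < ν) {x : ℝ} (hx : 0 < x) :
    HasDerivAt (fun x => x ^ (1 - q) * slopeGap q ν x) (x ^ (-q) * slopeVar q ν x) x := by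
  have h1 := (hasDerivAt_id x).rpow_const (p := 1 - q) (Or.inl hx.ne')
  convert! h1.mul (hasDerivAt_slopeGap hq0 hq hν hx) using 1
  have e1 : x ^ (1 - q) = x ^ (-q) * x := by
    rw [← rpow_add_one hx.ne']; congr 1; ring
  have e2 : (1 - q - 1) = -q := by ring
  simp only [id]
  rw [e1, e2, slopeVar]; ring

/-- A bounded `gainFun` is quasiconcave. -/
lemma gainFun_quasiconcave (hq0 : 0 < q) (hq : q < 1) (hν : 0 < ν) {B : ℝ}
    (hB : ∀ x, 0 < x → gainFun q ν x ≤ B) {x₁ x x₂ : ℝ} (hx₁ : 0 < x₁) (h1 : x₁ < x) (h2 : x < x₂) :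
    min (gainFun q ν x₁) (gainFun q ν x₂) ≤ gainFun q ν x := by
  by_contra hcon
  push Not at hcon
  obtain ⟨hc1, hc2⟩ := lt_min_iff.1 hcon
  set R : ℝ → ℝ := fun x => x ^ (1 - q) * slopeGap q ν x with hR
  have hdg : ∀ y, 0 < y → HasDerivAt (gainFun q ν) (y ^ (q - 1) * (ν * q - R y)) y :=
    fun y hy => hasDerivAt_gainFun hq0 hq hν hy
  have hdR : ∀ y, 0 < y → HasDerivAt R (y ^ (-q) * slopeVar q ν y) y :=
    fun y hy => hasDerivAt_rpow_mul_slopeGap hq0 hq hν hy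
  -- A valley at `x` yields a point of negative slope followed by one of positive slope, so `R`
  -- passes from above `ν * q` to below it.
  obtain ⟨ξ₁, hξ₁, e1⟩ := exists_hasDerivAt_eq_slope (gainFun q ν) _ h1
    (fun y hy => (hdg y (hx₁.trans_le hy.1)).continuousAt.continuousWithinAt)
    (fun y hy => hdg y (hx₁.trans hy.1))
  obtain ⟨ξ₂, hξ₂, e2⟩ := exists_hasDerivAt_eq_slope (gainFun q ν) _ h2
    (fun y hy => (hdg y ((hx₁.trans h1).trans_le hy.1)).continuousAt.continuousWithinAt)
    (fun y hy => hdg y ((hx₁.trans h1).trans hy.1))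
  have hξ₁0 := hx₁.trans hξ₁.1
  have hξ : ξ₁ < ξ₂ := hξ₁.2.trans hξ₂.1
  have hξ₂0 := hξ₁0.trans hξ
  have hR1 : ν * q < R ξ₁ := by
    have : ξ₁ ^ (q - 1) * (ν * q - R ξ₁) < 0 := by
      rw [e1]; exact div_neg_of_neg_of_pos (by linarith) (by linarith)
    have h3 : 0 < ξ₁ ^ (q - 1) := by positivity
    by_contra hn
    have := mul_nonneg h3.le (sub_nonneg.2 (not_lt.1 hn))
    linarith
  have hR2 : R ξ₂ < ν * q := by
    have : 0 < ξ₂ ^ (q - 1) * (ν * q - R ξ₂) := by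
      rw [e2]; exact div_pos (by linarith) (by linarith)
    have h3 : 0 < ξ₂ ^ (q - 1) := by positivity
    linarith [(mul_pos_iff_of_pos_left h3).1 this]
  -- `R` has fallen somewhere between, so `slopeVar` is nonpositive at some `η` and hence at every
  -- later point: `R` never recovers.
  obtain ⟨η, hη, e3⟩ := exists_hasDerivAt_eq_slope R _ hξ
    (fun y hy => (hdR y (hξ₁0.trans_le hy.1)).continuousAt.continuousWithinAt)
    (fun y hy => hdR y (hξ₁0.trans hy.1))
  have hη0 := hξ₁0.trans hη.1
  have hVη : slopeVar q ν η ≤ 0 := by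
    by_contra hn
    have h3 : 0 < η ^ (-q) := by positivity
    have h4 := mul_pos h3 (not_le.1 hn)
    rw [e3] at h4
    have : (R ξ₂ - R ξ₁) / (ξ₂ - ξ₁) < 0 := div_neg_of_neg_of_pos (by linarith) (by linarith)
    linarith
  have hRanti : ∀ y, ξ₂ ≤ y → R y ≤ R ξ₂ := by
    have : AntitoneOn R (Ici ξ₂) := by
      refine antitoneOn_of_deriv_nonpos (convex_Ici _)
        (fun y hy => (hdR y (hξ₂0.trans_le hy)).continuousAt.continuousWithinAt)
        (fun y hy => (hdR y (hξ₂0.trans_le (interior_subset hy))).differentiableAt.differentiableWithinAt)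
        fun y hy => ?_
      have hy' : ξ₂ ≤ y := interior_subset hy
      have hy0 := hξ₂0.trans_le hy'
      rw [(hdR y hy0).deriv]
      exact mul_nonpos_of_nonneg_of_nonpos (by positivity)
        (slopeVar_nonpos_of_le hq0 hq hν hη0 (hη.2.le.trans hy') hVη)
    exact fun y hy => this (mem_Ici.2 le_rfl) (mem_Ici.2 hy) hy
  set δ := ν * q - R ξ₂ with hδ
  have hδ0 : 0 < δ := by linarith
  -- From `ξ₂` on the slope of `gainFun` is at least `δ * y ^ (q - 1)`, so `gainFun` outgrows any
  -- bound like `y ^ q`, against `hB`.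
  have hmono : MonotoneOn (fun y => gainFun q ν y - δ / q * y ^ q) (Ici ξ₂) := by
    have hd : ∀ y, ξ₂ ≤ y → HasDerivAt (fun y => gainFun q ν y - δ / q * y ^ q)
        (y ^ (q - 1) * (ν * q - R y) - δ / q * (q * y ^ (q - 1))) y := fun y hy =>
      (hdg y (hξ₂0.trans_le hy)).sub
        ((hasDerivAt_rpow_const (Or.inl (hξ₂0.trans_le hy).ne')).const_mul _)
    refine monotoneOn_of_deriv_nonneg (convex_Ici _)
      (fun y hy => (hd y hy).continuousAt.continuousWithinAt)
      (fun y hy => (hd y (interior_subset hy)).differentiableAt.differentiableWithinAt)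
      fun y hy => ?_
    have hy' : ξ₂ ≤ y := interior_subset hy
    rw [(hd y hy').deriv]
    have h3 : 0 < y ^ (q - 1) := rpow_pos_of_pos (hξ₂0.trans_le hy') _
    have h4 : δ / q * (q * y ^ (q - 1)) = δ * y ^ (q - 1) := by field_simp
    rw [h4]
    nlinarith [hRanti y hy']
  have htop : Tendsto (fun y : ℝ => δ / q * y ^ q) atTop atTop :=
    (tendsto_rpow_atTop hq0).const_mul_atTop (by positivity)
  obtain ⟨y, hy1, hy2⟩ := ((htop.eventually_gt_atTop
    (B - (gainFun q ν ξ₂ - δ / q * ξ₂ ^ q))).and (eventually_ge_atTop ξ₂)).exists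
  have h5 := hmono (mem_Ici.2 le_rfl) (mem_Ici.2 hy2) hy2
  have h6 := hB y (hξ₂0.trans_le hy2)
  simp only at h5
  linarith

end

/-! ### The objective and its pointwise supremum -/

lemma absPow_zero_right (q : ℝ) : absPow q 0 = 0 := by simp [absPow]

lemma absPow_of_ne {t : ℝ} (q : ℝ) (ht : t ≠ 0) : absPow q t = |t| ^ q := by simp [absPow, ht]

lemma absPow_nonneg (q t : ℝ) : 0 ≤ absPow q t := by
  unfold absPow; split_ifs <;> positivity

lemma absPow_neg (q t : ℝ) : absPow q (-t) = absPow q t := by simp [absPow]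

lemma absPow_abs (q t : ℝ) : absPow q |t| = absPow q t := by simp [absPow]

lemma absPow_mul (q : ℝ) {c : ℝ} (hc : 0 < c) (t : ℝ) :
    absPow q (c * t) = c ^ q * absPow q t := by
  by_cases ht : t = 0
  · simp [ht, absPow]
  · rw [absPow_of_ne q (mul_ne_zero hc.ne' ht), absPow_of_ne q ht, abs_mul, abs_of_pos hc,
      mul_rpow hc.le (abs_nonneg t)]

lemma absPow_add_le {q : ℝ} (hq0 : 0 ≤ q) (hq1 : q ≤ 1) (s t : ℝ) :
    absPow q (s + t) ≤ absPow q s + absPow q t := by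
  by_cases hs : s = 0
  · simp [hs, absPow_zero_right]
  by_cases ht : t = 0
  · simp [ht, absPow_zero_right]
  by_cases hst : s + t = 0
  · rw [hst, absPow_zero_right]
    exact add_nonneg (absPow_nonneg _ _) (absPow_nonneg _ _)
  rw [absPow_of_ne q hs, absPow_of_ne q ht, absPow_of_ne q hst]
  exact (rpow_le_rpow (abs_nonneg _) (abs_add_le s t) hq0).trans
    (rpow_add_le_add_rpow (abs_nonneg _) (abs_nonneg _) hq0 hq1)

lemma absPow_sub_le {q : ℝ} (hq0 : 0 ≤ q) (hq1 : q ≤ 1) (s t : ℝ) :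
    absPow q s - absPow q t ≤ absPow q (s - t) := by
  have := absPow_add_le hq0 hq1 (s - t) t
  rw [sub_add_cancel] at this
  linarith

lemma absPow_le_one_add {q : ℝ} (hq0 : 0 ≤ q) (hq1 : q ≤ 1) (t : ℝ) : absPow q t ≤ 1 + |t| := by
  by_cases ht : t = 0
  · simp [ht, absPow_zero_right]
  rw [absPow_of_ne q ht]
  rcases le_total |t| 1 with h | h
  · have := rpow_le_one (abs_nonneg t) h hq0
    linarith [abs_nonneg t]
  · have := rpow_le_rpow_of_exponent_le h hq1
    rw [rpow_one] at this
    linarith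

/-- The objective of `I₁`. -/
def gain (q : ℝ) (γ ν : ℝ≥0) (x h w : ℝ) : ℝ :=
  h * w - ν * absPow q (x + w) + ν * absPow q x - γ * w ^ 2

/-- The integrand of `I₁`. -/
def supGain (q : ℝ) (γ ν : ℝ≥0) (x h : ℝ) : ℝ≥0∞ := ⨆ w : ℝ, ENNReal.ofReal (gain q γ ν x h w)

lemma I₁_eq (q : ℝ) (γ ν : ℝ≥0) (x : ℝ) :
    I₁ q γ ν x = ∫⁻ h, supGain q γ ν x h ∂(gaussianReal 0 1) := rfl

lemma gain_zero_right (q : ℝ) (γ ν : ℝ≥0) (x h : ℝ) : gain q γ ν x h 0 = 0 := by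
  simp [gain]

lemma ofReal_gain_le (q : ℝ) (γ ν : ℝ≥0) (x h w : ℝ) :
    ENNReal.ofReal (gain q γ ν x h w) ≤ supGain q γ ν x h :=
  le_iSup (fun w => ENNReal.ofReal (gain q γ ν x h w)) w

lemma lowerSemicontinuous_supGain (q : ℝ) (γ ν : ℝ≥0) (x : ℝ) :
    LowerSemicontinuous (supGain q γ ν x) := by
  refine lowerSemicontinuous_iSup fun w => Continuous.lowerSemicontinuous
    (ENNReal.continuous_ofReal.comp ?_)
  unfold gain; fun_prop

lemma measurable_supGain (q : ℝ) (γ ν : ℝ≥0) (x : ℝ) : Measurable (supGain q γ ν x) :=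
  (lowerSemicontinuous_supGain q γ ν x).measurable

lemma supGain_neg_neg (q : ℝ) (γ ν : ℝ≥0) (x h : ℝ) :
    supGain q γ ν (-x) (-h) = supGain q γ ν x h := by
  unfold supGain
  rw [← (Equiv.neg ℝ).iSup_comp]
  refine iSup_congr fun w => ?_
  simp only [gain, Equiv.neg_apply]
  rw [← neg_add, absPow_neg, absPow_neg, neg_mul_neg, neg_sq]

/-- At base point `0` the penalty is even in `w`, so the sign of `w` may be matched to that of `h`.
-/
lemma I₂_eq (q : ℝ) (γ ν : ℝ≥0) : I₂ q γ ν = I₁ q γ ν 0 := by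
  rw [I₁_eq]
  refine lintegral_congr fun h => le_antisymm (iSup_le fun w => ?_) (iSup_le fun w => ?_)
  · rcases le_total 0 (h * w) with hh | hh
    · refine le_trans (ENNReal.ofReal_le_ofReal ?_) (ofReal_gain_le q γ ν 0 h w)
      rw [← abs_mul, abs_of_nonneg hh]
      simp [gain, absPow_zero_right]
    · refine le_trans (ENNReal.ofReal_le_ofReal ?_) (ofReal_gain_le q γ ν 0 h (-w))
      rw [← abs_mul, abs_of_nonpos hh]
      simp [gain, absPow_zero_right, absPow_neg]
  · refine le_trans (ENNReal.ofReal_le_ofReal ?_) (le_iSup (fun w : ℝ =>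
      ENNReal.ofReal (|h| * |w| - ν * absPow q w - γ * w ^ 2)) w)
    have := le_abs_self (h * w)
    rw [abs_mul] at this
    simpa [gain, absPow_zero_right] using this

/-- An integrable bound for the objective, uniform in `x`. -/
def gainBound (γ ν : ℝ≥0) (h : ℝ) : ℝ := ν + (|h| + ν) ^ 2 / (4 * γ)

lemma gainBound_nonneg (γ ν : ℝ≥0) (h : ℝ) : 0 ≤ gainBound γ ν h := by
  unfold gainBound; positivity

/-- Subadditivity of `|·|^q` bounds the penalty difference by `ν (1 + |w|)` whatever `x` is; the
quadratic term then caps the remaining linear growth. -/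
lemma gain_le {q : ℝ} (hq0 : 0 ≤ q) (hq1 : q ≤ 1) {γ : ℝ≥0} (hγ : 0 < γ) (ν : ℝ≥0) (x h w : ℝ) :
    gain q γ ν x h w ≤ gainBound γ ν h := by
  have h1 : absPow q x - absPow q (x + w) ≤ 1 + |w| := by
    have := absPow_sub_le hq0 hq1 x (x + w)
    have h2 := absPow_le_one_add hq0 hq1 (x - (x + w))
    have h3 : |x - (x + w)| = |w| := by rw [sub_add_cancel_left, abs_neg]
    linarith
  have hγ' : (0 : ℝ) < γ := hγ
  have h2 : h * w ≤ |h| * |w| := by rw [← abs_mul]; exact le_abs_self _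
  have h3 := mul_le_mul_of_nonneg_left h1 ν.coe_nonneg
  have h4 : (|h| + ν) * |w| - γ * w ^ 2 ≤ (|h| + ν) ^ 2 / (4 * γ) := by
    rw [le_div_iff₀ (by positivity), ← sq_abs w]
    nlinarith [sq_nonneg (|h| + ν - 2 * γ * |w|)]
  unfold gain gainBound
  linarith

lemma supGain_le {q : ℝ} (hq0 : 0 ≤ q) (hq1 : q ≤ 1) {γ : ℝ≥0} (hγ : 0 < γ) (ν : ℝ≥0) (x h : ℝ) :
    supGain q γ ν x h ≤ ENNReal.ofReal (gainBound γ ν h) :=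
  iSup_le fun w => ENNReal.ofReal_le_ofReal (gain_le hq0 hq1 hγ ν x h w)

lemma integrable_sq_gaussianReal : Integrable (fun h : ℝ => h ^ 2) (gaussianReal 0 1) := by
  have := (memLp_id_gaussianReal (μ := 0) (v := 1) 2).integrable_sq
  simpa using this

lemma integrable_abs_gaussianReal : Integrable (fun h : ℝ => |h|) (gaussianReal 0 1) := by
  have := (memLp_id_gaussianReal (μ := 0) (v := 1) 1)
  have := (memLp_one_iff_integrable.1 (by simpa using this)).abs
  simpa using this

lemma integrable_gainBound (γ ν : ℝ≥0) : Integrable (gainBound γ ν) (gaussianReal 0 1) := by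
  have : gainBound γ ν = fun h => ν + (h ^ 2 + 2 * ν * |h| + ν ^ 2) * (4 * (γ : ℝ))⁻¹ := by
    funext h
    rw [gainBound, div_eq_mul_inv, ← sq_abs h]; ring
  rw [this]
  exact (integrable_const _).add (((integrable_sq_gaussianReal.add
    (integrable_abs_gaussianReal.const_mul _)).add (integrable_const _)).mul_const _)

lemma lintegral_gainBound_lt_top (γ ν : ℝ≥0) :
    ∫⁻ h, ENNReal.ofReal (gainBound γ ν h) ∂(gaussianReal 0 1) < ∞ :=
  (integrable_gainBound γ ν).lintegral_lt_top

/-- Scaling to `γ = 1 / 2`. -/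
lemma supGain_scale (q : ℝ) {γ : ℝ≥0} (hγ : 0 < γ) (ν : ℝ≥0) (x h : ℝ) :
    supGain q γ ν x h = ENNReal.ofReal (2 * γ)⁻¹ *
      supGain q (1 / 2) (ν * (2 * γ) ^ (1 - q)) (2 * γ * x) h := by
  have hγ' : (0 : ℝ) < γ := hγ
  rw [supGain, supGain, ENNReal.mul_iSup,
    ← (Equiv.mulLeft₀ (2 * (γ : ℝ)) (by positivity)).iSup_comp
      (g := fun w => ENNReal.ofReal (2 * γ)⁻¹ *
        ENNReal.ofReal (gain q (1 / 2) (ν * (2 * γ) ^ (1 - q)) (2 * γ * x) h w))]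
  refine iSup_congr fun w => ?_
  rw [← ENNReal.ofReal_mul (by positivity)]
  congr 1
  simp only [gain]
  rw [show (Equiv.mulLeft₀ (2 * (γ : ℝ)) (by positivity)) w = 2 * γ * w from rfl, ← mul_add,
    absPow_mul q (by positivity), absPow_mul q (by positivity)]
  have e : (2 * (γ : ℝ)) ^ (1 - q) * (2 * (γ : ℝ)) ^ q = 2 * γ := by
    rw [← rpow_add (by positivity)]; simp
  push_cast
  have e2 : ∀ z : ℝ, (ν : ℝ) * (2 * (γ : ℝ)) ^ (1 - q) * ((2 * (γ : ℝ)) ^ q * z) =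
      2 * γ * (ν * z) := by
    intro z
    calc _ = ν * ((2 * (γ : ℝ)) ^ (1 - q) * (2 * (γ : ℝ)) ^ q) * z := by ring
      _ = _ := by rw [e]; ring
  rw [e2, e2]
  field_simp

lemma I₁_scale (q : ℝ) {γ : ℝ≥0} (hγ : 0 < γ) (ν : ℝ≥0) (x : ℝ) :
    I₁ q γ ν x = ENNReal.ofReal (2 * γ)⁻¹ *
      I₁ q (1 / 2) (ν * (2 * γ) ^ (1 - q)) (2 * γ * x) := by
  rw [I₁_eq, I₁_eq, ← lintegral_const_mul _ (measurable_supGain _ _ _ _)]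
  exact lintegral_congr fun h => supGain_scale q hγ ν x h

/-! ### Quasiconcavity for `0 < q < 1` -/

section

variable {q ν : ℝ}

/-- `sup_u (y u - u² / 2 - ν |u|^q)` written as an integral over the inverse of the maximizer. -/
def conj (q ν y : ℝ) : ℝ≥0∞ :=
  ENNReal.ofReal (jump q ν) * ENNReal.ofReal (|y| - level q ν) +
    ∫⁻ u in Ioi (jump q ν), ENNReal.ofReal (|y| - knot q ν u)

lemma measurable_knot : Measurable (knot q ν) := by unfold knot; fun_prop

lemma measurable_conj : Measurable (conj q ν) := by
  have hk := measurable_knot (q := q) (ν := ν)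
  have h1 : Measurable fun y : ℝ =>
      ENNReal.ofReal (jump q ν) * ENNReal.ofReal (|y| - level q ν) := by fun_prop
  unfold conj
  refine h1.add ?_
  exact Measurable.lintegral_prod_right' (f := fun z : ℝ × ℝ => ENNReal.ofReal (|z.1| - knot q ν z.2))
    (by fun_prop)

/-- At `y = level q ν` the points `0` and `jump q ν` tie: the objective vanishes at both. -/
lemma jump_sq (hq : q < 1) (hν : 0 < ν) :
    jump q ν ^ 2 / 2 + ν * jump q ν ^ q = level q ν * jump q ν := by
  have hp := jump_pos hq hν
  have h := jump_rpow hq hν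
  have e1 : jump q ν ^ 2 = jump q ν ^ (2 - q) * jump q ν ^ q := by
    rw [← rpow_add hp, sub_add_cancel, rpow_two]
  have e2 : jump q ν ^ (q - 1) * jump q ν = jump q ν ^ q := by
    rw [← rpow_add_one hp.ne', sub_add_cancel]
  rw [level, knot, add_mul, mul_assoc, e2, ← sq, e1, h]
  ring

lemma hasDerivAt_potential (y : ℝ) {u : ℝ} (hu : 0 < u) :
    HasDerivAt (fun u => y * u - u ^ 2 / 2 - ν * u ^ q) (y - knot q ν u) u := by
  have := (((hasDerivAt_id u).const_mul y).sub ((hasDerivAt_pow 2 u).div_const 2)).sub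
    ((hasDerivAt_rpow_const (p := q) (Or.inl hu.ne')).const_mul ν)
  convert! this using 1
  rw [knot]; push_cast; ring

/-- Per unit of `v` the cost is `v / 2 + ν v ^ (q - 1)`. It decreases up to `jump q ν`, where its
derivative vanishes, and its value there is `level q ν`. -/
lemma level_mul_le (hq : q < 1) (hν : 0 < ν) {v : ℝ} (hv : 0 < v)
    (hvp : v ≤ jump q ν) : level q ν * v ≤ v ^ 2 / 2 + ν * v ^ q := by
  have hp := jump_pos hq hν
  have hd : ∀ u : ℝ, 0 < u → HasDerivAt (fun u => u / 2 + ν * u ^ (q - 1))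
      (1 / 2 + ν * ((q - 1) * u ^ (q - 1 - 1))) u := fun u hu =>
    ((hasDerivAt_id u).div_const 2).add
      ((hasDerivAt_rpow_const (p := q - 1) (Or.inl hu.ne')).const_mul ν)
  have hanti : AntitoneOn (fun u => u / 2 + ν * u ^ (q - 1)) (Icc v (jump q ν)) := by
    refine antitoneOn_of_deriv_nonpos (convex_Icc _ _)
      (fun u hu => (hd u (hv.trans_le hu.1)).continuousAt.continuousWithinAt)
      (fun u hu => (hd u (hv.trans_le (interior_subset hu).1)).differentiableAt.differentiableWithinAt)
      fun u hu => ?_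
    have hu' := interior_subset hu
    have hu0 : 0 < u := hv.trans_le hu'.1
    rw [(hd u hu0).deriv]
    have h1 : jump q ν ^ (q - 2) ≤ u ^ (q - 2) := rpow_le_rpow_of_nonpos hu0 hu'.2 (by linarith)
    have h2 : jump q ν ^ (q - 2) = (2 * ν * (1 - q))⁻¹ := by
      rw [← jump_rpow hq hν, ← rpow_neg hp.le]; congr 1; ring
    have h3 : 0 < 1 - q := by linarith
    rw [h2] at h1
    have h4 : 1 / 2 ≤ ν * (1 - q) * u ^ (q - 2) := by
      calc (1 : ℝ) / 2 = ν * (1 - q) * (2 * ν * (1 - q))⁻¹ := by field_simp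
        _ ≤ _ := by gcongr
    rw [show q - 1 - 1 = q - 2 by ring]
    linarith
  have h := hanti (left_mem_Icc.2 hvp) (right_mem_Icc.2 hvp) hvp
  simp only at h
  have h1 : ∀ u : ℝ, 0 < u → (u / 2 + ν * u ^ (q - 1)) * u = u ^ 2 / 2 + ν * u ^ q := by
    intro u hu
    have : u ^ (q - 1) * u = u ^ q := by rw [← rpow_add_one hu.ne', sub_add_cancel]
    rw [add_mul, mul_assoc, this]; ring
  have h2 := h1 _ hp
  rw [jump_sq hq hν] at h2
  rw [mul_right_cancel₀ hp.ne' h2] at h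
  rw [← h1 v hv]
  exact mul_le_mul_of_nonneg_right h hv.le

/-- `conj` is the maximum of `y v - v² / 2 - ν |v|^q`. -/
lemma exists_conj_eq (hq0 : 0 < q) (hq : q < 1) (hν : 0 < ν) {y : ℝ} (hy : 0 ≤ y) :
    ∃ v, 0 ≤ v ∧ 0 ≤ y * v - v ^ 2 / 2 - ν * absPow q v ∧
      conj q ν y = ENNReal.ofReal (y * v - v ^ 2 / 2 - ν * absPow q v) ∧
      ∀ v', 0 ≤ v' → y * v' - v' ^ 2 / 2 - ν * absPow q v' ≤ y * v - v ^ 2 / 2 - ν * absPow q v := by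
  have hp := jump_pos hq hν
  have hmono := knot_strictMonoOn hq0 hq hν
  have hap : ∀ u : ℝ, 0 < u → absPow q u = u ^ q := fun u hu => by
    rw [absPow_of_ne q hu.ne', abs_of_pos hu]
  have hlev : ∀ u, jump q ν ≤ u → level q ν ≤ knot q ν u := fun u hu =>
    hmono.monotoneOn (mem_Ici.2 le_rfl) (mem_Ici.2 hu) hu
  have hcontP : ∀ y u : ℝ, 0 < u → ContinuousAt (fun u => y * u - u ^ 2 / 2 - ν * u ^ q) u :=
    fun y u hu => (hasDerivAt_potential y hu).continuousAt
  -- Up to `level` the maximizer is `0`: before the jump by `level_mul_le`, after it because the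
  -- objective at `y = level` decreases from its value `0` at the jump.
  rcases le_or_gt y (level q ν) with hyl | hyl
  · refine ⟨0, le_rfl, by simp [absPow_zero_right], ?_, fun v' hv' => ?_⟩
    · have h1 : ∀ u ∈ Ioi (jump q ν), ENNReal.ofReal (|y| - knot q ν u) = 0 := fun u hu => by
        rw [abs_of_nonneg hy]
        exact ENNReal.ofReal_of_nonpos (by linarith [hlev u (le_of_lt hu)])
      rw [conj, setLIntegral_congr_fun measurableSet_Ioi h1, abs_of_nonneg hy,
        ENNReal.ofReal_of_nonpos (p := y - level q ν) (by linarith)]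
      simp [absPow_zero_right]
    · rcases hv'.eq_or_lt with rfl | hv0
      · exact le_rfl
      rw [absPow_zero_right, hap v' hv0]
      have key : level q ν * v' ≤ v' ^ 2 / 2 + ν * v' ^ q := by
        rcases le_total v' (jump q ν) with h | h
        · exact level_mul_le hq hν hv0 h
        have hanti : AntitoneOn (fun u => level q ν * u - u ^ 2 / 2 - ν * u ^ q)
            (Ici (jump q ν)) := by
          refine antitoneOn_of_deriv_nonpos (convex_Ici _)
            (fun u hu => (hcontP _ u (hp.trans_le hu)).continuousWithinAt)
            (fun u hu => (hasDerivAt_potential _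
              (hp.trans_le (interior_subset hu))).differentiableAt.differentiableWithinAt)
            fun u hu => ?_
          rw [(hasDerivAt_potential _ (hp.trans_le (interior_subset hu))).deriv]
          linarith [hlev u (interior_subset hu)]
        have h2 := hanti (mem_Ici.2 le_rfl) (mem_Ici.2 h) h
        simp only at h2
        linarith [jump_sq hq hν]
      have := mul_le_mul_of_nonneg_right hyl hv0.le
      linarith
  -- Above `level` the winner is the stationary point past the jump; the upper end of the interval
  -- is admissible because `u ≤ knot q ν u`.
  · obtain ⟨v, hv, hvy⟩ : ∃ v ∈ Icc (jump q ν) (max (jump q ν) y), knot q ν v = y := by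
      have hsub := intermediate_value_Icc (le_max_left (jump q ν) y)
        ((continuousOn_knot hq hν).mono Icc_subset_Ici_self)
      obtain ⟨v, hv, e⟩ := hsub ⟨hyl.le, (le_max_right (jump q ν) y).trans
        (le_knot hq0 hν (lt_max_of_lt_left hp))⟩
      exact ⟨v, hv, e⟩
    have hpv := hv.1
    have hv0 : 0 < v := hp.trans_le hpv
    have hmax : ∀ v', 0 ≤ v' →
        y * v' - v' ^ 2 / 2 - ν * absPow q v' ≤ y * v - v ^ 2 / 2 - ν * v ^ q := by
      have hM : MonotoneOn (fun u => y * u - u ^ 2 / 2 - ν * u ^ q) (Icc (jump q ν) v) := by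
        refine monotoneOn_of_deriv_nonneg (convex_Icc _ _)
          (fun u hu => (hcontP _ u (hp.trans_le hu.1)).continuousWithinAt)
          (fun u hu => (hasDerivAt_potential _
            (hp.trans_le (interior_subset hu).1)).differentiableAt.differentiableWithinAt)
          fun u hu => ?_
        have hu' := interior_subset hu
        rw [(hasDerivAt_potential _ (hp.trans_le hu'.1)).deriv, ← hvy]
        exact sub_nonneg.2 (hmono.monotoneOn hu'.1 hpv hu'.2)
      have hA : AntitoneOn (fun u => y * u - u ^ 2 / 2 - ν * u ^ q) (Ici v) := by
        refine antitoneOn_of_deriv_nonpos (convex_Ici _)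
          (fun u hu => (hcontP _ u (hv0.trans_le hu)).continuousWithinAt)
          (fun u hu => (hasDerivAt_potential _
            (hv0.trans_le (interior_subset hu))).differentiableAt.differentiableWithinAt)
          fun u hu => ?_
        have hu' : v ≤ u := interior_subset hu
        rw [(hasDerivAt_potential _ (hv0.trans_le hu')).deriv, ← hvy]
        exact sub_nonpos.2 (hmono.monotoneOn hpv (mem_Ici.2 (hpv.trans hu')) hu')
      have hpM := hM (left_mem_Icc.2 hpv) (right_mem_Icc.2 hpv) hpv
      simp only at hpM
      have hjs := jump_sq hq hν
      have hyp : 0 ≤ (y - level q ν) * jump q ν := mul_nonneg (by linarith) hp.le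
      intro v' hv'
      rcases hv'.eq_or_lt with rfl | hv'0
      · simp only [absPow_zero_right]; nlinarith
      rw [hap v' hv'0]
      rcases le_total v' (jump q ν) with h | h
      · have h1 := level_mul_le hq hν hv'0 h
        have h2 : (y - level q ν) * v' ≤ (y - level q ν) * jump q ν :=
          mul_le_mul_of_nonneg_left h (by linarith)
        nlinarith
      rcases le_total v' v with h' | h'
      · exact hM ⟨h, h'⟩ (right_mem_Icc.2 hpv) h'
      · exact hA (mem_Ici.2 le_rfl) (mem_Ici.2 h') h'
    have hval0 : 0 ≤ y * v - v ^ 2 / 2 - ν * v ^ q := by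
      simpa [absPow_zero_right] using hmax 0 le_rfl
    refine ⟨v, hv0.le, by rwa [hap v hv0], ?_, by rwa [hap v hv0]⟩
    rw [hap v hv0, conj, abs_of_nonneg hy]
    -- The maximum is the value at the jump, `jump * (y - level)`, plus the integral of the
    -- derivative `y - knot` from the jump to `v`; beyond `v` the positive part is zero.
    have hint : ∫⁻ u in Ioi (jump q ν), ENNReal.ofReal (y - knot q ν u) =
        ENNReal.ofReal (∫ u in jump q ν..v, (y - knot q ν u)) := by
      have hcont : ContinuousOn (fun u => y - knot q ν u) (Icc (jump q ν) v) :=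
        continuousOn_const.sub ((continuousOn_knot hq hν).mono Icc_subset_Ici_self)
      rw [intervalIntegral.integral_of_le hpv, ofReal_integral_eq_lintegral_ofReal
        ((hcont.integrableOn_Icc).mono_set Ioc_subset_Icc_self)
        ((ae_restrict_mem measurableSet_Ioc).mono fun u hu => by
          have := hmono.monotoneOn (mem_Ici.2 hu.1.le) hpv hu.2
          simp only [Pi.zero_apply]; linarith),
        ← lintegral_indicator measurableSet_Ioi, ← lintegral_indicator measurableSet_Ioc]
      refine lintegral_congr fun u => ?_
      by_cases h1 : u ∈ Ioc (jump q ν) v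
      · rw [indicator_of_mem h1, indicator_of_mem (Ioc_subset_Ioi_self h1)]
      · rw [indicator_of_notMem h1]
        by_cases h2 : u ∈ Ioi (jump q ν)
        · rw [indicator_of_mem h2]
          have h3 : v < u := by
            by_contra h; exact h1 ⟨h2, not_lt.1 h⟩
          have := hmono.monotoneOn hpv (mem_Ici.2 (hpv.trans h3.le)) h3.le
          exact ENNReal.ofReal_of_nonpos (by linarith)
        · rw [indicator_of_notMem h2]
    have hFTC : ∫ u in jump q ν..v, (y - knot q ν u) =
        (y * v - v ^ 2 / 2 - ν * v ^ q) -
          (y * jump q ν - jump q ν ^ 2 / 2 - ν * jump q ν ^ q) := by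
      refine intervalIntegral.integral_eq_sub_of_hasDerivAt
        (f := fun u => y * u - u ^ 2 / 2 - ν * u ^ q) (fun u hu => ?_) ?_
      · rw [uIcc_of_le hpv] at hu
        exact hasDerivAt_potential y (hp.trans_le hu.1)
      · refine ContinuousOn.intervalIntegrable ?_
        rw [uIcc_of_le hpv]
        exact continuousOn_const.sub ((continuousOn_knot hq hν).mono Icc_subset_Ici_self)
    have hjs := jump_sq hq hν
    have hnn : 0 ≤ ∫ u in jump q ν..v, (y - knot q ν u) :=
      intervalIntegral.integral_nonneg hpv fun u hu => by
        have := hmono.monotoneOn hu.1 hpv hu.2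
        linarith
    rw [hint, ← ENNReal.ofReal_mul hp.le,
      ← ENNReal.ofReal_add (mul_nonneg hp.le (by linarith)) hnn, hFTC]
    congr 1
    linarith

/-- For `γ = 1 / 2` the substitution `u = x + w` turns `h w - w² / 2` into `(x + h) u - u² / 2 - h x
- x² / 2`, so inside the maximum `x` only shifts the linear coefficient. -/
lemma supGain_eq_conj (hq0 : 0 < q) (hq : q < 1) {ν : ℝ≥0} (hν : 0 < ν) {x : ℝ} (hx : 0 < x)
    (h : ℝ) :
    conj q ν (x + h) ≠ ∞ ∧ 0 ≤ (conj q ν (x + h)).toReal + (ν * x ^ q - x ^ 2 / 2 - h * x) ∧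
    supGain q (1 / 2) ν x h =
      ENNReal.ofReal ((conj q ν (x + h)).toReal + (ν * x ^ q - x ^ 2 / 2 - h * x)) := by
  obtain ⟨v, hv0, hnn, heq, hmax⟩ := exists_conj_eq hq0 hq (ν := ν) hν (abs_nonneg (x + h))
  have hc : conj q ν (x + h) = conj q ν |x + h| := by simp [conj]
  have hg : ∀ w : ℝ, gain q (1 / 2) ν x h w = ((x + h) * (x + w) - (x + w) ^ 2 / 2 -
      ν * absPow q (x + w)) + (ν * x ^ q - x ^ 2 / 2 - h * x) := by
    intro w
    rw [gain, absPow_of_ne q hx.ne', abs_of_pos hx]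
    push_cast
    ring
  have hle : ∀ w : ℝ, gain q (1 / 2) ν x h w ≤
      (conj q ν (x + h)).toReal + (ν * x ^ q - x ^ 2 / 2 - h * x) := by
    intro w
    rw [hg, hc, heq, ENNReal.toReal_ofReal hnn]
    have h1 := hmax |x + w| (abs_nonneg _)
    rw [absPow_abs, sq_abs] at h1
    have h2 : (x + h) * (x + w) ≤ |x + h| * |x + w| := by
      rw [← abs_mul]; exact le_abs_self _
    linarith
  have hat : ∃ w : ℝ, gain q (1 / 2) ν x h w =
      (conj q ν (x + h)).toReal + (ν * x ^ q - x ^ 2 / 2 - h * x) := by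
    rw [hc, heq, ENNReal.toReal_ofReal hnn]
    rcases le_total 0 (x + h) with hs | hs
    · refine ⟨v - x, ?_⟩
      rw [hg, add_sub_cancel, abs_of_nonneg hs]
    · refine ⟨-v - x, ?_⟩
      rw [hg, add_sub_cancel, abs_of_nonpos hs, absPow_neg]
      ring
  refine ⟨by rw [hc, heq]; exact ENNReal.ofReal_ne_top, ?_, le_antisymm (iSup_le fun w =>
    ENNReal.ofReal_le_ofReal (hle w)) ?_⟩
  · have := hle 0
    rwa [gain_zero_right] at this
  · obtain ⟨w, hw⟩ := hat
    rw [← hw]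
    exact ofReal_gain_le q (1 / 2) ν x h w

lemma lintegral_conj (hq0 : 0 < q) (hq : q < 1) (hν : 0 < ν) {x : ℝ} (hx : 0 < x) :
    ∫⁻ h, conj q ν (x + h) ∂(gaussianReal 0 1) =
      ENNReal.ofReal (jump q ν * kerC x (level q ν) +
        ∫ u in Ioi (jump q ν), kerC x (knot q ν u)) := by
  have hp := jump_pos hq hν
  have hk := measurable_knot (q := q) (ν := ν)
  unfold conj
  rw [lintegral_add_left (by fun_prop), lintegral_const_mul _ (by fun_prop),
    lintegral_kerC (level_pos hq0 hq hν).le, lintegral_lintegral_swap (by fun_prop),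
    setLIntegral_congr_fun measurableSet_Ioi (fun u hu => lintegral_kerC
      ((hp.trans hu).le.trans (le_knot hq0 hν (hp.trans hu)))),
    ← ofReal_integral_eq_lintegral_ofReal (integrableOn_kerC hq0 hq hν hx.le)
      (ae_of_all _ fun u => kerC_nonneg _ _), ← ENNReal.ofReal_mul hp.le,
    ← ENNReal.ofReal_add (mul_nonneg hp.le (kerC_nonneg _ _))
      (integral_nonneg fun u => kerC_nonneg _ _)]

lemma I₁_eq_gainFun (hq0 : 0 < q) (hq : q < 1) {ν : ℝ≥0} (hν : 0 < ν) {x : ℝ} (hx : 0 < x) :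
    0 ≤ gainFun q ν x ∧ I₁ q (1 / 2) ν x = ENNReal.ofReal (gainFun q ν x) := by
  have hp := jump_pos hq (ν := ν) hν
  have hlin := lintegral_conj hq0 hq (ν := ν) hν hx
  have hm : Measurable fun h => conj q ν (x + h) := measurable_conj.comp (by fun_prop)
  have hi1 : Integrable (fun h => (conj q ν (x + h)).toReal) (gaussianReal 0 1) :=
    integrable_toReal_of_lintegral_ne_top hm.aemeasurable (by rw [hlin]; exact ENNReal.ofReal_ne_top)
  have hid : Integrable (fun h : ℝ => h) (gaussianReal 0 1) := by
    have := (memLp_id_gaussianReal (μ := 0) (v := 1) 1)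
    exact memLp_one_iff_integrable.1 (by simpa using! this)
  have hi2 : Integrable (fun h => (ν : ℝ) * x ^ q - x ^ 2 / 2 - h * x) (gaussianReal 0 1) :=
    (integrable_const _).sub (hid.mul_const x)
  have hint : ∫ h, ((conj q ν (x + h)).toReal + (ν * x ^ q - x ^ 2 / 2 - h * x))
      ∂(gaussianReal 0 1) = gainFun q ν x := by
    rw [integral_add hi1 hi2, integral_toReal hm.aemeasurable
      (ae_of_all _ fun h => (supGain_eq_conj hq0 hq hν hx h).1.lt_top), hlin,
      ENNReal.toReal_ofReal, integral_sub (integrable_const _) (hid.mul_const x),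
      integral_mul_const]
    · have : ∫ h : ℝ, h ∂(gaussianReal 0 1) = 0 := by simp
      rw [this]
      simp [gainFun]; ring
    · exact add_nonneg (mul_nonneg hp.le (kerC_nonneg _ _)) (integral_nonneg fun u => kerC_nonneg _ _)
  constructor
  · rw [← hint]
    exact integral_nonneg fun h => (supGain_eq_conj hq0 hq hν hx h).2.1
  · have := ofReal_integral_eq_lintegral_ofReal (hi1.add hi2)
      (ae_of_all _ fun h => (supGain_eq_conj hq0 hq hν hx h).2.1)
    simp only [Pi.add_apply] at this
    rw [← hint, this, I₁_eq]
    exact lintegral_congr fun h => (supGain_eq_conj hq0 hq hν hx h).2.2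

end

/-! ### Quasiconcavity for all `q` -/

lemma I₁_half_quasiconcave_of_mem_Ioo {q : ℝ} (hq0 : 0 < q) (hq : q < 1) {ν : ℝ≥0} (hν : 0 < ν)
    {x₁ x x₂ : ℝ} (hx₁ : 0 < x₁) (h1 : x₁ < x) (h2 : x < x₂) :
    min (I₁ q (1 / 2) ν x₁) (I₁ q (1 / 2) ν x₂) ≤ I₁ q (1 / 2) ν x := by
  have hx := hx₁.trans h1
  have hB : ∀ x, 0 < x → gainFun q ν x ≤
      (∫⁻ h, ENNReal.ofReal (gainBound (1 / 2) ν h) ∂(gaussianReal 0 1)).toReal := by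
    intro x hx
    obtain ⟨h0, he⟩ := I₁_eq_gainFun hq0 hq hν hx
    rw [← ENNReal.ofReal_le_iff_le_toReal (lintegral_gainBound_lt_top _ _).ne, ← he]
    exact lintegral_mono fun h => supGain_le hq0.le hq.le (by norm_num) ν x h
  rw [(I₁_eq_gainFun hq0 hq hν hx).2, (I₁_eq_gainFun hq0 hq hν hx₁).2,
    (I₁_eq_gainFun hq0 hq hν (hx.trans h2)).2, ← ENNReal.ofReal_min]
  exact ENNReal.ofReal_le_ofReal (gainFun_quasiconcave hq0 hq hν hB hx₁ h1 h2)

/-- For `q = 1` the inequality `|y + w| - |x + w| ≤ y - x` gives monotonicity for each fixed `h` and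
`w`. -/
lemma supGain_monotone_of_one (γ ν : ℝ≥0) {x y : ℝ} (hx : 0 < x) (hxy : x ≤ y) (h : ℝ) :
    supGain 1 γ ν x h ≤ supGain 1 γ ν y h := by
  refine iSup_mono fun w => ENNReal.ofReal_le_ofReal ?_
  unfold gain
  have h1 : ∀ t, absPow 1 t = |t| := fun t => by
    by_cases ht : t = 0
    · simp [ht, absPow]
    · rw [absPow_of_ne 1 ht, rpow_one]
  rw [h1, h1, h1, h1, abs_of_pos hx, abs_of_pos (hx.trans_le hxy)]
  have h2 : |y + w| ≤ |x + w| + (y - x) := by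
    have := abs_add_le (x + w) (y - x)
    rwa [abs_of_nonneg (sub_nonneg.2 hxy), show x + w + (y - x) = y + w by ring] at this
  nlinarith [mul_le_mul_of_nonneg_left h2 ν.coe_nonneg]

lemma I₁_monotone_of_one (γ ν : ℝ≥0) {x y : ℝ} (hx : 0 < x) (hxy : x ≤ y) :
    I₁ 1 γ ν x ≤ I₁ 1 γ ν y :=
  lintegral_mono fun h => supGain_monotone_of_one γ ν hx hxy h

/-- For `q = 0` only two moves compete: `w = h`, which ignores the penalty, and `w = -x`, which
kills the coordinate and collects `ν`. If they coincide, that move also gains `ν`. -/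
lemma supGain_half_of_zero (ν : ℝ≥0) {x : ℝ} (hx : x ≠ 0) (h : ℝ) :
    supGain 0 (1 / 2) ν x h =
      ENNReal.ofReal (h ^ 2 / 2) + ENNReal.ofReal (ν - (x + h) ^ 2 / 2) := by
  have hap : ∀ t : ℝ, t ≠ 0 → absPow 0 t = 1 := fun t ht => by rw [absPow_of_ne 0 ht, rpow_zero]
  have hle1 : ∀ t : ℝ, 0 ≤ absPow 0 t := absPow_nonneg 0
  have hmax : ENNReal.ofReal (h ^ 2 / 2) + ENNReal.ofReal (ν - (x + h) ^ 2 / 2) =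
      ENNReal.ofReal (max (h ^ 2 / 2) (h ^ 2 / 2 + (ν - (x + h) ^ 2 / 2))) := by
    rcases le_total 0 (ν - (x + h) ^ 2 / 2) with h0 | h0
    · rw [max_eq_right (by linarith), ENNReal.ofReal_add (by positivity) h0]
    · rw [max_eq_left (by linarith), ENNReal.ofReal_of_nonpos h0, add_zero]
  rw [hmax]
  refine le_antisymm (iSup_le fun w => ENNReal.ofReal_le_ofReal ?_) ?_
  · unfold gain
    push_cast
    by_cases hw : x + w = 0
    · refine le_max_of_le_right ?_
      have : w = -x := by linarith
      rw [hw, absPow_zero_right, hap x hx, this]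
      nlinarith
    · refine le_max_of_le_left ?_
      rw [hap _ hw, hap x hx]
      nlinarith [sq_nonneg (h - w)]
  · rw [ENNReal.ofReal_max]
    refine max_le ?_ ?_
    · by_cases hw : x + h = 0
      · refine le_trans (ENNReal.ofReal_le_ofReal ?_)
          (ofReal_gain_le 0 (1 / 2) ν x h h)
        unfold gain
        rw [hw, absPow_zero_right, hap x hx]
        push_cast
        nlinarith [ν.coe_nonneg]
      · refine le_trans (ENNReal.ofReal_le_ofReal ?_)
          (ofReal_gain_le 0 (1 / 2) ν x h h)
        unfold gain
        rw [hap _ hw, hap x hx]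
        push_cast
        nlinarith
    · refine le_trans (ENNReal.ofReal_le_ofReal ?_)
        (ofReal_gain_le 0 (1 / 2) ν x h (-x))
      unfold gain
      rw [add_neg_cancel, absPow_zero_right, hap x hx]
      push_cast
      nlinarith

/-- The integrand is even and decreasing in distance from `0`, so moving the Gaussian centre away
from `0` can only reduce its mean. Pairing `z` with its mirror image `x + y - z` writes the
difference of the integrals through products of two factors of equal sign. -/
lemma integral_shift_antitone (ν : ℝ) {x y : ℝ} (hx : 0 < x) (hxy : x ≤ y) :
    ∫ h, gpdf h * max (ν - (y + h) ^ 2 / 2) 0 ≤ ∫ h, gpdf h * max (ν - (x + h) ^ 2 / 2) 0 := by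
  set F : ℝ → ℝ := fun z => max (ν - z ^ 2 / 2) 0 with hF
  have hFc : Continuous F := by fun_prop
  have hFb : ∀ z, ‖F z‖ ≤ |ν| := fun z => by
    rw [Real.norm_eq_abs, abs_of_nonneg (le_max_right _ _)]
    exact max_le ((by nlinarith [sq_nonneg z, le_abs_self ν])) (abs_nonneg _)
  have hi : ∀ a : ℝ, Integrable fun z => gpdf (z - a) * F z := fun a =>
    (integrable_gpdf.comp_sub_right a).mul_bdd (c := |ν|) hFc.aestronglyMeasurable
      (ae_of_all _ hFb)
  have hshift : ∀ a : ℝ, ∫ h, gpdf h * F (a + h) = ∫ z, gpdf (z - a) * F z := fun a => by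
    rw [← integral_sub_right_eq_self (fun h => gpdf h * F (a + h)) a]
    simp
  rw [hshift, hshift, ← sub_nonneg, ← integral_sub (hi x) (hi y)]
  set H : ℝ → ℝ := fun z => gpdf (z - x) * F z - gpdf (z - y) * F z with hH
  have hHi : Integrable H := (hi x).sub (hi y)
  have hrefl : ∫ z, H (x + y - z) = ∫ z, H z := integral_sub_left_eq_self H volume (x + y)
  have hsum : 0 ≤ ∫ z, (H z + H (x + y - z)) := by
    refine integral_nonneg fun z => ?_
    have e1 : gpdf (x + y - z - x) = gpdf (z - y) := by
      rw [← gpdf_neg]; congr 1; ring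
    have e2 : gpdf (x + y - z - y) = gpdf (z - x) := by
      rw [← gpdf_neg]; congr 1; ring
    simp only [hH, Pi.zero_apply]
    rw [e1, e2]
    have hg : ∀ a b : ℝ, a ^ 2 ≤ b ^ 2 → gpdf b ≤ gpdf a := fun a b hab => by
      unfold gpdf
      gcongr
    have hFm : ∀ a b : ℝ, a ^ 2 ≤ b ^ 2 → F b ≤ F a := fun a b hab =>
      max_le_max (by linarith) le_rfl
    have e3 : (x + y - z) ^ 2 - z ^ 2 = (x + y) * (x + y - 2 * z) := by ring
    have e4 : (z - y) ^ 2 - (z - x) ^ 2 = (y - x) * (x + y - 2 * z) := by ring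
    have key : 0 ≤ (F z - F (x + y - z)) * (gpdf (z - x) - gpdf (z - y)) := by
      rcases le_total (2 * z) (x + y) with hz | hz
      · refine mul_nonneg (sub_nonneg.2 (hFm _ _ ?_)) (sub_nonneg.2 (hg _ _ ?_))
        · nlinarith [mul_nonneg (by linarith : 0 ≤ x + y) (by linarith : 0 ≤ x + y - 2 * z)]
        · nlinarith [mul_nonneg (by linarith : 0 ≤ y - x) (by linarith : 0 ≤ x + y - 2 * z)]
      · refine mul_nonneg_of_nonpos_of_nonpos (sub_nonpos.2 (hFm _ _ ?_))
          (sub_nonpos.2 (hg _ _ ?_))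
        · nlinarith [mul_nonneg (by linarith : 0 ≤ x + y) (by linarith : 0 ≤ 2 * z - (x + y))]
        · nlinarith [mul_nonneg (by linarith : 0 ≤ y - x) (by linarith : 0 ≤ 2 * z - (x + y))]
    nlinarith
  rw [integral_add hHi (hHi.comp_sub_left (x + y)), hrefl] at hsum
  linarith

lemma I₁_half_antitone_of_zero (ν : ℝ≥0) {x y : ℝ} (hx : 0 < x) (hxy : x ≤ y) :
    I₁ 0 (1 / 2) ν y ≤ I₁ 0 (1 / 2) ν x := by
  have hval : ∀ a : ℝ, 0 < a → I₁ 0 (1 / 2) ν a =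
      ∫⁻ h, ENNReal.ofReal (h ^ 2 / 2) ∂(gaussianReal 0 1) +
        ENNReal.ofReal (∫ h, gpdf h * max (ν - (a + h) ^ 2 / 2) 0) := by
    intro a ha
    have hi : Integrable (fun h => max ((ν : ℝ) - (a + h) ^ 2 / 2) 0) (gaussianReal 0 1) := by
      refine Integrable.of_bound (by fun_prop) (ν : ℝ) (ae_of_all _ fun h => ?_)
      rw [Real.norm_eq_abs, abs_of_nonneg (le_max_right _ _)]
      exact max_le (by nlinarith [sq_nonneg (a + h)]) ν.coe_nonneg
    rw [I₁_eq, lintegral_congr fun h => supGain_half_of_zero ν ha.ne' h,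
      lintegral_add_left (by fun_prop), ← integral_gaussianReal (fun h => max (ν - (a + h) ^ 2 / 2) 0),
      ofReal_integral_eq_lintegral_ofReal hi (ae_of_all _ fun h => le_max_right _ _)]
    congr 1
    refine lintegral_congr fun h => ?_
    rw [ENNReal.ofReal_max, ENNReal.ofReal_zero, max_eq_left zero_le]
  rw [hval x hx, hval y (hx.trans_le hxy)]
  exact add_le_add_right (ENNReal.ofReal_le_ofReal (integral_shift_antitone ν hx hxy)) _

lemma I₁_eq_of_nu_zero (q : ℝ) (γ : ℝ≥0) (x y : ℝ) : I₁ q γ 0 x = I₁ q γ 0 y := by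
  simp [I₁]

/-- `I₁` is quasiconcave in `x > 0`. -/
lemma I₁_quasiconcave {q : ℝ} (hq0 : 0 ≤ q) (hq1 : q ≤ 1) {γ : ℝ≥0} (hγ : 0 < γ) (ν : ℝ≥0)
    {x₁ x x₂ : ℝ} (hx₁ : 0 < x₁) (h1 : x₁ ≤ x) (h2 : x ≤ x₂) :
    min (I₁ q γ ν x₁) (I₁ q γ ν x₂) ≤ I₁ q γ ν x := by
  rcases h1.eq_or_lt with rfl | h1
  · exact min_le_left _ _
  rcases h2.eq_or_lt with rfl | h2
  · exact min_le_right _ _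
  rcases eq_or_ne ν 0 with rfl | hν
  · rw [I₁_eq_of_nu_zero q γ x₁ x]
    exact min_le_left _ _
  have hν0 : 0 < ν := pos_iff_ne_zero.2 hν
  have hγ' : (0 : ℝ) < γ := hγ
  have key : ∀ ν : ℝ≥0, 0 < ν → ∀ x₁ x x₂ : ℝ, 0 < x₁ → x₁ < x → x < x₂ →
      min (I₁ q (1 / 2) ν x₁) (I₁ q (1 / 2) ν x₂) ≤ I₁ q (1 / 2) ν x := by
    intro ν hν x₁ x x₂ hx₁ h1 h2
    rcases hq0.eq_or_lt with rfl | hq0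
    · exact (min_le_right _ _).trans (I₁_half_antitone_of_zero ν (hx₁.trans h1) h2.le)
    rcases hq1.eq_or_lt with rfl | hq1
    · exact (min_le_left _ _).trans (I₁_monotone_of_one _ ν hx₁ h1.le)
    · exact I₁_half_quasiconcave_of_mem_Ioo hq0 hq1 hν hx₁ h1 h2
  -- Scaling multiplies all base points by `2 * γ` and changes `ν` in a way that does not depend on
  -- them, so `γ = 1 / 2` suffices.
  rw [I₁_scale q hγ ν x₁, I₁_scale q hγ ν x, I₁_scale q hγ ν x₂, ← mul_min]
  gcongr
  have h2γ : (0 : ℝ) < 2 * γ := by positivity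
  refine key _ (by positivity) _ _ _ (mul_pos h2γ hx₁) ?_ ?_
  · exact mul_lt_mul_of_pos_left h1 h2γ
  · exact mul_lt_mul_of_pos_left h2 h2γ

/-! ### Continuity of the objective in `x` -/

lemma continuous_absPow {q : ℝ} (hq : 0 < q) : Continuous (absPow q) := by
  have : absPow q = fun t => |t| ^ q := by
    funext t
    by_cases ht : t = 0
    · simp [ht, absPow, hq.ne']
    · exact absPow_of_ne q ht
  rw [this]
  exact continuous_abs.rpow_const fun _ => Or.inr hq.le

/-- A modulus of continuity from subadditivity. For `q = 0` the error does not tend to zero, which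
is why that exponent needs its explicit formula below. -/
lemma supGain_le_add {q : ℝ} (hq0 : 0 ≤ q) (hq1 : q ≤ 1) (γ ν : ℝ≥0) (x y h : ℝ) :
    supGain q γ ν x h ≤ supGain q γ ν y h + ENNReal.ofReal (2 * ν * absPow q (x - y)) := by
  refine iSup_le fun w => ?_
  refine le_trans (ENNReal.ofReal_le_ofReal (q := gain q γ ν y h w + 2 * ν * absPow q (x - y)) ?_)
    (ENNReal.ofReal_add_le.trans (by gcongr; exact ofReal_gain_le q γ ν y h w))
  have h1 := absPow_sub_le hq0 hq1 x y
  have h2 := absPow_sub_le hq0 hq1 (y + w) (x + w)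
  have h3 : absPow q (y + w - (x + w)) = absPow q (x - y) := by
    rw [← absPow_neg]; congr 1; ring
  rw [h3] at h2
  have h4 := mul_le_mul_of_nonneg_left h1 ν.coe_nonneg
  have h5 := mul_le_mul_of_nonneg_left h2 ν.coe_nonneg
  unfold gain
  linarith

lemma continuous_supGain_left {q : ℝ} (hq0 : 0 < q) (hq1 : q ≤ 1) {γ : ℝ≥0} (hγ : 0 < γ)
    (ν : ℝ≥0) (h : ℝ) : Continuous fun x => supGain q γ ν x h := by
  refine continuous_iff_continuousAt.2 fun x => ?_
  have hlim : Tendsto (fun y => ENNReal.ofReal (2 * ν * absPow q (y - x))) (𝓝 x) (𝓝 0) := by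
    have : Continuous fun y => ENNReal.ofReal (2 * ν * absPow q (y - x)) :=
      ENNReal.continuous_ofReal.comp
        (((continuous_absPow hq0).comp (continuous_id.sub continuous_const)).const_mul _)
    have h2 := this.tendsto x
    simpa [absPow_zero_right] using h2
  have hfin : supGain q γ ν x h ≠ ∞ :=
    ((supGain_le hq0.le hq1 hγ ν x h).trans_lt ENNReal.ofReal_lt_top).ne
  refine tendsto_of_tendsto_of_tendsto_of_le_of_le
    (g := fun y => supGain q γ ν x h - ENNReal.ofReal (2 * ν * absPow q (y - x)))
    (h := fun y => supGain q γ ν x h + ENNReal.ofReal (2 * ν * absPow q (y - x))) ?_ ?_ ?_ ?_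
  · have := ENNReal.Tendsto.sub (tendsto_const_nhds (x := supGain q γ ν x h)) hlim (Or.inl hfin)
    simpa using this
  · simpa using tendsto_const_nhds.add hlim
  · intro y
    rw [tsub_le_iff_right]
    have h1 := supGain_le_add hq0.le hq1 γ ν x y h
    rwa [← absPow_neg, neg_sub] at h1
  · intro y
    exact supGain_le_add hq0.le hq1 γ ν y x h

lemma supGain_of_zero {γ : ℝ≥0} (hγ : 0 < γ) (ν : ℝ≥0) {x : ℝ} (hx : x ≠ 0) (h : ℝ) :
    supGain 0 γ ν x h = ENNReal.ofReal (2 * γ)⁻¹ * (ENNReal.ofReal (h ^ 2 / 2) +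
        ENNReal.ofReal ((ν * (2 * γ) ^ (1 - 0 : ℝ) : ℝ≥0) - (2 * γ * x + h) ^ 2 / 2)) := by
  have hγ' : (0 : ℝ) < γ := hγ
  rw [supGain_scale 0 hγ, supGain_half_of_zero _ (mul_ne_zero (by positivity) hx)]

lemma continuous_supGain_of_zero_aux (c d : ℝ≥0) (h : ℝ) :
    Continuous fun x : ℝ => ENNReal.ofReal (2 * c)⁻¹ * (ENNReal.ofReal (h ^ 2 / 2) +
        ENNReal.ofReal (d - (2 * c * x + h) ^ 2 / 2)) := by
  refine (ENNReal.continuous_const_mul ENNReal.ofReal_ne_top).comp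
    (continuous_const.add (ENNReal.continuous_ofReal.comp ?_))
  fun_prop

lemma tendsto_supGain_nhds {q : ℝ} (hq0 : 0 ≤ q) (hq1 : q ≤ 1) {γ : ℝ≥0} (hγ : 0 < γ)
    (ν : ℝ≥0) {x : ℝ} (hx : 0 < x) (h : ℝ) :
    Tendsto (fun y => supGain q γ ν y h) (𝓝 x) (𝓝 (supGain q γ ν x h)) := by
  rcases hq0.eq_or_lt with rfl | hq
  · rw [supGain_of_zero hγ ν hx.ne']
    refine ((continuous_supGain_of_zero_aux γ _ h).tendsto x).congr' ?_
    filter_upwards [lt_mem_nhds hx] with y hy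
    rw [supGain_of_zero hγ ν (ne_of_gt hy)]
  · exact (continuous_supGain_left hq hq1 hγ ν h).tendsto x

lemma supGain_zero_left_le {γ ν : ℝ≥0} {x : ℝ} (hx : x ≠ 0) (h : ℝ) :
    supGain 0 γ ν 0 h ≤ supGain 0 γ ν x h := by
  have hap : ∀ t : ℝ, t ≠ 0 → absPow 0 t = 1 := fun t ht => by rw [absPow_of_ne 0 ht, rpow_zero]
  have hle : ∀ t : ℝ, absPow 0 t ≤ 1 := fun t => by
    by_cases ht : t = 0
    · simp [ht, absPow_zero_right]
    · exact (hap t ht).le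
  refine iSup_le fun w => le_trans (ENNReal.ofReal_le_ofReal ?_) (ofReal_gain_le 0 γ ν x h w)
  unfold gain
  rw [hap x hx, absPow_zero_right, zero_add]
  have h1 := mul_le_mul_of_nonneg_left (hle (x + w)) ν.coe_nonneg
  have h2 := mul_nonneg ν.coe_nonneg (absPow_nonneg 0 w)
  linarith

/-- For `q = 0` the right limit at `0` need not be the value at `0`: a tiny nonzero coordinate can
still be removed for a profit `ν`. The one-sided comparison is what lets a bound for `x > 0` pass to
`I₂`. -/
lemma exists_tendsto_supGain_zero {q : ℝ} (hq0 : 0 ≤ q) (hq1 : q ≤ 1) {γ : ℝ≥0} (hγ : 0 < γ)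
    (ν : ℝ≥0) : ∃ Z : ℝ → ℝ≥0∞, (∀ h, supGain q γ ν 0 h ≤ Z h) ∧
      ∀ h, Tendsto (fun y => supGain q γ ν y h) (𝓝[>] 0) (𝓝 (Z h)) := by
  rcases hq0.eq_or_lt with rfl | hq
  · have hlim : ∀ h, Tendsto (fun y => supGain 0 γ ν y h) (𝓝[>] 0) _ := fun h =>
      (((continuous_supGain_of_zero_aux γ (ν * (2 * γ) ^ (1 - 0 : ℝ)) h).tendsto 0).mono_left
        nhdsWithin_le_nhds).congr' (by
          filter_upwards [self_mem_nhdsWithin] with y hy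
          rw [supGain_of_zero hγ ν (ne_of_gt hy)])
    refine ⟨_, fun h => ?_, hlim⟩
    refine ge_of_tendsto (hlim h) ?_
    filter_upwards [self_mem_nhdsWithin] with y hy
    exact supGain_zero_left_le (ne_of_gt hy) h
  · exact ⟨supGain q γ ν 0, fun h => le_rfl, fun h =>
      ((continuous_supGain_left hq hq1 hγ ν h).tendsto 0).mono_left nhdsWithin_le_nhds⟩

/-- A number `a` in `(0, 1]` satisfies `a ≤ a ^ q`; take `a = (x - K) / x`. -/
lemma rpow_sub_rpow_le {q : ℝ} (hq1 : q < 1) {K x : ℝ} (hK : 0 ≤ K) (hx : K < x) :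
    x ^ q - (x - K) ^ q ≤ K * x ^ (q - 1) := by
  have hx0 : 0 < x := hK.trans_lt hx
  have h1 : (x - K) / x ≤ ((x - K) / x) ^ q := by
    have h2 : (x - K) / x ≤ 1 := (div_le_one hx0).2 (by linarith)
    have := rpow_le_rpow_of_exponent_ge (div_pos (by linarith) hx0) h2 hq1.le
    rwa [rpow_one] at this
  rw [div_rpow (by linarith) hx0.le, div_le_div_iff₀ hx0 (by positivity)] at h1
  rw [rpow_sub_one hx0.ne', ← mul_div_assoc, le_div_iff₀ hx0]
  nlinarith

/-- Far from the origin `|·|^q` is flat on bounded windows, so only the unpenalized maximum of `h w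
- γ w²` survives. -/
lemma tendsto_supGain_atTop_of_mem_Ioo {q : ℝ} (hq0 : 0 < q) (hq1 : q < 1) {γ : ℝ≥0} (hγ : 0 < γ)
    (ν : ℝ≥0) (h : ℝ) :
    Tendsto (fun y => supGain q γ ν y h) atTop (𝓝 (ENNReal.ofReal (h ^ 2 / (4 * γ)))) := by
  have hγ' : (0 : ℝ) < γ := hγ
  -- The first entry puts the unpenalized maximizer `h / (2 * γ)` in the window; the second makes
  -- every `w` outside the window yield a negative gain.
  set K : ℝ := max (|h| / (2 * γ)) ((|h| + 2 * ν + 1) / γ + 1) with hKdef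
  have hK1 : |h| / (2 * γ) ≤ K := le_max_left _ _
  have hK2 : (|h| + 2 * ν + 1) / γ + 1 ≤ K := le_max_right _ _
  have hKge : 1 ≤ K := le_trans (by
    have : 0 ≤ (|h| + 2 * ν + 1) / (γ : ℝ) := by positivity
    linarith) hK2
  have hK0 : 0 ≤ K := by linarith
  have herr : Tendsto (fun y : ℝ => ENNReal.ofReal (ν * (K * y ^ (q - 1)))) atTop (𝓝 0) := by
    have h1 : Tendsto (fun y : ℝ => y ^ (q - 1)) atTop (𝓝 0) := by
      have := tendsto_rpow_neg_atTop (y := 1 - q) (by linarith)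
      simpa using this
    have h2 : Tendsto (fun y : ℝ => ν * (K * y ^ (q - 1))) atTop (𝓝 0) := by
      simpa using (h1.const_mul K).const_mul (ν : ℝ)
    have h3 := (ENNReal.continuous_ofReal.tendsto 0).comp h2
    rw [ENNReal.ofReal_zero] at h3
    exact h3
  have hbig : ∀ w : ℝ, h * w - γ * w ^ 2 ≤ h ^ 2 / (4 * γ) := fun w => by
    rw [le_div_iff₀ (by positivity)]
    nlinarith [sq_nonneg (h - 2 * γ * w)]
  have hdiff : ∀ y w : ℝ, K < y → |w| ≤ K →
      absPow q y - absPow q (y + w) ≤ K * y ^ (q - 1) := by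
    intro y w hy hw
    have hw1 := (abs_le.1 hw).1
    have h2 : 0 < y + w := by linarith
    rw [absPow_of_ne q (hK0.trans_lt hy).ne', absPow_of_ne q h2.ne',
      abs_of_pos (hK0.trans_lt hy), abs_of_pos h2]
    have h3 : (y - K) ^ q ≤ (y + w) ^ q := rpow_le_rpow (by linarith) (by linarith) hq0.le
    linarith [rpow_sub_rpow_le hq1 hK0 hy]
  refine tendsto_of_tendsto_of_tendsto_of_le_of_le'
    (g := fun y => ENNReal.ofReal (h ^ 2 / (4 * γ)) - ENNReal.ofReal (ν * (K * y ^ (q - 1))))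
    (h := fun y => ENNReal.ofReal (h ^ 2 / (4 * γ)) + ENNReal.ofReal (ν * (K * y ^ (q - 1))))
    ?_ ?_ ?_ ?_
  · simpa using ENNReal.Tendsto.sub (tendsto_const_nhds (x := ENNReal.ofReal (h ^ 2 / (4 * γ))))
      herr (Or.inl ENNReal.ofReal_ne_top)
  · simpa using (tendsto_const_nhds (x := ENNReal.ofReal (h ^ 2 / (4 * γ)))).add herr
  · filter_upwards [eventually_gt_atTop (2 * K)] with y hy
    rw [tsub_le_iff_right]
    have hw : |h / (2 * γ)| ≤ K := by
      rw [abs_div, abs_of_pos (by positivity : (0 : ℝ) < 2 * γ)]; exact hK1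
    have hw1 := abs_le.1 hw
    set w := h / (2 * γ) with hwdef
    have hval : h * w - γ * w ^ 2 = h ^ 2 / (4 * γ) := by
      rw [hwdef]; field_simp; ring
    have hd : absPow q (y + w) - absPow q y ≤ K * y ^ (q - 1) := by
      have hy0 : 0 < y := by linarith
      have h2 : 0 < y + w := by linarith
      rw [absPow_of_ne q hy0.ne', absPow_of_ne q h2.ne', abs_of_pos hy0, abs_of_pos h2]
      have h3 : (y + w) ^ q ≤ (y + K) ^ q := rpow_le_rpow h2.le (by linarith) hq0.le
      have h4 := rpow_sub_rpow_le hq1 hK0 (show K < y + K by linarith)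
      have h5 : (y + K) ^ (q - 1) ≤ y ^ (q - 1) :=
        rpow_le_rpow_of_nonpos hy0 (by linarith) (by linarith)
      have h6 := mul_le_mul_of_nonneg_left h5 hK0
      rw [add_sub_cancel_right] at h4
      linarith
    refine le_trans (ENNReal.ofReal_le_ofReal
      (q := gain q γ ν y h w + ν * (K * y ^ (q - 1))) ?_)
      (ENNReal.ofReal_add_le.trans (by gcongr; exact ofReal_gain_le q γ ν y h w))
    have := mul_le_mul_of_nonneg_left hd ν.coe_nonneg
    unfold gain
    linarith
  · filter_upwards [eventually_gt_atTop K] with y hy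
    have hy0 : 0 < y := hK0.trans_lt hy
    refine iSup_le fun w => ?_
    rw [← ENNReal.ofReal_add (by positivity) (by positivity)]
    refine ENNReal.ofReal_le_ofReal ?_
    rcases le_or_gt |w| K with hw | hw
    · have := mul_le_mul_of_nonneg_left (hdiff y w hy hw) ν.coe_nonneg
      have := hbig w
      unfold gain
      linarith
    · have h1 := absPow_sub_le hq0.le hq1.le y (y + w)
      have h2 := absPow_le_one_add hq0.le hq1.le (y - (y + w))
      have h3 : |y - (y + w)| = |w| := by rw [sub_add_cancel_left, abs_neg]
      have h4 : absPow q y - absPow q (y + w) ≤ 1 + |w| := by linarith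
      have h5 := mul_le_mul_of_nonneg_left h4 ν.coe_nonneg
      have h6 : h * w ≤ |h| * |w| := by rw [← abs_mul]; exact le_abs_self _
      have h7 : |h| + 2 * ν + 1 ≤ γ * |w| := by
        have : (|h| + 2 * ν + 1) / γ ≤ |w| := by linarith
        rw [div_le_iff₀ hγ'] at this
        linarith
      have h8 : (|h| + 2 * ν + 1) * |w| ≤ γ * w ^ 2 := by
        rw [← sq_abs w, sq, ← mul_assoc]
        exact mul_le_mul_of_nonneg_right h7 (abs_nonneg w)
      have h9 : (ν : ℝ) ≤ ν * |w| := le_mul_of_one_le_right ν.coe_nonneg (by linarith)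
      have h10 : 0 ≤ h ^ 2 / (4 * γ) + ν * (K * y ^ (q - 1)) := by positivity
      unfold gain
      nlinarith [abs_nonneg w]

lemma exists_tendsto_supGain_atTop {q : ℝ} (hq0 : 0 ≤ q) (hq1 : q ≤ 1) {γ : ℝ≥0} (hγ : 0 < γ)
    (ν : ℝ≥0) : ∃ Z : ℝ → ℝ≥0∞, ∀ h, Tendsto (fun y => supGain q γ ν y h) atTop (𝓝 (Z h)) := by
  have hγ' : (0 : ℝ) < γ := hγ
  rcases hq0.eq_or_lt with rfl | hq0
  · refine ⟨fun h => ENNReal.ofReal (2 * γ)⁻¹ * (ENNReal.ofReal (h ^ 2 / 2) + 0), fun h => ?_⟩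
    have h1 : Tendsto (fun x : ℝ => ENNReal.ofReal
        ((ν * (2 * γ) ^ (1 - 0 : ℝ) : ℝ≥0) - (2 * γ * x + h) ^ 2 / 2)) atTop (𝓝 0) := by
      have h2 : Tendsto (fun x : ℝ => 2 * γ * x + h) atTop atTop :=
        tendsto_atTop_add_const_right _ _ (tendsto_id.const_mul_atTop (by positivity))
      have h3 : Tendsto (fun x : ℝ => (2 * γ * x + h) ^ 2 / 2) atTop atTop :=
        ((tendsto_pow_atTop two_ne_zero).comp h2).atTop_div_const two_pos
      refine tendsto_const_nhds.congr' ?_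
      filter_upwards [h3.eventually_ge_atTop ((ν * (2 * γ) ^ (1 - 0 : ℝ) : ℝ≥0) : ℝ)] with x hx
      rw [ENNReal.ofReal_of_nonpos (by linarith)]
    refine ((ENNReal.Tendsto.const_mul (tendsto_const_nhds.add h1)
      (Or.inr ENNReal.ofReal_ne_top))).congr' ?_
    filter_upwards [eventually_gt_atTop 0] with x hx
    rw [supGain_of_zero hγ ν (ne_of_gt hx)]
  rcases hq1.eq_or_lt with rfl | hq1
  -- Monotonicity holds only for positive base points; truncating at `1` extends it to the whole
  -- line without changing the limit.
  · refine ⟨fun h => ⨆ y : ℝ, supGain 1 γ ν (max y 1) h, fun h => ?_⟩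
    have hm : Monotone fun y : ℝ => supGain 1 γ ν (max y 1) h := by
      intro x y hxy
      refine supGain_monotone_of_one γ ν (lt_max_of_lt_right one_pos) (max_le_max hxy le_rfl) h
    refine (tendsto_atTop_iSup hm).congr' ?_
    filter_upwards [eventually_ge_atTop 1] with y hy
    rw [max_eq_left hy]
  · exact ⟨_, tendsto_supGain_atTop_of_mem_Ioo hq0 hq1 hγ ν⟩

/-! ### Dependence on the multipliers -/

lemma tendsto_I₁ {q : ℝ} (hq0 : 0 ≤ q) (hq1 : q ≤ 1) {γ : ℝ≥0} (hγ : 0 < γ) (ν : ℝ≥0)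
    {l : Filter ℝ} [l.IsCountablyGenerated] {Z : ℝ → ℝ≥0∞}
    (h : ∀ h, Tendsto (fun y => supGain q γ ν y h) l (𝓝 (Z h))) :
    Tendsto (fun y => I₁ q γ ν y) l (𝓝 (∫⁻ h, Z h ∂(gaussianReal 0 1))) :=
  tendsto_lintegral_filter_of_dominated_convergence
    (fun h => ENNReal.ofReal (gainBound γ ν h))
    (Eventually.of_forall fun y => measurable_supGain q γ ν y)
    (Eventually.of_forall fun y => ae_of_all _ fun h => supGain_le hq0 hq1 hγ ν y h)
    (lintegral_gainBound_lt_top γ ν).ne (ae_of_all _ h)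

/-- For fixed `h` the integrand is a supremum of continuous functions of the multipliers; Fatou's
lemma passes this to the integral. -/
lemma lowerSemicontinuous_I₁ (q x : ℝ) :
    LowerSemicontinuous fun p : ℝ≥0 × ℝ≥0 => I₁ q p.1 p.2 x := by
  intro p
  refine lowerSemicontinuousAt_iff_le_liminf.2 ?_
  refine le_trans (lintegral_mono fun h => ?_)
    (lintegral_liminf_le fun p : ℝ≥0 × ℝ≥0 => measurable_supGain q p.1 p.2 x)
  have : LowerSemicontinuousAt (fun p : ℝ≥0 × ℝ≥0 => supGain q p.1 p.2 x h) p := by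
    refine LowerSemicontinuous.lowerSemicontinuousAt (lowerSemicontinuous_iSup fun w =>
      Continuous.lowerSemicontinuous (ENNReal.continuous_ofReal.comp ?_)) p
    unfold gain; fun_prop
  exact lowerSemicontinuousAt_iff_le_liminf.1 this

/-- For fixed `h` and `w` the objective is affine in the multipliers, and positive parts, suprema
and integrals preserve convexity. -/
lemma I₁_convex (q x : ℝ) (a b : ℝ≥0) (hab : a + b = 1) (γ γ' ν ν' : ℝ≥0) :
    I₁ q (a * γ + b * γ') (a * ν + b * ν') x ≤ a * I₁ q γ ν x + b * I₁ q γ' ν' x := by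
  rw [I₁_eq, I₁_eq, I₁_eq, ← lintegral_const_mul _ (measurable_supGain _ _ _ _),
    ← lintegral_const_mul _ (measurable_supGain _ _ _ _),
    ← lintegral_add_left ((measurable_supGain _ _ _ _).const_mul _)]
  refine lintegral_mono fun h => iSup_le fun w => ?_
  have hab' : (a : ℝ) + b = 1 := by exact_mod_cast hab
  have e : gain q (a * γ + b * γ') (a * ν + b * ν') x h w =
      a * gain q γ ν x h w + b * gain q γ' ν' x h w := by
    have e1 : h * w = (a + b) * (h * w) := by rw [hab', one_mul]
    unfold gain
    push_cast
    linear_combination e1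
  rw [e]
  refine ENNReal.ofReal_add_le.trans ?_
  rw [ENNReal.ofReal_mul a.coe_nonneg, ENNReal.ofReal_mul b.coe_nonneg, ENNReal.ofReal_coe_nnreal,
    ENNReal.ofReal_coe_nnreal]
  gcongr
  · exact ofReal_gain_le _ _ _ _ _ _
  · exact ofReal_gain_le _ _ _ _ _ _

lemma gaussianReal_pos_of_isOpen {s : Set ℝ} (hs : IsOpen s) (hne : s.Nonempty) :
    gaussianReal 0 1 s ≠ 0 := fun h =>
  (hs.measure_pos volume hne).ne' (gaussianReal_absolutelyContinuous' 0 one_ne_zero h)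

/-- Without the quadratic term, whenever `h > ν` the linear reward outgrows a penalty of growth at
most `ν (1 + |w|)`; this event has positive probability. -/
lemma I₁_gamma_zero {q : ℝ} (hq0 : 0 ≤ q) (hq1 : q ≤ 1) (ν : ℝ≥0) (x : ℝ) :
    I₁ q 0 ν x = ∞ := by
  refine lintegral_eq_top_of_measure_eq_top_ne_zero (measurable_supGain q 0 ν x).aemeasurable ?_
  refine fun h0 => gaussianReal_pos_of_isOpen (isOpen_Ioi (a := (ν : ℝ))) nonempty_Ioi
    (measure_mono_null (fun h hh => ?_) h0)
  have hh' : (ν : ℝ) < h := hh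
  refine ENNReal.eq_top_of_forall_nnreal_le fun r => ?_
  have hpos : 0 < h - ν := by linarith
  -- This `w` solves `h w - ν (1 + w) = r`.
  refine le_trans ?_ (ofReal_gain_le q 0 ν x h ((r + ν) / (h - ν)))
  rw [← ENNReal.ofReal_coe_nnreal]
  refine ENNReal.ofReal_le_ofReal ?_
  set w : ℝ := (r + ν) / (h - ν) with hw
  have hw0 : 0 ≤ w := by positivity
  have e : (h - ν) * w = r + ν := by rw [hw]; field_simp
  have h1 := absPow_sub_le hq0 hq1 (x + w) x
  rw [add_sub_cancel_left] at h1
  have h2 := absPow_le_one_add hq0 hq1 w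
  rw [abs_of_nonneg hw0] at h2
  have h3 := mul_le_mul_of_nonneg_left (h1.trans h2) ν.coe_nonneg
  unfold gain
  push_cast
  linarith

/-- Test with `w = -1`, which removes the base point `1` and collects `ν`. The bound makes `I₁` at
`1` coercive in `ν`, the source of compactness for the multipliers. -/
lemma le_I₁_one (q : ℝ) (γ ν : ℝ≥0) :
    ENNReal.ofReal (ν - γ) * gaussianReal 0 1 (Iio 0) ≤ I₁ q γ ν 1 := by
  rw [← setLIntegral_const, I₁_eq]
  refine (setLIntegral_mono (measurable_supGain _ _ _ _) fun h hh => ?_).trans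
    (setLIntegral_le_lintegral _ _)
  refine le_trans (ENNReal.ofReal_le_ofReal ?_) (ofReal_gain_le q γ ν 1 h (-1))
  have hh' : h < 0 := hh
  have : absPow q 1 = 1 := by rw [absPow_of_ne q one_ne_zero, abs_one, one_rpow]
  unfold gain
  rw [add_neg_cancel, absPow_zero_right, this]
  linarith

/-! ### Exchanging the supremum and the infimum -/

/-- The function whose max-min is `weakBound`. -/
def weakFun (q β : ℝ) (x : ℝ) (γ ν : ℝ≥0) : ℝ≥0∞ :=
  ENNReal.ofReal β * I₁ q γ ν x + ENNReal.ofReal (1 - β) * I₂ q γ ν + γ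

lemma weakFun_quasiconcave {q : ℝ} (hq0 : 0 ≤ q) (hq1 : q ≤ 1) (β : ℝ) {γ : ℝ≥0} (hγ : 0 < γ)
    (ν : ℝ≥0) {x₁ x x₂ : ℝ} (hx₁ : 0 < x₁) (h1 : x₁ ≤ x) (h2 : x ≤ x₂) :
    min (weakFun q β x₁ γ ν) (weakFun q β x₂ γ ν) ≤ weakFun q β x γ ν := by
  have := I₁_quasiconcave hq0 hq1 hγ ν hx₁ h1 h2
  rcases min_le_iff.1 this with h | h
  · exact min_le_of_left_le (by unfold weakFun; gcongr)
  · exact min_le_of_right_le (by unfold weakFun; gcongr)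

lemma weakFun_convex (q β x : ℝ) (a b : ℝ≥0) (hab : a + b = 1) (γ γ' ν ν' : ℝ≥0) :
    weakFun q β x (a * γ + b * γ') (a * ν + b * ν') ≤
      a * weakFun q β x γ ν + b * weakFun q β x γ' ν' := by
  have h1 := I₁_convex q x a b hab γ γ' ν ν'
  have h2 := I₁_convex q 0 a b hab γ γ' ν ν'
  unfold weakFun
  rw [I₂_eq, I₂_eq, I₂_eq]
  calc _ ≤ ENNReal.ofReal β * (a * I₁ q γ ν x + b * I₁ q γ' ν' x) +
        ENNReal.ofReal (1 - β) * (a * I₁ q γ ν 0 + b * I₁ q γ' ν' 0) +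
          ((a * γ + b * γ' : ℝ≥0) : ℝ≥0∞) := by gcongr
    _ = _ := by push_cast; ring

lemma lowerSemicontinuous_weakFun (q β x : ℝ) :
    LowerSemicontinuous fun p : ℝ≥0 × ℝ≥0 => weakFun q β x p.1 p.2 := by
  have hmul : ∀ (c y : ℝ), LowerSemicontinuous fun p : ℝ≥0 × ℝ≥0 =>
      ENNReal.ofReal c * I₁ q p.1 p.2 y := fun c y =>
    (ENNReal.continuous_const_mul ENNReal.ofReal_ne_top).comp_lowerSemicontinuous
      (lowerSemicontinuous_I₁ q y) (fun _ _ h => mul_le_mul_right h _)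
  unfold weakFun
  simp_rw [I₂_eq]
  refine ((hmul β x).add (hmul (1 - β) 0)).add (Continuous.lowerSemicontinuous ?_)
  fun_prop

lemma exists_forall_mem_Icc_weakFun_le {q β : ℝ} (hq0 : 0 ≤ q) (hq1 : q ≤ 1) (hβ : 0 < β)
    {s : ℝ≥0∞} (hs : weakBound q β < s) {a b : ℝ} (ha : 0 < a) :
    ∃ γ ν : ℝ≥0, ∀ x ∈ Icc a b, weakFun q β x γ ν ≤ s := by
  -- Continuity and quasiconcavity in `x` are available for `γ > 0` only. Excluding `γ = 0` costs
  -- nothing, because `weakFun` is infinite there.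
  set Y : Set (ℝ × ℝ) := {p | 0 < p.1 ∧ 0 ≤ p.2} with hY
  set F : ℝ → ℝ × ℝ → ℝ≥0∞ := fun x p => weakFun q β x p.1.toNNReal p.2.toNNReal with hF
  rcases (Icc a b).eq_empty_or_nonempty with he | hne
  · exact ⟨0, 0, by simp [he]⟩
  have hcvx : ∀ p ∈ Y, ∀ p' ∈ Y, ∀ s t : ℝ, 0 ≤ s → 0 ≤ t → s + t = 1 → s • p + t • p' ∈ Y := by
    rintro p ⟨h1, h2⟩ p' ⟨h1', h2'⟩ s t hs ht hst
    refine ⟨?_, ?_⟩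
    · simp only [Prod.fst_add, Prod.smul_fst, smul_eq_mul]
      rcases hs.eq_or_lt with rfl | hs'
      · rw [zero_add] at hst; simp [hst, h1']
      · have := mul_pos hs' h1
        have := mul_nonneg ht h1'.le
        linarith
    · simp only [Prod.snd_add, Prod.smul_snd, smul_eq_mul]
      positivity
  have hYc : Convex ℝ Y := by
    intro p hp p' hp' s t hs ht hst
    exact hcvx p hp p' hp' s t hs ht hst
  have hpos : ∀ p ∈ Y, 0 < p.1.toNNReal := fun p hp => Real.toNNReal_pos.2 hp.1
  have hmm : (⨆ x ∈ Icc a b, ⨅ p ∈ Y, F x p) = ⨅ p ∈ Y, ⨆ x ∈ Icc a b, F x p := by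
    -- The order dual puts the compact interval on the minimizing side of Sion's theorem.
    refine Sion.minimax' (β := ℝ≥0∞ᵒᵈ) (X := Icc a b) (Y := Y)
      (f := fun x p => OrderDual.toDual (F x p)) hne (convex_Icc a b) isCompact_Icc ?_ ?_ hYc ?_ ?_
    · intro p hp
      have hcont : ContinuousOn (fun x => F x p) (Icc a b) := by
        intro x hx
        refine ContinuousAt.continuousWithinAt ?_
        have h1 := tendsto_I₁ hq0 hq1 (hpos p hp) p.2.toNNReal
          (tendsto_supGain_nhds hq0 hq1 (hpos p hp) p.2.toNNReal (ha.trans_le hx.1))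
        exact ((ENNReal.Tendsto.const_mul h1 (Or.inr ENNReal.ofReal_ne_top)).add
          tendsto_const_nhds).add tendsto_const_nhds
      exact hcont.upperSemicontinuousOn
    · intro p hp r
      refine Set.OrdConnected.convex ⟨fun x hx y hy z hz => ?_⟩
      refine ⟨⟨hx.1.1.trans hz.1, hz.2.trans hy.1.2⟩, ?_⟩
      have := weakFun_quasiconcave hq0 hq1 β (hpos p hp) p.2.toNNReal (ha.trans_le hx.1.1) hz.1 hz.2
      have hx2 : OrderDual.ofDual r ≤ F x p := hx.2
      have hy2 : OrderDual.ofDual r ≤ F y p := hy.2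
      show OrderDual.ofDual r ≤ F z p
      exact (le_min hx2 hy2).trans this
    · intro x hx
      have hcont : Continuous fun p : ℝ × ℝ => (p.1.toNNReal, p.2.toNNReal) := by fun_prop
      exact ((lowerSemicontinuous_weakFun q β x).comp hcont).lowerSemicontinuousOn _
    · intro x hx r p hp p' hp' s t hs ht hst
      refine ⟨hcvx p hp.1 p' hp'.1 s t hs ht hst, ?_⟩
      have hp2 : F x p ≤ OrderDual.ofDual r := hp.2
      have hp2' : F x p' ≤ OrderDual.ofDual r := hp'.2
      have hst' : s.toNNReal + t.toNNReal = 1 := by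
        rw [← Real.toNNReal_add hs ht, hst, Real.toNNReal_one]
      have e1 : (s • p + t • p').1.toNNReal =
          s.toNNReal * p.1.toNNReal + t.toNNReal * p'.1.toNNReal := by
        simp only [Prod.fst_add, Prod.smul_fst, smul_eq_mul]
        rw [Real.toNNReal_add (mul_nonneg hs hp.1.1.le) (mul_nonneg ht hp'.1.1.le),
          Real.toNNReal_mul hs, Real.toNNReal_mul ht]
      have e2 : (s • p + t • p').2.toNNReal =
          s.toNNReal * p.2.toNNReal + t.toNNReal * p'.2.toNNReal := by
        simp only [Prod.snd_add, Prod.smul_snd, smul_eq_mul]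
        rw [Real.toNNReal_add (mul_nonneg hs hp.1.2) (mul_nonneg ht hp'.1.2),
          Real.toNNReal_mul hs, Real.toNNReal_mul ht]
      show F x (s • p + t • p') ≤ OrderDual.ofDual r
      simp only [hF]
      rw [e1, e2]
      refine (weakFun_convex q β x _ _ hst' _ _ _ _).trans ?_
      calc _ ≤ (s.toNNReal : ℝ≥0∞) * OrderDual.ofDual r + t.toNNReal * OrderDual.ofDual r := by
            gcongr
        _ = OrderDual.ofDual r := by
            rw [← add_mul, ← ENNReal.coe_add, hst', ENNReal.coe_one, one_mul]
  have hle : (⨆ x ∈ Icc a b, ⨅ p ∈ Y, F x p) ≤ weakBound q β := by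
    refine iSup₂_le fun x _ => le_trans ?_ (le_iSup _ x)
    refine le_iInf₂ fun γ ν => ?_
    rcases eq_or_ne γ 0 with rfl | hγ
    · rw [I₁_gamma_zero hq0 hq1, ENNReal.mul_top (by simpa using hβ)]
      simp
    · refine (iInf₂_le ((γ : ℝ), (ν : ℝ)) ⟨?_, ν.coe_nonneg⟩).trans ?_
      · simp [hF, weakFun]
      · exact_mod_cast pos_iff_ne_zero.2 hγ
  rw [hmm] at hle
  obtain ⟨p, hp⟩ := iInf_lt_iff.1 (hle.trans_lt hs)
  obtain ⟨hpY, hp⟩ := iInf_lt_iff.1 hp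
  exact ⟨p.1.toNNReal, p.2.toNNReal, fun x hx => (le_iSup₂ (f := fun x _ => F x p) x hx).trans hp.le⟩

/-- One pair of multipliers serves all `x`. -/
lemma exists_forall_weakFun_le {q β : ℝ} (hq0 : 0 ≤ q) (hq1 : q ≤ 1) (hβ : 0 < β)
    {s : ℝ≥0∞} (hs : weakBound q β < s) (hs' : s ≠ ∞) :
    ∃ γ ν : ℝ≥0, 0 < γ ∧ ∀ x, 0 < x → weakFun q β x γ ν ≤ s := by
  -- The good pairs for the intervals `[1 / (N + 1), N + 1]` form a decreasing sequence of nonempty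
  -- closed sets; Cantor's intersection theorem gives a pair good on all of `(0, ∞)`.
  set C : ℕ → Set (ℝ≥0 × ℝ≥0) := fun N =>
    {p | ∀ x ∈ Icc (1 / ((N : ℝ) + 1)) (N + 1), weakFun q β x p.1 p.2 ≤ s} with hC
  have hCc : ∀ N, IsClosed (C N) := by
    intro N
    have : C N = ⋂ x ∈ Icc (1 / ((N : ℝ) + 1)) (N + 1),
        (fun p : ℝ≥0 × ℝ≥0 => weakFun q β x p.1 p.2) ⁻¹' Iic s := by
      ext p; simp [hC]
    rw [this]
    exact isClosed_biInter fun x _ => (lowerSemicontinuous_weakFun q β x).isClosed_preimage s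
  set c := gaussianReal 0 1 (Iio 0) with hc
  have hc0 : c ≠ 0 := gaussianReal_pos_of_isOpen isOpen_Iio nonempty_Iio
  -- For `N = 0` the interval is the single point `1`: the summand `γ` bounds `γ` by `s`, and
  -- `le_I₁_one` then bounds `ν`.
  have hcpt : IsCompact (C 0) := by
    set M : ℝ≥0 := (s / (ENNReal.ofReal β * c)).toNNReal with hM
    refine (isCompact_Icc (a := ((0 : ℝ≥0), (0 : ℝ≥0)))
      (b := (s.toNNReal, s.toNNReal + M))).of_isClosed_subset (hCc 0) fun p hp => ?_
    have h1 := hp 1 (by norm_num)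
    have hγ : p.1 ≤ s.toNNReal := by
      rw [← ENNReal.coe_le_coe, ENNReal.coe_toNNReal hs']
      exact le_trans (by unfold weakFun; exact le_add_self) h1
    refine ⟨⟨zero_le, zero_le⟩, ⟨hγ, ?_⟩⟩
    have h2 : ENNReal.ofReal β * (ENNReal.ofReal (p.2 - p.1) * c) ≤ s := by
      refine le_trans ?_ h1
      unfold weakFun
      rw [add_assoc]
      exact le_add_right (by gcongr; exact le_I₁_one q p.1 p.2)
    have hβc : ENNReal.ofReal β * c ≠ 0 := mul_ne_zero (by simpa using hβ) hc0
    have hβc' : ENNReal.ofReal β * c ≠ ∞ :=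
      ENNReal.mul_ne_top ENNReal.ofReal_ne_top (measure_ne_top _ _)
    have h3 : ENNReal.ofReal (p.2 - p.1) ≤ s / (ENNReal.ofReal β * c) := by
      rw [ENNReal.le_div_iff_mul_le (Or.inl hβc) (Or.inl hβc')]
      calc _ = _ := by ring
        _ ≤ s := h2
    have h4 : (p.2 : ℝ) - p.1 ≤ M := by
      have := (ENNReal.ofReal_le_iff_le_toReal (ENNReal.div_ne_top hs' hβc)).1 h3
      exact this
    have h5 : (p.1 : ℝ) ≤ s.toNNReal := by exact_mod_cast hγ
    have : (p.2 : ℝ) ≤ s.toNNReal + M := by linarith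
    exact_mod_cast this
  have hne : ∀ N, (C N).Nonempty := fun N => by
    obtain ⟨γ, ν, h⟩ := exists_forall_mem_Icc_weakFun_le hq0 hq1 hβ hs
      (a := 1 / ((N : ℝ) + 1)) (b := N + 1) (by positivity)
    exact ⟨(γ, ν), h⟩
  obtain ⟨p, hp⟩ := IsCompact.nonempty_iInter_of_sequence_nonempty_isCompact_isClosed C
    (fun N p hp x hx => hp x ⟨le_trans (by push_cast; gcongr; linarith) hx.1,
      hx.2.trans (by push_cast; linarith)⟩) hne hcpt hCc
  have hall : ∀ x, 0 < x → weakFun q β x p.1 p.2 ≤ s := by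
    intro x hx
    obtain ⟨N, hN⟩ := exists_nat_ge (max x (1 / x))
    refine mem_iInter.1 hp N x ⟨?_, ?_⟩
    · rw [one_div_le (by positivity) hx]
      linarith [le_max_right x (1 / x)]
    · linarith [le_max_left x (1 / x)]
  refine ⟨p.1, p.2, pos_iff_ne_zero.2 fun h0 => ?_, hall⟩
  have h1 := hall 1 one_pos
  rw [h0, weakFun, I₁_gamma_zero hq0 hq1, ENNReal.mul_top (by simpa using hβ)] at h1
  simp at h1
  exact hs' h1

/-! ### Gaussian integration by parts -/

section Stein

open Function

variable {V W : Type*} [NormedAddCommGroup V] [NormedAddCommGroup W]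

lemma hasTemperateGrowth_fderiv_apply [NormedSpace ℝ V] [NormedSpace ℝ W]
    {f : V → W} (hf : f.HasTemperateGrowth) (v : V) :
    (fun x => fderiv ℝ f x v).HasTemperateGrowth := by
  have h : (fderiv ℝ f).HasTemperateGrowth := by
    refine ⟨hf.1.fderiv_right (by simp), fun n => ?_⟩
    obtain ⟨k, C, h⟩ := hf.2 (n + 1)
    exact ⟨k, C, fun x => by rw [norm_iteratedFDeriv_fderiv]; exact h x⟩
  exact (ContinuousLinearMap.apply ℝ W v).hasTemperateGrowth.comp h

variable [MeasurableSpace V] [MeasurableSpace W]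

/-- All moments of the norm are finite. -/
def HasMoments (μ : Measure V) : Prop := ∀ k : ℕ, Integrable (fun x => (1 + ‖x‖) ^ k) μ

lemma hasMoments_gaussianReal : HasMoments (gaussianReal 0 1) := by
  intro k
  have h0 : MemLp (fun x : ℝ => x) (k : ℝ≥0∞) (gaussianReal 0 1) := memLp_id_gaussianReal (k : ℝ≥0)
  have h1 : MemLp (fun _ : ℝ => (1 : ℝ)) (k : ℝ≥0∞) (gaussianReal 0 1) := memLp_const 1
  have h : MemLp (fun x : ℝ => 1 + ‖x‖) (k : ℝ≥0∞) (gaussianReal 0 1) := h1.add h0.norm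
  rcases Nat.eq_zero_or_pos k with rfl | hk
  · simp
  · have := h.integrable_norm_pow (by omega)
    refine this.congr (ae_of_all _ fun x => ?_)
    simp only [norm_eq_abs]
    rw [abs_of_nonneg (by positivity)]

lemma HasMoments.prod [OpensMeasurableSpace V] [OpensMeasurableSpace W]
    [SecondCountableTopology V] [SecondCountableTopology W] {μ : Measure V} {ν : Measure W}
    [IsProbabilityMeasure μ] [IsProbabilityMeasure ν] (hμ : HasMoments μ) (hν : HasMoments ν) :
    HasMoments (μ.prod ν) := by
  intro k
  refine (((hμ k).comp_fst ν).add ((hν k).comp_snd μ)).mono'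
    (by fun_prop) (ae_of_all _ fun x => ?_)
  rw [Real.norm_of_nonneg (by positivity), Prod.norm_def]
  simp only [Pi.add_apply]
  rcases max_cases ‖x.1‖ ‖x.2‖ with ⟨h, _⟩ | ⟨h, _⟩ <;> rw [h]
  · exact le_add_of_nonneg_right (by positivity)
  · exact le_add_of_nonneg_left (by positivity)

lemma HasMoments.pi [OpensMeasurableSpace V] [SecondCountableTopology V] {μ : Measure V}
    [IsProbabilityMeasure μ] (hμ : HasMoments μ) (n : ℕ) :
    HasMoments (Measure.pi fun _ : Fin n => μ) := by
  intro k
  have h : Integrable (fun x : Fin n → V => 1 + ∑ i, (1 + ‖x i‖) ^ k)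
      (Measure.pi fun _ : Fin n => μ) :=
    (integrable_const 1).add (integrable_finsetSum _ fun i _ =>
      integrable_comp_eval (μ := fun _ : Fin n => μ) (hμ k))
  refine h.mono' (by fun_prop) (ae_of_all _ fun x => ?_)
  rw [Real.norm_of_nonneg (by positivity)]
  rcases isEmpty_or_nonempty (Fin n) with he | hne
  · simp [Pi.norm_def]
  · obtain ⟨i, hi⟩ := Finite.exists_max fun i => ‖x i‖
    have h1 : ‖x‖ ≤ ‖x i‖ := (pi_norm_le_iff_of_nonneg (norm_nonneg _)).2 hi
    calc (1 + ‖x‖) ^ k ≤ (1 + ‖x i‖) ^ k := by gcongr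
      _ ≤ ∑ i, (1 + ‖x i‖) ^ k :=
          Finset.single_le_sum (f := fun i => (1 + ‖x i‖) ^ k)
            (fun i _ => by positivity) (Finset.mem_univ i)
      _ ≤ _ := by linarith

variable [NormedSpace ℝ V] [NormedSpace ℝ W]

/-- The formula `E φ(x) G(x) = E ∂_v G(x)` for functions `G` of temperate growth. -/
def SteinPair (μ : Measure V) (v : V) (φ : V →L[ℝ] ℝ) : Prop :=
  ∀ G : V → ℝ, G.HasTemperateGrowth → ∫ x, φ x * G x ∂μ = ∫ x, fderiv ℝ G x v ∂μ

/-- Temperate growth is stable under products, derivatives and composition with linear maps, so with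
all moments finite every integrability condition of the interpolation argument is automatic. -/
lemma HasMoments.integrable [BorelSpace V] [SecondCountableTopology V] {μ : Measure V}
    (hμ : HasMoments μ) {G : V → ℝ} (hG : G.HasTemperateGrowth) : Integrable G μ := by
  obtain ⟨k, C, h⟩ := hG.2 0
  refine ((hμ k).const_mul C).mono' hG.1.continuous.aestronglyMeasurable (ae_of_all _ fun x => ?_)
  simpa using h x

/-- Integration by parts, since the density satisfies `gpdf' z = -z * gpdf z`. -/
lemma steinPair_gaussianReal : SteinPair (gaussianReal 0 1) 1 (ContinuousLinearMap.id ℝ ℝ) := by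
  intro G hG
  have hG' : (fun x => fderiv ℝ G x 1).HasTemperateGrowth := hasTemperateGrowth_fderiv_apply hG 1
  have hi : ∀ {H : ℝ → ℝ}, H.HasTemperateGrowth → Integrable (fun x => gpdf x * H x) := by
    intro H hH
    have h := hasMoments_gaussianReal.integrable hH
    rw [gaussianReal_of_var_ne_zero 0 one_ne_zero,
      integrable_withDensity_iff_integrable_smul' (measurable_gaussianPDF 0 1)
        (ae_of_all _ fun x => gaussianPDF_lt_top)] at h
    refine h.congr (ae_of_all _ fun x => ?_)
    simp [gpdf_eq, toReal_gaussianPDF]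
  have hxG : (fun x => x * G x).HasTemperateGrowth := by fun_prop
  rw [integral_gaussianReal_eq_integral_smul one_ne_zero,
    integral_gaussianReal_eq_integral_smul one_ne_zero]
  simp_rw [← gpdf_eq, smul_eq_mul]
  have h := integral_mul_deriv_eq_deriv_mul_of_integrable (u := gpdf) (v := G)
    (u' := fun z => -z * gpdf z) (v' := fun x => fderiv ℝ G x 1)
    (fun x _ => hasDerivAt_gpdf x)
    (fun x _ => ((hG.1.differentiable (by simp)) x).hasFDerivAt.hasDerivAt)
    (hi hG') ((hi hxG).neg.congr (ae_of_all _ fun x => by simp; ring)) (hi hG)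
  rw [h, ← integral_neg]
  refine integral_congr_ae (ae_of_all _ fun x => ?_)
  simp; ring

lemma SteinPair.prod_left [BorelSpace V] [BorelSpace W] [SecondCountableTopology V]
    [SecondCountableTopology W] {μ : Measure V} {ν : Measure W} [IsProbabilityMeasure μ]
    [IsProbabilityMeasure ν] (hμ : HasMoments μ) (hν : HasMoments ν) {v : V} {φ : V →L[ℝ] ℝ}
    (h : SteinPair μ v φ) :
    SteinPair (μ.prod ν) (v, 0) (φ.comp (ContinuousLinearMap.fst ℝ V W)) := by
  intro G hG
  have hm := hμ.prod hν
  have hφ : (fun x => φ.comp (ContinuousLinearMap.fst ℝ V W) x * G x).HasTemperateGrowth :=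
    (φ.comp (ContinuousLinearMap.fst ℝ V W)).hasTemperateGrowth.mul hG
  rw [integral_prod_symm _ (hm.integrable hφ),
    integral_prod_symm _ (hm.integrable (hasTemperateGrowth_fderiv_apply hG _))]
  refine integral_congr_ae (ae_of_all _ fun y => ?_)
  have e : (fun x : V => (x, y)) = fun x => ContinuousLinearMap.inl ℝ V W x + (0, y) := by
    funext x; simp
  have ht : (fun x : V => (x, y)).HasTemperateGrowth := by
    rw [e]
    exact (ContinuousLinearMap.inl ℝ V W).hasTemperateGrowth.add (.const _)
  have := h (fun x => G (x, y)) (hG.comp ht)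
  simp only [ContinuousLinearMap.comp_apply, ContinuousLinearMap.coe_fst']
  rw [this]
  refine integral_congr_ae (ae_of_all _ fun x => ?_)
  have hd : HasFDerivAt (fun x : V => (x, y)) (ContinuousLinearMap.inl ℝ V W) x := by
    rw [e]; exact (ContinuousLinearMap.inl ℝ V W).hasFDerivAt.add_const _
  have hGd := ((hG.1.differentiable (by simp)) (x, y)).hasFDerivAt
  have := (hGd.comp x hd).fderiv
  show fderiv ℝ (G ∘ fun x => (x, y)) x v = _
  rw [this]
  simp

lemma SteinPair.map [BorelSpace V] [BorelSpace W] [SecondCountableTopology V]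
    {μ : Measure V} (L : V ≃L[ℝ] W) {v : V} {φ : W →L[ℝ] ℝ}
    (h : SteinPair μ v (φ.comp (L : V →L[ℝ] W))) : SteinPair (μ.map L) (L v) φ := by
  intro G hG
  have hL : MeasurableEmbedding L := L.toHomeomorph.measurableEmbedding
  rw [hL.integral_map, hL.integral_map]
  refine (h (G ∘ L) (hG.comp (L : V →L[ℝ] W).hasTemperateGrowth)).trans ?_
  refine integral_congr_ae (ae_of_all _ fun x => ?_)
  have hGd := ((hG.1.differentiable (by simp)) (L x)).hasFDerivAt
  have := (hGd.comp x L.hasFDerivAt).fderiv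
  show fderiv ℝ (G ∘ L) x v = _
  rw [this]
  rfl

lemma SteinPair.prod_right [BorelSpace V] [BorelSpace W] [SecondCountableTopology V]
    [SecondCountableTopology W] {μ : Measure V} {ν : Measure W} [IsProbabilityMeasure μ]
    [IsProbabilityMeasure ν] (hμ : HasMoments μ) (hν : HasMoments ν) {w : W} {φ : W →L[ℝ] ℝ}
    (h : SteinPair ν w φ) :
    SteinPair (μ.prod ν) (0, w) (φ.comp (ContinuousLinearMap.snd ℝ V W)) := by
  have h1 := h.prod_left hν hμ
  have h2 := SteinPair.map (ContinuousLinearEquiv.prodComm ℝ W V) (v := (w, 0))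
    (φ := φ.comp (ContinuousLinearMap.snd ℝ V W)) h1
  have e : (ν.prod μ).map (ContinuousLinearEquiv.prodComm ℝ W V) = μ.prod ν := Measure.prod_swap
  rwa [e] at h2

lemma SteinPair.pi [BorelSpace V] [SecondCountableTopology V] {μ : Measure V}
    [IsProbabilityMeasure μ] (hμ : HasMoments μ) {v : V} {φ : V →L[ℝ] ℝ} (h : SteinPair μ v φ)
    {n : ℕ} (i : Fin n) :
    SteinPair (Measure.pi fun _ : Fin n => μ) (Pi.single i v)
      (φ.comp (ContinuousLinearMap.proj i)) := by
  obtain ⟨n, rfl⟩ : ∃ k, n = k + 1 := ⟨n - 1, by have := i.2; omega⟩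
  let L : (V × (Fin n → V)) ≃L[ℝ] (Fin (n + 1) → V) :=
    { toFun := fun p => i.insertNth p.1 p.2
      invFun := fun x => (x i, i.removeNth x)
      left_inv := fun p => by simp
      right_inv := fun x => by simp
      map_add' := fun p p' => by
        funext j; refine Fin.succAboveCases i ?_ (fun j => ?_) j <;> simp
      map_smul' := fun c p => by
        funext j; refine Fin.succAboveCases i ?_ (fun j => ?_) j <;> simp
      continuous_toFun := by
        refine continuous_pi fun j => ?_
        refine Fin.succAboveCases i ?_ (fun j => ?_) j
        · simpa using continuous_fst
        · simp only [Fin.insertNth_apply_succAbove]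
          fun_prop
      continuous_invFun := by
        refine (continuous_apply i).prodMk (continuous_pi fun j => ?_)
        exact continuous_apply _ }
  have h1 := SteinPair.map L (v := (v, 0)) (φ := φ.comp (ContinuousLinearMap.proj i)) (by
    have := h.prod_left hμ (hμ.pi n)
    convert! this using 1
    ext p <;> simp [L])
  have e : (μ.prod (Measure.pi fun _ : Fin n => μ)).map L = Measure.pi fun _ => μ :=
    ((measurePreserving_piFinSuccAbove (fun _ : Fin (n + 1) => μ) i).symm).map_eq
  have e2 : L (v, 0) = Pi.single i v := by
    funext j
    refine Fin.succAboveCases i ?_ (fun j => ?_) j <;> simp [L]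
  rwa [e, e2] at h1

end Stein

/-! ### Gaussian comparison by interpolation -/

section Interpolation

open Function

variable {V E : Type*} [NormedAddCommGroup V] [NormedSpace ℝ V]
  [NormedAddCommGroup E] [NormedSpace ℝ E]

/-- The second derivative of `F` along `u`. -/
def secondDeriv (F : E → ℝ) (u z : E) : ℝ := fderiv ℝ (fun y => fderiv ℝ F y u) z u

lemma hasTemperateGrowth_secondDeriv {F : E → ℝ} (hF : F.HasTemperateGrowth) (u : E) :
    (secondDeriv F u).HasTemperateGrowth :=
  hasTemperateGrowth_fderiv_apply (hasTemperateGrowth_fderiv_apply hF u) u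

/-- The linear map `cos θ • X + sin θ • Y`. -/
def interpolate (X Y : V →L[ℝ] E) (θ : ℝ) : V →L[ℝ] E := cos θ • X + sin θ • Y

variable [MeasurableSpace V]

lemma SteinPair.integral_mul_fderiv {μ : Measure V} {v : V} {φ : V →L[ℝ] ℝ}
    (h : SteinPair μ v φ) {F : E → ℝ} (hF : F.HasTemperateGrowth) (Z : V →L[ℝ] E) {u : E} {c : ℝ}
    (hZ : Z v = c • u) :
    ∫ x, φ x * fderiv ℝ F (Z x) u ∂μ = c * ∫ x, secondDeriv F u (Z x) ∂μ := by
  have hu := hasTemperateGrowth_fderiv_apply hF u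
  rw [h (fun x => fderiv ℝ F (Z x) u) (hu.comp Z.hasTemperateGrowth), ← integral_const_mul]
  refine integral_congr_ae (ae_of_all _ fun x => ?_)
  have hd := ((hu.1.differentiable (by simp)) (Z x)).hasFDerivAt
  have := (hd.comp x Z.hasFDerivAt).fderiv
  show fderiv ℝ ((fun y => fderiv ℝ F y u) ∘ Z) x v = _
  rw [this, ContinuousLinearMap.comp_apply, hZ, map_smul, smul_eq_mul]
  rfl

variable [BorelSpace V] [SecondCountableTopology V]

lemma hasDerivAt_integral_interpolate {μ : Measure V} (hμ : HasMoments μ) {F : E → ℝ}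
    (hF : F.HasTemperateGrowth) (X Y : V →L[ℝ] E) (θ : ℝ) :
    HasDerivAt (fun θ => ∫ x, F (interpolate X Y θ x) ∂μ)
      (∫ x, fderiv ℝ F (interpolate X Y θ x) (-sin θ • X x + cos θ • Y x) ∂μ) θ := by
  obtain ⟨k, C, hC⟩ := hF.2 1
  have hC0 : 0 ≤ C := by
    have := (norm_nonneg _).trans (hC 0)
    simpa using this
  set K : ℝ := ‖X‖ + ‖Y‖ + 1 with hK
  have hK0 : 0 ≤ ‖X‖ := norm_nonneg X
  have hK1 : 0 ≤ ‖Y‖ := norm_nonneg Y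
  have hb : ∀ (a b : ℝ), |a| ≤ 1 → |b| ≤ 1 → ∀ x, ‖a • X x + b • Y x‖ ≤ K * ‖x‖ := by
    intro a b ha hb x
    have h1 : ‖a • X x‖ ≤ ‖X‖ * ‖x‖ := by
      rw [norm_smul, norm_eq_abs]
      exact (mul_le_of_le_one_left (norm_nonneg _) ha).trans (X.le_opNorm x)
    have h2 : ‖b • Y x‖ ≤ ‖Y‖ * ‖x‖ := by
      rw [norm_smul, norm_eq_abs]
      exact (mul_le_of_le_one_left (norm_nonneg _) hb).trans (Y.le_opNorm x)
    refine (norm_add_le _ _).trans ?_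
    rw [hK]
    linarith [norm_nonneg x]
  have hcomp : ∀ θ, (fun x => F (interpolate X Y θ x)).HasTemperateGrowth := fun θ =>
    hF.comp (interpolate X Y θ).hasTemperateGrowth
  refine (hasDerivAt_integral_of_dominated_loc_of_deriv_le (s := univ)
    (F' := fun θ x => fderiv ℝ F (interpolate X Y θ x) (-sin θ • X x + cos θ • Y x))
    (bound := fun x => C * K ^ (k + 1) * (1 + ‖x‖) ^ (k + 1)) univ_mem
    (Eventually.of_forall fun θ => (hcomp θ).1.continuous.aestronglyMeasurable)
    (hμ.integrable (hcomp θ)) ?_ (ae_of_all _ fun x θ _ => ?_) ((hμ _).const_mul _)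
    (ae_of_all _ fun x θ _ => ?_)).2
  · have hc : Continuous (fderiv ℝ F) := hF.1.continuous_fderiv (by simp)
    refine Continuous.aestronglyMeasurable ?_
    refine (hc.comp (interpolate X Y θ).continuous).clm_apply ?_
    fun_prop
  · have h1 := hC (interpolate X Y θ x)
    rw [norm_iteratedFDeriv_one] at h1
    have h2 : ‖interpolate X Y θ x‖ ≤ K * ‖x‖ := hb _ _ (abs_cos_le_one θ) (abs_sin_le_one θ) x
    have h3 : ‖-sin θ • X x + cos θ • Y x‖ ≤ K * ‖x‖ :=
      hb _ _ (by rw [abs_neg]; exact abs_sin_le_one θ) (abs_cos_le_one θ) x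
    have hx := norm_nonneg x
    have h4 : 1 + ‖interpolate X Y θ x‖ ≤ K * (1 + ‖x‖) := by linarith
    have h5 : ‖-sin θ • X x + cos θ • Y x‖ ≤ K * (1 + ‖x‖) := by linarith
    calc _ ≤ ‖fderiv ℝ F (interpolate X Y θ x)‖ * ‖-sin θ • X x + cos θ • Y x‖ :=
          ContinuousLinearMap.le_opNorm _ _
      _ ≤ (C * (K * (1 + ‖x‖)) ^ k) * (K * (1 + ‖x‖)) := by
          refine mul_le_mul (h1.trans ?_) h5 (norm_nonneg _) (by positivity)
          gcongr
      _ = _ := by rw [mul_pow]; ring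
  · have hF' := ((hF.1.differentiable (by simp)) (interpolate X Y θ x)).hasFDerivAt
    have hd : HasDerivAt (fun θ => interpolate X Y θ x) (-sin θ • X x + cos θ • Y x) θ :=
      ((hasDerivAt_cos θ).smul_const (X x)).add ((hasDerivAt_sin θ).smul_const (Y x))
    exact hF'.comp_hasDerivAt θ hd

/-- If `X` and `Y` depend on disjoint sets of Gaussian coordinates and the second derivatives of `F`
along the coordinates of `X` dominate those along the coordinates of `Y`, then
`E F(Y) ≤ E F(X)`. -/
lemma integral_comp_le_of_secondDeriv {μ : Measure V} (hμ : HasMoments μ)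
    {ι κ : Type*} [Fintype ι] [Fintype κ] {v : ι → V} {φ : ι → V →L[ℝ] ℝ} {w : κ → V}
    {ψ : κ → V →L[ℝ] ℝ} (hv : ∀ i, SteinPair μ (v i) (φ i)) (hw : ∀ j, SteinPair μ (w j) (ψ j))
    {X Y : V →L[ℝ] E} (hX : ∀ x, X x = ∑ i, φ i x • X (v i)) (hY : ∀ x, Y x = ∑ j, ψ j x • Y (w j))
    (hXw : ∀ j, X (w j) = 0) (hYv : ∀ i, Y (v i) = 0) {F : E → ℝ} (hF : F.HasTemperateGrowth)
    (h : ∀ z, ∑ j, secondDeriv F (Y (w j)) z ≤ ∑ i, secondDeriv F (X (v i)) z) :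
    ∫ x, F (Y x) ∂μ ≤ ∫ x, F (X x) ∂μ := by
  set Φ : ℝ → ℝ := fun θ => ∫ x, F (interpolate X Y θ x) ∂μ with hΦ
  have hint : ∀ (φ : V →L[ℝ] ℝ) (θ : ℝ) (u : E),
      Integrable (fun x => φ x * fderiv ℝ F (interpolate X Y θ x) u) μ := fun φ θ u =>
    hμ.integrable (φ.hasTemperateGrowth.mul
      ((hasTemperateGrowth_fderiv_apply hF u).comp (interpolate X Y θ).hasTemperateGrowth))
  have hint2 : ∀ (θ : ℝ) (u : E),
      Integrable (fun x => secondDeriv F u (interpolate X Y θ x)) μ := fun θ u =>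
    hμ.integrable ((hasTemperateGrowth_secondDeriv hF u).comp
      (interpolate X Y θ).hasTemperateGrowth)
  -- A Stein integration in an `X` coordinate brings out `cos θ`, in a `Y` coordinate `sin θ`,
  -- because each coordinate moves only one of the two maps. Both groups thus carry `sin θ * cos θ`,
  -- with opposite signs.
  have hderiv : ∀ θ, ∫ x, fderiv ℝ F (interpolate X Y θ x) (-sin θ • X x + cos θ • Y x) ∂μ =
      sin θ * cos θ * ∫ x, (∑ j, secondDeriv F (Y (w j)) (interpolate X Y θ x) -
        ∑ i, secondDeriv F (X (v i)) (interpolate X Y θ x)) ∂μ := by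
    intro θ
    have e : ∀ x, fderiv ℝ F (interpolate X Y θ x) (-sin θ • X x + cos θ • Y x) =
        -sin θ * ∑ i, φ i x * fderiv ℝ F (interpolate X Y θ x) (X (v i)) +
        cos θ * ∑ j, ψ j x * fderiv ℝ F (interpolate X Y θ x) (Y (w j)) := by
      intro x
      conv_lhs => rw [hX x, hY x]
      simp only [map_add, map_smul, map_sum, smul_eq_mul]
    simp_rw [e]
    rw [integral_add ((integrable_finsetSum _ fun i _ => hint _ _ _).const_mul _)
      ((integrable_finsetSum _ fun i _ => hint _ _ _).const_mul _), integral_const_mul,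
      integral_const_mul, integral_finsetSum _ (fun i _ => hint _ _ _),
      integral_finsetSum _ (fun i _ => hint _ _ _),
      integral_sub (integrable_finsetSum _ fun i _ => hint2 _ _)
        (integrable_finsetSum _ fun i _ => hint2 _ _),
      integral_finsetSum _ (fun i _ => hint2 _ _), integral_finsetSum _ (fun i _ => hint2 _ _)]
    have e1 : ∀ i, ∫ x, φ i x * fderiv ℝ F (interpolate X Y θ x) (X (v i)) ∂μ =
        cos θ * ∫ x, secondDeriv F (X (v i)) (interpolate X Y θ x) ∂μ := fun i =>
      (hv i).integral_mul_fderiv hF _ (by simp [interpolate, hYv i])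
    have e2 : ∀ j, ∫ x, ψ j x * fderiv ℝ F (interpolate X Y θ x) (Y (w j)) ∂μ =
        sin θ * ∫ x, secondDeriv F (Y (w j)) (interpolate X Y θ x) ∂μ := fun j =>
      (hw j).integral_mul_fderiv hF _ (by simp [interpolate, hXw j])
    simp_rw [e1, e2, ← Finset.mul_sum]
    ring
  -- The path runs from `X` at `0` to `Y` at `π / 2`, and on it `sin θ * cos θ` is nonnegative.
  have hanti : AntitoneOn Φ (Icc 0 (π / 2)) := by
    refine antitoneOn_of_hasDerivWithinAt_nonpos (convex_Icc _ _)
      (fun θ _ => (hasDerivAt_integral_interpolate hμ hF X Y θ).continuousAt.continuousWithinAt)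
      (fun θ _ => (hasDerivAt_integral_interpolate hμ hF X Y θ).hasDerivWithinAt) fun θ hθ => ?_
    rw [interior_Icc] at hθ
    rw [hderiv θ]
    refine mul_nonpos_of_nonneg_of_nonpos (mul_nonneg ?_ ?_) ?_
    · exact sin_nonneg_of_nonneg_of_le_pi hθ.1.le (by linarith [hθ.2, pi_pos])
    · exact cos_nonneg_of_neg_pi_div_two_le_of_le (by linarith [hθ.1, pi_pos]) hθ.2.le
    · exact integral_nonpos fun x => sub_nonpos.2 (h _)
  have h1 := hanti ⟨le_rfl, by positivity⟩ ⟨by positivity, le_rfl⟩ (by positivity : 0 ≤ π / 2)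
  simpa [hΦ, interpolate] using h1

end Interpolation

/-! ### The smoothed indicator -/

section SmoothIndicator

open Function

/-- A smooth monotone approximation of the indicator of `(0, ∞)`. -/
def softStep (v : ℝ) : ℝ := (1 + sin (arctan v)) / 2

lemma softStep_nonneg (v : ℝ) : 0 ≤ softStep v := by
  have := neg_one_le_sin (arctan v)
  unfold softStep; linarith

lemma softStep_le_one (v : ℝ) : softStep v ≤ 1 := by
  have := sin_le_one (arctan v)
  unfold softStep; linarith

/-- `sin (arctan v) = v / √(1 + v²)`: the algebraic form shows the growth of all derivatives. -/
lemma hasTemperateGrowth_softStep : softStep.HasTemperateGrowth := by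
  have e : softStep = fun v => (1 + v * (1 + ‖v‖ ^ 2) ^ (-(1 / 2) : ℝ)) * (1 / 2) := by
    funext v
    rw [softStep, sin_arctan, norm_eq_abs, sq_abs, rpow_neg (by positivity), ← sqrt_eq_rpow]
    ring
  rw [e]
  fun_prop

lemma deriv_softStep_nonneg (v : ℝ) : 0 ≤ deriv softStep v := by
  have h : HasDerivAt softStep (cos (arctan v) * (1 / (1 + v ^ 2)) / 2) v :=
    ((((hasDerivAt_sin _).comp v (hasDerivAt_arctan v)).const_add 1).div_const 2)
  rw [h.deriv]
  have := cos_arctan_pos v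
  positivity

lemma tendsto_softStep (v : ℝ) : Tendsto (fun s : ℝ => softStep (s * v)) atTop
    (𝓝 (if 0 < v then 1 else if v = 0 then 1 / 2 else 0)) := by
  have h : ∀ {l : Filter ℝ} {c : ℝ}, Tendsto (fun s : ℝ => arctan (s * v)) atTop l →
      l ≤ 𝓝 c → Tendsto (fun s : ℝ => softStep (s * v)) atTop (𝓝 ((1 + sin c) / 2)) := by
    intro l c h1 h2
    exact ((((continuous_sin.tendsto c).comp (h1.mono_right h2)).const_add 1).div_const 2)
  split_ifs with h1 h2
  · have := h (tendsto_arctan_atTop.comp (tendsto_id.atTop_mul_const h1)) nhdsWithin_le_nhds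
    simpa using this
  · simp [h2, softStep]
  · have hv : v < 0 := lt_of_le_of_ne (not_lt.1 h1) h2
    have := h (tendsto_arctan_atBot.comp (tendsto_id.atTop_mul_const_of_neg hv)) nhdsWithin_le_nhds
    simpa using this

variable {m : ℕ}

/-- `√(1 + ‖p‖²)`. -/
def softNorm (p : EuclideanSpace ℝ (Fin m)) : ℝ := (1 + ‖p‖ ^ 2) ^ (1 / 2 : ℝ)

lemma le_softNorm (p : EuclideanSpace ℝ (Fin m)) : ‖p‖ ≤ softNorm p := by
  rw [softNorm, ← sqrt_eq_rpow]
  exact le_sqrt_of_sq_le (by linarith)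

/-- Smoothing the norm at the origin costs an additive `1`, negligible against `√n`. -/
lemma softNorm_le (p : EuclideanSpace ℝ (Fin m)) : softNorm p ≤ 1 + ‖p‖ := by
  rw [softNorm, ← sqrt_eq_rpow]
  exact sqrt_le_iff.2 ⟨by positivity, by nlinarith [norm_nonneg p]⟩

lemma hasTemperateGrowth_softNorm :
    (softNorm : EuclideanSpace ℝ (Fin m) → ℝ).HasTemperateGrowth := by
  unfold softNorm; fun_prop

lemma hasFDerivAt_softNorm (p : EuclideanSpace ℝ (Fin m)) :
    HasFDerivAt softNorm ((softNorm p)⁻¹ • innerSL ℝ p) p := by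
  have hpos : 0 < 1 + ‖p‖ ^ 2 := by positivity
  have h := (((hasFDerivAt_id p).norm_sq).const_add 1).rpow_const (p := 1 / 2) (Or.inl hpos.ne')
  convert! h using 1
  ext u
  simp [softNorm]
  rw [← rpow_neg hpos.le, ← mul_assoc]
  norm_num
  left
  ring

/-- A smooth approximation of the indicator of `‖p‖ + z > l`. -/
def softInd (s l : ℝ) (y : EuclideanSpace ℝ (Fin m) × ℝ) : ℝ :=
  softStep (s * (softNorm y.1 + y.2 - l))

lemma hasTemperateGrowth_softInd (s l : ℝ) :
    (softInd s l : EuclideanSpace ℝ (Fin m) × ℝ → ℝ).HasTemperateGrowth := by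
  have h1 : (fun y : EuclideanSpace ℝ (Fin m) × ℝ => softNorm y.1).HasTemperateGrowth :=
    hasTemperateGrowth_softNorm.comp
      (ContinuousLinearMap.fst ℝ (EuclideanSpace ℝ (Fin m)) ℝ).hasTemperateGrowth
  have h2 : (fun y : EuclideanSpace ℝ (Fin m) × ℝ => y.2).HasTemperateGrowth :=
    (ContinuousLinearMap.snd ℝ (EuclideanSpace ℝ (Fin m)) ℝ).hasTemperateGrowth
  exact hasTemperateGrowth_softStep.comp ((HasTemperateGrowth.const s).mul
    ((h1.add h2).sub (.const l)))

/-- The gradient is a nonnegative multiple of `(N, 1)` with `N` in the unit ball. This is all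
Gordon's off-diagonal inequality uses, with `N` in the role of the dual unit vector. -/
lemma exists_fderiv_softInd {s : ℝ} (hs : 0 ≤ s) (l : ℝ) (y : EuclideanSpace ℝ (Fin m) × ℝ) :
    ∃ (b : ℝ) (N : Fin m → ℝ), 0 ≤ b ∧ ∑ i, N i ^ 2 ≤ 1 ∧ fderiv ℝ (softInd s l) y (0, 1) = b ∧
      ∀ i, fderiv ℝ (softInd s l) y (EuclideanSpace.single i 1, 0) = b * N i := by
  have h1 : HasFDerivAt (fun y : EuclideanSpace ℝ (Fin m) × ℝ => s * (softNorm y.1 + y.2 - l))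
      (s • (((softNorm y.1)⁻¹ • innerSL ℝ y.1).comp (ContinuousLinearMap.fst ℝ _ _) +
        ContinuousLinearMap.snd ℝ _ _)) y :=
    ((((hasFDerivAt_softNorm y.1).comp y hasFDerivAt_fst).add
      hasFDerivAt_snd).sub_const l).const_mul s
  have h2 : HasDerivAt softStep (deriv softStep (s * (softNorm y.1 + y.2 - l)))
      (s * (softNorm y.1 + y.2 - l)) :=
    ((hasTemperateGrowth_softStep.1.differentiable (by simp)) _).hasDerivAt
  have h3 : HasFDerivAt (softInd s l) _ y := h2.comp_hasFDerivAt y h1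
  refine ⟨deriv softStep (s * (softNorm y.1 + y.2 - l)) * s, fun i => (softNorm y.1)⁻¹ * y.1 i,
    mul_nonneg (deriv_softStep_nonneg _) hs, ?_, ?_, fun i => ?_⟩
  · have hn : ∑ i, y.1 i ^ 2 = ‖y.1‖ ^ 2 := by
      rw [EuclideanSpace.norm_sq_eq]; simp
    simp_rw [mul_pow]
    rw [← Finset.mul_sum, hn, ← mul_pow]
    have h4 := le_softNorm y.1
    have h5 : 0 ≤ softNorm y.1 := (norm_nonneg _).trans h4
    refine pow_le_one₀ (by positivity) ?_
    rw [inv_mul_eq_div]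
    exact div_le_one_of_le₀ h4 h5
  · rw [h3.fderiv]; simp
  · rw [h3.fderiv]
    simp [EuclideanSpace.inner_single_right]
    ring

end SmoothIndicator

/-! ### Second derivatives of products -/

section Product

open Function

variable {E : Type*} [NormedAddCommGroup E] [NormedSpace ℝ E]

lemma secondDeriv_smul {F : E → ℝ} (hF : F.HasTemperateGrowth) (c : ℝ) (u z : E) :
    secondDeriv F (c • u) z = c ^ 2 * secondDeriv F u z := by
  have hd := ((hasTemperateGrowth_fderiv_apply hF u).1.differentiable (by simp)) z
  unfold secondDeriv
  simp_rw [map_smul, smul_eq_mul]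
  rw [fderiv_const_mul hd]
  simp
  ring

variable {τ : Type*} [Fintype τ] [DecidableEq τ]

lemma hasTemperateGrowth_prod {ι : Type*} {f : ι → E → ℝ} (s : Finset ι)
    (hf : ∀ i, (f i).HasTemperateGrowth) : (fun z => ∏ i ∈ s, f i z).HasTemperateGrowth := by
  classical
  induction s using Finset.induction_on with
  | empty => simp
  | insert a s ha ih =>
    simp_rw [Finset.prod_insert ha]
    exact (hf a).mul ih

lemma hasFDerivAt_prod_eval {a : E → ℝ} (ha : a.HasTemperateGrowth) (s : Finset τ) (z : τ → E) :
    HasFDerivAt (fun z : τ → E => ∏ w ∈ s, a (z w)) (∑ w ∈ s, (∏ w' ∈ s.erase w, a (z w')) •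
      (fderiv ℝ a (z w)).comp (ContinuousLinearMap.proj w)) z := by
  refine HasFDerivAt.finsetProd fun w _ => ?_
  exact ((ha.1.differentiable (by simp)) (z w)).hasFDerivAt.comp z
    (ContinuousLinearMap.proj (R := ℝ) (φ := fun _ : τ => E) w).hasFDerivAt

/-- Diagonal terms will be compared through variances, off-diagonal ones through covariances between
different indices. -/
lemma secondDeriv_prod {a : E → ℝ} (ha : a.HasTemperateGrowth) (u z : τ → E) :
    secondDeriv (fun z : τ → E => ∏ w, a (z w)) u z =
      ∑ w, (∏ w' ∈ Finset.univ.erase w, a (z w')) * secondDeriv a (u w) (z w) +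
      ∑ w, ∑ w' ∈ Finset.univ.erase w, (∏ w'' ∈ (Finset.univ.erase w).erase w', a (z w'')) *
        (fderiv ℝ a (z w') (u w') * fderiv ℝ a (z w) (u w)) := by
  have h1 : (fun y : τ → E => fderiv ℝ (fun z : τ → E => ∏ w, a (z w)) y u) =
      fun y => ∑ w, (∏ w' ∈ Finset.univ.erase w, a (y w')) * fderiv ℝ a (y w) (u w) := by
    funext y
    rw [(hasFDerivAt_prod_eval ha _ y).fderiv]
    simp
  have hc : ∀ w, HasFDerivAt (fun y : τ → E => fderiv ℝ a (y w) (u w))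
      ((fderiv ℝ (fun x => fderiv ℝ a x (u w)) (z w)).comp (ContinuousLinearMap.proj w)) z :=
    fun w => HasFDerivAt.comp (g := fun x => fderiv ℝ a x (u w)) z
      (((hasTemperateGrowth_fderiv_apply ha (u w)).1.differentiable (by simp)) (z w)).hasFDerivAt
      (ContinuousLinearMap.proj (R := ℝ) (φ := fun _ : τ => E) w).hasFDerivAt
  have h2 : HasFDerivAt (fun y : τ → E =>
      ∑ w, (∏ w' ∈ Finset.univ.erase w, a (y w')) * fderiv ℝ a (y w) (u w)) _ z :=
    HasFDerivAt.fun_sum fun w _ => (hasFDerivAt_prod_eval ha _ z).mul (hc w)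
  rw [secondDeriv, h1, h2.fderiv, ← Finset.sum_add_distrib]
  simp only [sum_apply, add_apply,
    smul_apply, ContinuousLinearMap.comp_apply, ContinuousLinearMap.proj_apply,
    smul_eq_mul, secondDeriv, Finset.mul_sum]
  refine Finset.sum_congr rfl fun w _ => ?_
  congr 1
  refine Finset.sum_congr rfl fun w' _ => ?_
  ring

end Product

/-! ### Gordon's comparison -/

section Gordon

variable {m n : ℕ}

/-- The law of a vector with i.i.d. standard normal entries. -/
def gaussianVector (n : ℕ) : Measure (Fin n → ℝ) := Measure.pi fun _ => gaussianReal 0 1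

instance : IsProbabilityMeasure (gaussianVector n) := by
  unfold gaussianVector; infer_instance

instance : IsProbabilityMeasure (gaussianMatrix m n) := by
  unfold gaussianMatrix; infer_instance

lemma hasMoments_gaussianVector : HasMoments (gaussianVector n) := hasMoments_gaussianReal.pi n

lemma hasMoments_gaussianMatrix : HasMoments (gaussianMatrix m n) :=
  (hasMoments_gaussianVector (n := n)).pi m

lemma steinPair_gaussianVector (j : Fin n) :
    SteinPair (gaussianVector n) (Pi.single j 1)
      ((ContinuousLinearMap.id ℝ ℝ).comp (ContinuousLinearMap.proj j)) :=
  steinPair_gaussianReal.pi hasMoments_gaussianReal j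

lemma steinPair_gaussianMatrix (i : Fin m) (j : Fin n) :
    SteinPair (gaussianMatrix m n) (Pi.single i (Pi.single j 1))
      (((ContinuousLinearMap.id ℝ ℝ).comp (ContinuousLinearMap.proj j)).comp
        (ContinuousLinearMap.proj i)) :=
  (steinPair_gaussianVector j).pi hasMoments_gaussianVector i

/-- The sample space carrying a matrix, a number and two vectors. -/
abbrev GordonSpace (m n : ℕ) := (Fin m → Fin n → ℝ) × ℝ × (Fin m → ℝ) × (Fin n → ℝ)

/-- All entries are i.i.d. standard normal. -/
def gordonMeasure (m n : ℕ) : Measure (GordonSpace m n) :=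
  (gaussianMatrix m n).prod ((gaussianReal 0 1).prod ((gaussianVector m).prod (gaussianVector n)))

instance : IsProbabilityMeasure (gordonMeasure m n) := by
  unfold gordonMeasure; infer_instance

lemma hasMoments_gordonMeasure : HasMoments (gordonMeasure m n) :=
  hasMoments_gaussianMatrix.prod (hasMoments_gaussianReal.prod
    (hasMoments_gaussianVector.prod hasMoments_gaussianVector))

/-- The coordinates of the first process. -/
def matVec (m n : ℕ) : Option (Fin m × Fin n) → GordonSpace m n
  | some (i, j) => (Pi.single i (Pi.single j 1), 0)
  | none => (0, (1, 0))

/-- The coordinate functionals of the first process. -/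
def matFun (m n : ℕ) : Option (Fin m × Fin n) → GordonSpace m n →L[ℝ] ℝ
  | some (i, j) => (((ContinuousLinearMap.id ℝ ℝ).comp (ContinuousLinearMap.proj j)).comp
      (ContinuousLinearMap.proj i)).comp (ContinuousLinearMap.fst ℝ _ _)
  | none => ((ContinuousLinearMap.id ℝ ℝ).comp (ContinuousLinearMap.fst ℝ _ _)).comp
      (ContinuousLinearMap.snd ℝ _ _)

lemma steinPair_matVec (k : Option (Fin m × Fin n)) :
    SteinPair (gordonMeasure m n) (matVec m n k) (matFun m n k) := by
  have h2 := (hasMoments_gaussianVector (n := m)).prod (hasMoments_gaussianVector (n := n))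
  rcases k with _ | ⟨i, j⟩
  · exact (steinPair_gaussianReal.prod_left hasMoments_gaussianReal h2).prod_right
      hasMoments_gaussianMatrix (hasMoments_gaussianReal.prod h2)
  · exact (steinPair_gaussianMatrix i j).prod_left hasMoments_gaussianMatrix
      (hasMoments_gaussianReal.prod h2)

/-- The coordinates of the second process. -/
def vecVec (m n : ℕ) : Fin m ⊕ Fin n → GordonSpace m n
  | .inl i => (0, (0, (Pi.single i 1, 0)))
  | .inr j => (0, (0, (0, Pi.single j 1)))

/-- The coordinate functionals of the second process. -/
def vecFun (m n : ℕ) : Fin m ⊕ Fin n → GordonSpace m n →L[ℝ] ℝ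
  | .inl i => ((((ContinuousLinearMap.id ℝ ℝ).comp (ContinuousLinearMap.proj i)).comp
      (ContinuousLinearMap.fst ℝ _ _)).comp (ContinuousLinearMap.snd ℝ _ _)).comp
        (ContinuousLinearMap.snd ℝ _ _)
  | .inr j => ((((ContinuousLinearMap.id ℝ ℝ).comp (ContinuousLinearMap.proj j)).comp
      (ContinuousLinearMap.snd ℝ _ _)).comp (ContinuousLinearMap.snd ℝ _ _)).comp
        (ContinuousLinearMap.snd ℝ _ _)

lemma steinPair_vecVec (k : Fin m ⊕ Fin n) :
    SteinPair (gordonMeasure m n) (vecVec m n k) (vecFun m n k) := by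
  have h2 := (hasMoments_gaussianVector (n := m)).prod (hasMoments_gaussianVector (n := n))
  rcases k with i | j
  · exact (((steinPair_gaussianVector i).prod_left hasMoments_gaussianVector
      hasMoments_gaussianVector).prod_right hasMoments_gaussianReal h2).prod_right
      hasMoments_gaussianMatrix (hasMoments_gaussianReal.prod h2)
  · exact (((steinPair_gaussianVector j).prod_right hasMoments_gaussianVector
      hasMoments_gaussianVector).prod_right hasMoments_gaussianReal h2).prod_right
      hasMoments_gaussianMatrix (hasMoments_gaussianReal.prod h2)

/-! ### The two Gaussian processes and their comparison. -/

variable {τ : Type*}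

/-- The process `w ↦ (A w, g)`. -/
def matProc (m : ℕ) (w : τ → Fin n → ℝ) :
    GordonSpace m n →L[ℝ] (τ → EuclideanSpace ℝ (Fin m) × ℝ) :=
  LinearMap.toContinuousLinearMap
    { toFun := fun x t => (WithLp.toLp 2 (Matrix.of x.1 *ᵥ w t), x.2.1)
      map_add' := fun x y => by
        funext t; ext <;> simp [Matrix.mulVec, dotProduct, add_mul, Finset.sum_add_distrib]
      map_smul' := fun c x => by
        funext t; ext <;> simp [Matrix.mulVec, dotProduct, mul_assoc, Finset.mul_sum] }

/-- The process `w ↦ (g, ⟨h, w⟩)`. -/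
def vecProc (m : ℕ) (w : τ → Fin n → ℝ) :
    GordonSpace m n →L[ℝ] (τ → EuclideanSpace ℝ (Fin m) × ℝ) :=
  LinearMap.toContinuousLinearMap
    { toFun := fun x t => (WithLp.toLp 2 x.2.2.1, x.2.2.2 ⬝ᵥ w t)
      map_add' := fun x y => by funext t; ext <;> simp [add_dotProduct]
      map_smul' := fun c x => by funext t; ext <;> simp }

lemma matProc_apply (w : τ → Fin n → ℝ) (x : GordonSpace m n) (t : τ) :
    matProc m w x t = (WithLp.toLp 2 (Matrix.of x.1 *ᵥ w t), x.2.1) := rfl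

lemma vecProc_apply (w : τ → Fin n → ℝ) (x : GordonSpace m n) (t : τ) :
    vecProc m w x t = (WithLp.toLp 2 x.2.2.1, x.2.2.2 ⬝ᵥ w t) := rfl

lemma matProc_some (w : τ → Fin n → ℝ) (i : Fin m) (j : Fin n) (t : τ) :
    matProc m w (matVec m n (some (i, j))) t = w t j • (EuclideanSpace.single i 1, (0 : ℝ)) := by
  rw [matProc_apply]
  ext k
  · by_cases hk : k = i
    · subst hk; simp [matVec, Matrix.mulVec, dotProduct, Pi.single_apply]
    · simp [matVec, Matrix.mulVec, dotProduct, hk]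
  · simp [matVec]

lemma matProc_none (w : τ → Fin n → ℝ) (t : τ) :
    matProc m w (matVec m n none) t = (0, 1) := by
  rw [matProc_apply]
  ext k <;> simp [matVec, Matrix.mulVec, dotProduct]

lemma vecProc_inl (w : τ → Fin n → ℝ) (i : Fin m) (t : τ) :
    vecProc m w (vecVec m n (.inl i)) t = (EuclideanSpace.single i 1, 0) := by
  rw [vecProc_apply]
  ext k <;> simp [vecVec, Pi.single_apply]

lemma vecProc_inr (w : τ → Fin n → ℝ) (j : Fin n) (t : τ) :
    vecProc m w (vecVec m n (.inr j)) t = w t j • (0, 1) := by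
  rw [vecProc_apply]
  ext k <;> simp [vecVec]

lemma matProc_vecVec (w : τ → Fin n → ℝ) (k : Fin m ⊕ Fin n) :
    matProc m w (vecVec m n k) = 0 := by
  funext t
  rcases k with i | j <;> ext <;> simp [matProc_apply, vecVec]

lemma vecProc_matVec (w : τ → Fin n → ℝ) (k : Option (Fin m × Fin n)) :
    vecProc m w (matVec m n k) = 0 := by
  funext t
  rcases k with _ | ⟨i, j⟩ <;> ext <;> simp [vecProc_apply, matVec]

lemma matProc_eq_sum (w : τ → Fin n → ℝ) (x : GordonSpace m n) :
    matProc m w x = ∑ k, matFun m n k x • matProc m w (matVec m n k) := by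
  funext t
  rw [Fintype.sum_option, Fintype.sum_prod_type]
  simp only [Pi.add_apply, Pi.smul_apply, Finset.sum_apply, matProc_some, matProc_none]
  ext k
  · simp [matProc_apply, matFun, Matrix.mulVec, dotProduct, Prod.fst_sum, Pi.single_apply]
  · simp [matProc_apply, matFun, Prod.snd_sum]

lemma vecProc_eq_sum (w : τ → Fin n → ℝ) (x : GordonSpace m n) :
    vecProc m w x = ∑ k, vecFun m n k x • vecProc m w (vecVec m n k) := by
  funext t
  rw [Fintype.sum_sum_type]
  simp only [Pi.add_apply, Pi.smul_apply, Finset.sum_apply, vecProc_inl, vecProc_inr]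
  ext k
  · simp [vecProc_apply, vecFun, Prod.fst_sum, Pi.single_apply]
  · simp [vecProc_apply, vecFun, Prod.snd_sum, dotProduct]

/-- For a unit vector `w` both processes have the same covariance at a fixed index, namely the
identity. The extra scalar `g` next to `A w` is there to make this true. -/
lemma softInd_diag {s : ℝ} (l : ℝ) {w : Fin n → ℝ} (hw : ∑ j, w j ^ 2 = 1)
    (y : EuclideanSpace ℝ (Fin m) × ℝ) :
    ∑ i, secondDeriv (softInd s l) (EuclideanSpace.single i 1, 0) y +
      ∑ j, secondDeriv (softInd s l) (w j • (0, 1)) y =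
    secondDeriv (softInd s l) (0, 1) y +
      ∑ i, ∑ j, secondDeriv (softInd s l) (w j • (EuclideanSpace.single i 1, (0 : ℝ))) y := by
  simp_rw [secondDeriv_smul (hasTemperateGrowth_softInd s l), ← Finset.sum_mul, hw, one_mul]
  ring

/-- After factoring the gradients the difference of the two sides is a nonnegative multiple of `(1 -
⟨N', N⟩) (1 - ⟨w', w⟩)`, and both inner products are at most `1`. -/
lemma softInd_offDiag {s : ℝ} (hs : 0 ≤ s) (l : ℝ) {w w' : Fin n → ℝ} (hw : ∑ j, w j ^ 2 = 1)
    (hw' : ∑ j, w' j ^ 2 = 1) (y y' : EuclideanSpace ℝ (Fin m) × ℝ) :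
    ∑ i, fderiv ℝ (softInd s l) y' (EuclideanSpace.single i 1, 0) *
        fderiv ℝ (softInd s l) y (EuclideanSpace.single i 1, 0) +
      ∑ j, fderiv ℝ (softInd s l) y' (w' j • (0, 1)) *
        fderiv ℝ (softInd s l) y (w j • (0, 1)) ≤
    fderiv ℝ (softInd s l) y' (0, 1) * fderiv ℝ (softInd s l) y (0, 1) +
      ∑ i, ∑ j, fderiv ℝ (softInd s l) y' (w' j • (EuclideanSpace.single i 1, (0 : ℝ))) *
        fderiv ℝ (softInd s l) y (w j • (EuclideanSpace.single i 1, (0 : ℝ))) := by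
  obtain ⟨b, N, hb, hN, h1, h2⟩ := exists_fderiv_softInd hs l y
  obtain ⟨b', N', hb', hN', h1', h2'⟩ := exists_fderiv_softInd hs l y'
  simp_rw [map_smul, smul_eq_mul, h1, h2, h1', h2']
  have key : ∀ {k : ℕ} (a c : Fin k → ℝ), ∑ i, a i ^ 2 ≤ 1 → ∑ i, c i ^ 2 ≤ 1 →
      ∑ i, a i * c i ≤ 1 := by
    intro k a c ha hc
    have : ∑ i, a i * c i ≤ ∑ i, (a i ^ 2 + c i ^ 2) / 2 :=
      Finset.sum_le_sum fun i _ => by nlinarith [sq_nonneg (a i - c i)]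
    rw [← Finset.sum_div, Finset.sum_add_distrib] at this
    linarith
  have k1 := key N' N hN' hN
  have k2 := key w' w hw'.le hw.le
  have e1 : ∑ i, b' * N' i * (b * N i) = b' * b * ∑ i, N' i * N i := by
    rw [Finset.mul_sum]; exact Finset.sum_congr rfl fun i _ => by ring
  have e2 : ∑ j, w' j * b' * (w j * b) = b' * b * ∑ j, w' j * w j := by
    rw [Finset.mul_sum]; exact Finset.sum_congr rfl fun i _ => by ring
  have e3 : ∑ i, ∑ j, w' j * (b' * N' i) * (w j * (b * N i)) =
      b' * b * ((∑ i, N' i * N i) * ∑ j, w' j * w j) := by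
    rw [Finset.sum_mul_sum, Finset.mul_sum]
    refine Finset.sum_congr rfl fun i _ => ?_
    rw [Finset.mul_sum]; exact Finset.sum_congr rfl fun i _ => by ring
  rw [e1, e2, e3]
  have := mul_nonneg (mul_nonneg hb' hb) (mul_nonneg (sub_nonneg.2 k1) (sub_nonneg.2 k2))
  linarith

lemma integral_prod_softInd_le [Fintype τ] {s : ℝ} (hs : 0 ≤ s) (l : ℝ) (w : τ → Fin n → ℝ)
    (hw : ∀ t, ∑ j, w t j ^ 2 = 1) :
    ∫ x, ∏ t, softInd s l (vecProc m w x t) ∂(gordonMeasure m n) ≤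
      ∫ x, ∏ t, softInd s l (matProc m w x t) ∂(gordonMeasure m n) := by
  classical
  have ha := hasTemperateGrowth_softInd (m := m) s l
  have hpos : ∀ y : EuclideanSpace ℝ (Fin m) × ℝ, 0 ≤ softInd s l y := fun y => softStep_nonneg _
  refine integral_comp_le_of_secondDeriv (F := fun z : τ → EuclideanSpace ℝ (Fin m) × ℝ =>
      ∏ t, softInd s l (z t)) hasMoments_gordonMeasure steinPair_matVec
    steinPair_vecVec (matProc_eq_sum w) (vecProc_eq_sum w) (matProc_vecVec w) (vecProc_matVec w)
    (hasTemperateGrowth_prod _ fun t => ha.comp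
      (ContinuousLinearMap.proj (R := ℝ) 
        (φ := fun _ : τ => EuclideanSpace ℝ (Fin m) × ℝ) t).hasTemperateGrowth) fun z => ?_
  simp_rw [secondDeriv_prod ha]
  rw [Finset.sum_add_distrib, Finset.sum_add_distrib]
  refine add_le_add (le_of_eq ?_) ?_
  · rw [Finset.sum_comm, Finset.sum_comm (s := Finset.univ (α := Option _))]
    refine Finset.sum_congr rfl fun t _ => ?_
    simp_rw [← Finset.mul_sum]
    congr 1
    rw [Fintype.sum_sum_type, Fintype.sum_option, Fintype.sum_prod_type]
    simp_rw [matProc_some, matProc_none, vecProc_inl, vecProc_inr]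
    exact softInd_diag l (hw t) _
  · rw [Finset.sum_comm, Finset.sum_comm (s := Finset.univ (α := Option _))]
    refine Finset.sum_le_sum fun t _ => ?_
    rw [Finset.sum_comm, Finset.sum_comm (s := Finset.univ (α := Option _))]
    refine Finset.sum_le_sum fun t' _ => ?_
    simp_rw [← Finset.mul_sum]
    refine mul_le_mul_of_nonneg_left ?_ (Finset.prod_nonneg fun _ _ => hpos _)
    rw [Fintype.sum_sum_type, Fintype.sum_option, Fintype.sum_prod_type]
    simp_rw [matProc_some, matProc_none, vecProc_inl, vecProc_inr]
    exact softInd_offDiag hs l (hw t) (hw t') _ _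

/-- As `s` tends to infinity the products converge to the indicator that all indices exceed `l`,
except on the boundary, where a factor is `1 / 2`. This accounts for the strict inequality on one
side and the weak one on the other. -/
lemma measure_exists_lt_le [Fintype τ] (l : ℝ) (w : τ → Fin n → ℝ) (hw : ∀ t, ∑ j, w t j ^ 2 = 1) :
    gordonMeasure m n {x | ∃ t, softNorm (matProc m w x t).1 + (matProc m w x t).2 < l} ≤
      gordonMeasure m n {x | ∃ t, softNorm (vecProc m w x t).1 + (vecProc m w x t).2 ≤ l} := by
  classical
  set μ := gordonMeasure m n
  set χ : ℝ → ℝ := fun v => if 0 < v then 1 else if v = 0 then 1 / 2 else 0 with hχ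
  have hχ0 : ∀ v, 0 ≤ χ v := fun v => by simp only [hχ]; split_ifs <;> norm_num
  have hχ1 : ∀ v, χ v ≤ 1 := fun v => by simp only [hχ]; split_ifs <;> norm_num
  have hN : Continuous fun y : EuclideanSpace ℝ (Fin m) × ℝ => softNorm y.1 + y.2 - l :=
    ((hasTemperateGrowth_softNorm.1.continuous.comp continuous_fst).add continuous_snd).sub
      continuous_const
  have hlim : ∀ Z : GordonSpace m n →L[ℝ] (τ → EuclideanSpace ℝ (Fin m) × ℝ),
      Tendsto (fun s : ℝ => ∫ x, ∏ t, softInd s l (Z x t) ∂μ) atTop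
        (𝓝 (∫ x, ∏ t, χ (softNorm (Z x t).1 + (Z x t).2 - l) ∂μ)) := by
    intro Z
    refine tendsto_integral_filter_of_dominated_convergence (fun _ => 1)
      (Eventually.of_forall fun s => ?_) (Eventually.of_forall fun s => ae_of_all _ fun x => ?_)
      (integrable_const 1) (ae_of_all _ fun x => ?_)
    · refine Continuous.aestronglyMeasurable (continuous_finsetProd _ fun t _ => ?_)
      exact (hasTemperateGrowth_softInd s l).1.continuous.comp
        ((continuous_apply t).comp Z.continuous)
    · have h0 : 0 ≤ ∏ t, softInd s l (Z x t) := Finset.prod_nonneg fun _ _ => softStep_nonneg _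
      rw [norm_eq_abs, abs_of_nonneg h0]
      exact Finset.prod_le_one (fun _ _ => softStep_nonneg _) fun _ _ => softStep_le_one _
    · exact tendsto_finsetProd _ fun t _ => tendsto_softStep _
  have hle := le_of_tendsto_of_tendsto (hlim (vecProc m w)) (hlim (matProc m w))
    ((eventually_ge_atTop 0).mono fun s hs => integral_prod_softInd_le hs l w hw)
  have hmeas : ∀ Z : GordonSpace m n →L[ℝ] (τ → EuclideanSpace ℝ (Fin m) × ℝ),
      MeasurableSet {x | ∃ t, softNorm (Z x t).1 + (Z x t).2 < l} ∧
      MeasurableSet {x | ∃ t, softNorm (Z x t).1 + (Z x t).2 ≤ l} := by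
    intro Z
    have hZ : ∀ t, Measurable fun x => softNorm (Z x t).1 + (Z x t).2 - l := fun t =>
      (hN.comp ((continuous_apply t).comp Z.continuous)).measurable
    refine ⟨?_, ?_⟩
    · rw [ofPred_exists]
      refine MeasurableSet.iUnion fun t => ?_
      have := measurableSet_lt (hZ t) (measurable_const (a := (0 : ℝ)))
      simpa only [sub_neg] using this
    · rw [ofPred_exists]
      refine MeasurableSet.iUnion fun t => ?_
      have := measurableSet_le (hZ t) (measurable_const (a := (0 : ℝ)))
      simpa only [sub_nonpos] using this
  have hint : ∀ Z : GordonSpace m n →L[ℝ] (τ → EuclideanSpace ℝ (Fin m) × ℝ),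
      Integrable (fun x => ∏ t, χ (softNorm (Z x t).1 + (Z x t).2 - l)) μ := by
    intro Z
    have hχm : Measurable χ := Measurable.ite measurableSet_Ioi measurable_const
      (Measurable.ite (measurableSet_singleton 0) measurable_const measurable_const)
    refine (integrable_const (1 : ℝ)).mono' (Finset.measurable_prod _ fun t _ => hχm.comp
      (hN.comp ((continuous_apply t).comp Z.continuous)).measurable).aestronglyMeasurable
      (ae_of_all _ fun x => ?_)
    rw [norm_eq_abs, abs_of_nonneg (Finset.prod_nonneg fun _ _ => hχ0 _)]
    exact Finset.prod_le_one (fun _ _ => hχ0 _) fun _ _ => hχ1 _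
  have h1 : μ.real {x | ∃ t, softNorm (vecProc m w x t).1 + (vecProc m w x t).2 ≤ l}ᶜ ≤
      ∫ x, ∏ t, χ (softNorm (vecProc m w x t).1 + (vecProc m w x t).2 - l) ∂μ := by
    rw [← integral_indicator_one (hmeas _).2.compl]
    refine integral_mono ((integrable_const 1).indicator (hmeas _).2.compl) (hint _) fun x => ?_
    by_cases hx : x ∈ {x | ∃ t, softNorm (vecProc m w x t).1 + (vecProc m w x t).2 ≤ l}ᶜ
    · rw [indicator_of_mem hx]
      refine le_of_eq (Finset.prod_eq_one fun t _ => ?_).symm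
      simp only [mem_compl_iff, mem_ofPred_eq, not_exists, not_le] at hx
      exact if_pos (sub_pos.2 (hx t))
    · rw [indicator_of_notMem hx]
      exact Finset.prod_nonneg fun _ _ => hχ0 _
  have h2 : ∫ x, ∏ t, χ (softNorm (matProc m w x t).1 + (matProc m w x t).2 - l) ∂μ ≤
      μ.real {x | ∃ t, softNorm (matProc m w x t).1 + (matProc m w x t).2 < l}ᶜ := by
    rw [← integral_indicator_one (hmeas _).1.compl]
    refine integral_mono (hint _) ((integrable_const 1).indicator (hmeas _).1.compl) fun x => ?_
    by_cases hx : x ∈ {x | ∃ t, softNorm (matProc m w x t).1 + (matProc m w x t).2 < l}ᶜ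
    · rw [indicator_of_mem hx]
      exact Finset.prod_le_one (fun _ _ => hχ0 _) fun _ _ => hχ1 _
    · rw [indicator_of_notMem hx]
      rw [notMem_compl_iff] at hx
      obtain ⟨t, ht⟩ := hx
      refine le_of_eq (Finset.prod_eq_zero (Finset.mem_univ t) ?_)
      have : softNorm (matProc m w x t).1 + (matProc m w x t).2 - l < 0 := by linarith
      simp only [hχ]
      rw [if_neg (not_lt.2 this.le), if_neg this.ne]
  have h3 := h1.trans (hle.trans h2)
  rw [probReal_compl_eq_one_sub (hmeas _).2, probReal_compl_eq_one_sub (hmeas _).1] at h3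
  have h4 : μ.real {x | ∃ t, softNorm (matProc m w x t).1 + (matProc m w x t).2 < l} ≤
      μ.real {x | ∃ t, softNorm (vecProc m w x t).1 + (vecProc m w x t).2 ≤ l} := by linarith
  exact (ENNReal.toReal_le_toReal (measure_ne_top _ _) (measure_ne_top _ _)).1 h4

end Gordon

/-- By symmetry. It removes the auxiliary scalar from Gordon's comparison at the price of a factor
`2`. -/
lemma half_le_gaussianReal_Iio_one : 1 / 2 ≤ gaussianReal 0 1 (Iio 1) := by
  have h1 : gaussianReal 0 1 (Ici 0) = gaussianReal 0 1 (Iic 0) := by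
    conv_lhs => rw [← stdNormal_map_neg]
    rw [Measure.map_apply measurable_neg measurableSet_Ici]
    simp
  have h2 : (1 : ℝ≥0∞) ≤ gaussianReal 0 1 (Iic 0) + gaussianReal 0 1 (Ici 0) := by
    rw [← measure_univ (μ := gaussianReal 0 1), ← Iic_union_Ici (a := (0 : ℝ))]
    exact measure_union_le _ _
  have h3 : gaussianReal 0 1 (Iic 0) ≤ gaussianReal 0 1 (Iio 1) :=
    measure_mono (Iic_subset_Iio.2 one_pos)
  rw [h1, ← two_mul] at h2
  rw [one_div]
  refine ENNReal.inv_le_iff_le_mul (by simp) (by simp) |>.2 ?_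
  exact h2.trans (by gcongr)

/-! ### From finite nets to arbitrary sets of unit vectors. -/

section Gordon

variable {m n : ℕ}

/-- A deliberately crude net scale: the comparison does not see the cardinality of the index set, so
the net may be as fine as one likes. -/
lemma norm_toLp_mulVec_lt_one {A : Fin m → Fin n → ℝ} {R : ℝ} (hR : 0 ≤ R)
    (hA : ∀ i j, |A i j| ≤ R) {w : Fin n → ℝ}
    (hw : ∀ j, |w j| ≤ 1 / ((m + 1) * (n + 1) * (R + 1))) :
    ‖WithLp.toLp 2 (Matrix.of A *ᵥ w)‖ < 1 := by
  have h1 : ∀ i, |(Matrix.of A *ᵥ w) i| ≤ 1 / (m + 1) := by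
    intro i
    have e : (Matrix.of A *ᵥ w) i = ∑ j, A i j * w j := rfl
    calc |(Matrix.of A *ᵥ w) i| ≤ ∑ j, |A i j * w j| := by
          rw [e]; exact Finset.abs_sum_le_sum_abs _ _
      _ ≤ ∑ _j : Fin n, R * (1 / ((m + 1) * (n + 1) * (R + 1))) :=
          Finset.sum_le_sum fun j _ => by
            rw [abs_mul]; exact mul_le_mul (hA i j) (hw j) (abs_nonneg _) hR
      _ = (n / (n + 1)) * (R / (R + 1)) * (1 / (m + 1)) := by
          rw [Finset.sum_const, Finset.card_univ, Fintype.card_fin, nsmul_eq_mul]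
          field_simp
      _ ≤ 1 * 1 * (1 / (m + 1)) := by
          gcongr
          · exact div_le_one_of_le₀ (by linarith) (by positivity)
          · exact div_le_one_of_le₀ (by linarith) (by positivity)
      _ = _ := by ring
  have h2 : ‖WithLp.toLp 2 (Matrix.of A *ᵥ w)‖ ^ 2 < 1 := by
    rw [EuclideanSpace.norm_sq_eq]
    calc ∑ i, ‖(Matrix.of A *ᵥ w) i‖ ^ 2 ≤ ∑ _i : Fin m, (1 / ((m : ℝ) + 1)) ^ 2 :=
          Finset.sum_le_sum fun i _ => by
            rw [norm_eq_abs]; exact pow_le_pow_left₀ (abs_nonneg _) (h1 i) 2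
      _ = m / ((m : ℝ) + 1) ^ 2 := by
          rw [Finset.sum_const, Finset.card_univ, Fintype.card_fin, nsmul_eq_mul]
          field_simp
      _ < 1 := by
          rw [div_lt_one (by positivity)]
          have : (0 : ℝ) ≤ m := m.cast_nonneg
          nlinarith
  nlinarith [norm_nonneg (WithLp.toLp 2 (Matrix.of A *ᵥ w))]

/-- Gordon's escape inequality: the kernel of a Gaussian matrix misses a set `T` of unit vectors
unless a much simpler Gaussian process on `T` is small. -/
lemma measure_exists_mulVec_eq_zero_le (T : Set (Fin n → ℝ)) (hT : ∀ w ∈ T, ∑ j, w j ^ 2 = 1) :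
    gaussianMatrix m n {A | ∃ w ∈ T, Matrix.of A *ᵥ w = 0} ≤
      2 * ((gaussianVector m).prod (gaussianVector n))
        {p | ∃ w ∈ T, ‖WithLp.toLp 2 p.1‖ + p.2 ⬝ᵥ w ≤ 3} := by
  set U : Set ((Fin m → ℝ) × (Fin n → ℝ)) := {p | ∃ w ∈ T, ‖WithLp.toLp 2 p.1‖ + p.2 ⬝ᵥ w ≤ 3}
  -- Bounding the entries by `R` lets one net serve all matrices in `S R`; the sets increase to the
  -- whole event, and the bound is free of `R`.
  set S : ℕ → Set (Fin m → Fin n → ℝ) := fun R =>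
    {A | (∀ i j, |A i j| ≤ R) ∧ ∃ w ∈ T, Matrix.of A *ᵥ w = 0} with hS
  have hU : {A : Fin m → Fin n → ℝ | ∃ w ∈ T, Matrix.of A *ᵥ w = 0} = ⋃ R, S R := by
    ext A
    simp only [hS, mem_iUnion, mem_ofPred_eq, exists_and_right]
    refine ⟨fun h => ⟨?_, h⟩, fun h => h.2⟩
    obtain ⟨R, hR⟩ := exists_nat_ge (∑ i, ∑ j, |A i j|)
    refine ⟨R, fun i j => le_trans ?_ hR⟩
    refine le_trans ?_ (Finset.single_le_sum (f := fun i => ∑ j, |A i j|)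
      (fun i _ => Finset.sum_nonneg fun j _ => abs_nonneg _) (Finset.mem_univ i))
    exact Finset.single_le_sum (f := fun j => |A i j|) (fun j _ => abs_nonneg _)
      (Finset.mem_univ j)
  have hmono : Monotone S := fun R R' h A hA =>
    ⟨fun i j => (hA.1 i j).trans (by exact_mod_cast h), hA.2⟩
  rw [hU, hmono.measure_iUnion]
  refine iSup_le fun R => ?_
  have hbd : TotallyBounded T := by
    refine (isCompact_closedBall (0 : Fin n → ℝ) 1).totallyBounded.subset fun w hw => ?_
    rw [mem_closedBall_zero_iff, pi_norm_le_iff_of_nonneg zero_le_one]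
    intro j
    have h1 : w j ^ 2 ≤ 1 := by
      rw [← hT w hw]
      exact Finset.single_le_sum (f := fun j => w j ^ 2) (fun j _ => sq_nonneg _)
        (Finset.mem_univ j)
    rw [norm_eq_abs]
    exact (sq_le_one_iff_abs_le_one _).1 h1
  set ε : ℝ := 1 / ((m + 1) * (n + 1) * (R + 1)) with hε
  have hε0 : 0 < ε := by positivity
  obtain ⟨τ, hτT, hτf, hτ⟩ := hbd.exists_subset (Metric.dist_mem_uniformity hε0)
  have : Fintype τ := hτf.fintype
  have h1 := measure_exists_lt_le (m := m) 3 (fun t : τ => (t : Fin n → ℝ))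
    fun t => hT t (hτT t.2)
  -- The threshold `3` is spent as one unit each on `softNorm` versus the norm, the error of the
  -- net, and the event `g < 1`.
  have h2 : S R ×ˢ (Iio (1 : ℝ) ×ˢ (univ : Set ((Fin m → ℝ) × (Fin n → ℝ)))) ⊆
      {x : GordonSpace m n | ∃ t, softNorm (matProc m (fun t : τ => (t : Fin n → ℝ)) x t).1 +
        (matProc m (fun t : τ => (t : Fin n → ℝ)) x t).2 < 3} := by
    rintro ⟨A, g, p⟩ ⟨⟨hA, w, hwT, hw⟩, hg, _⟩
    obtain ⟨t, ht, hwt⟩ := mem_iUnion₂.1 (hτ hwT)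
    refine ⟨⟨t, ht⟩, ?_⟩
    rw [matProc_apply]
    have hg' : g < 1 := hg
    have h3 := softNorm_le (WithLp.toLp 2 (Matrix.of A *ᵥ t))
    have h4 : ‖WithLp.toLp 2 (Matrix.of A *ᵥ t)‖ < 1 := by
      have e : Matrix.of A *ᵥ t = Matrix.of A *ᵥ (t - w) := by
        rw [Matrix.mulVec_sub]
        rw [show Matrix.of A *ᵥ w = 0 from hw, sub_zero]
      rw [e]
      refine norm_toLp_mulVec_lt_one R.cast_nonneg hA fun j => ?_
      have hd : dist w t < ε := hwt
      rw [dist_comm, dist_eq_norm] at hd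
      exact (norm_le_pi_norm (t - w) j).trans hd.le
    show softNorm _ + g < 3
    linarith
  have h5 : {x : GordonSpace m n | ∃ t, softNorm (vecProc m (fun t : τ => (t : Fin n → ℝ)) x t).1 +
        (vecProc m (fun t : τ => (t : Fin n → ℝ)) x t).2 ≤ 3} ⊆ univ ×ˢ (univ ×ˢ U) := by
    rintro ⟨A, g, p⟩ ⟨t, ht⟩
    refine ⟨mem_univ _, mem_univ _, t, hτT t.2, ?_⟩
    rw [vecProc_apply] at ht
    exact (add_le_add_left (le_softNorm _) _).trans ht
  have h6 := (measure_mono h2).trans (h1.trans (measure_mono h5))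
  unfold gordonMeasure at h6
  simp only [Measure.prod_prod, measure_univ, one_mul, mul_one] at h6
  have h7 : gaussianMatrix m n (S R) * (1 / 2) ≤
      ((gaussianVector m).prod (gaussianVector n)) U :=
    le_trans (by gcongr; exact half_le_gaussianReal_Iio_one) h6
  calc gaussianMatrix m n (S R) = 2 * (gaussianMatrix m n (S R) * (1 / 2)) := by
        rw [mul_comm (gaussianMatrix m n (S R)), ← mul_assoc, one_div,
          ENNReal.mul_inv_cancel (by simp) (by simp), one_mul]
    _ ≤ _ := by gcongr

end Gordon

/-! ### Exponential moments -/

lemma integrable_exp_sq_gaussianReal {c : ℝ} (hc : c < 1 / 2) :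
    Integrable (fun h => exp (c * h ^ 2)) (gaussianReal 0 1) := by
  rw [gaussianReal_of_var_ne_zero 0 one_ne_zero,
    integrable_withDensity_iff_integrable_smul' (measurable_gaussianPDF 0 1)
      (ae_of_all _ fun x => gaussianPDF_lt_top)]
  refine ((integrable_exp_neg_mul_sq (b := 1 / 2 - c) (by linarith)).const_mul
    (√(2 * π))⁻¹).congr (ae_of_all _ fun h => ?_)
  simp only [toReal_gaussianPDF, smul_eq_mul, ← gpdf_eq, gpdf]
  rw [mul_assoc, ← exp_add]
  congr 2
  ring

/-- A variable of at most quadratic growth has exponential moments near `0`. -/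
lemma zero_mem_interior_integrableExpSet {X : ℝ → ℝ} (hX : Measurable X) {a b : ℝ}
    (hb : 0 ≤ b) (h : ∀ z, |X z| ≤ a + b * z ^ 2) :
    0 ∈ interior (integrableExpSet X (gaussianReal 0 1)) := by
  rw [mem_interior_iff_mem_nhds]
  refine mem_of_superset (Ioo_mem_nhds (a := -(1 / (2 * b + 2))) (b := 1 / (2 * b + 2))
    (neg_lt_zero.2 (by positivity)) (by positivity)) fun t ht => ?_
  have ht' : |t| < 1 / (2 * b + 2) := abs_lt.2 ht
  have ht2 : |t| * b < 1 / 2 := by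
    rw [lt_div_iff₀ (by positivity)] at ht'
    nlinarith [abs_nonneg t]
  refine ((integrable_exp_sq_gaussianReal ht2).const_mul (exp (|t| * a))).mono'
    (by fun_prop) (ae_of_all _ fun z => ?_)
  rw [norm_eq_abs, abs_exp, ← exp_add]
  refine exp_le_exp.2 ?_
  calc t * X z ≤ |t| * |X z| := by rw [← abs_mul]; exact le_abs_self _
    _ ≤ |t| * (a + b * z ^ 2) := by gcongr; exact h z
    _ = _ := by ring

/-- To first order the moment generating function is `1 + t E X`, which for small `t > 0` lies below
`1 + t a ≤ exp (t a)`. -/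
lemma eventually_mgf_le {X : ℝ → ℝ} (hX : 0 ∈ interior (integrableExpSet X (gaussianReal 0 1)))
    {a : ℝ} (ha : ∫ z, X z ∂(gaussianReal 0 1) < a) :
    ∀ᶠ t in 𝓝[>] 0, Integrable (fun z => exp (t * X z)) (gaussianReal 0 1) ∧
      mgf X (gaussianReal 0 1) t ≤ exp (t * a) := by
  have h1 : ∀ᶠ t in 𝓝[>] (0 : ℝ), t ∈ integrableExpSet X (gaussianReal 0 1) :=
    nhdsWithin_le_nhds (mem_interior_iff_mem_nhds.1 hX)
  have hd := hasDerivAt_mgf hX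
  simp only [zero_mul, exp_zero, mul_one] at hd
  have h2 := (hasDerivAt_iff_tendsto_slope.1 hd).mono_left
    (nhdsWithin_mono 0 fun t (ht : 0 < t) => ht.ne')
  filter_upwards [h1, h2.eventually_lt_const ha, self_mem_nhdsWithin] with t ht1 ht2 ht3
  have ht3' : 0 < t := ht3
  refine ⟨ht1, ?_⟩
  rw [slope_def_field, sub_zero, div_lt_iff₀ ht3', mgf_zero] at ht2
  linarith [add_one_le_exp (t * a)]

/-- Chernoff's bound. -/
lemma gaussianVector_sum_ge_le {n : ℕ} {f : Fin n → ℝ → ℝ} {t : ℝ} (ht : 0 ≤ t) {a : Fin n → ℝ}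
    (hf : ∀ i, Integrable (fun z => exp (t * f i z)) (gaussianReal 0 1) ∧
      mgf (f i) (gaussianReal 0 1) t ≤ exp (t * a i)) (b : ℝ) :
    gaussianVector n {h | ∑ i, a i + b ≤ ∑ i, f i (h i)} ≤ ENNReal.ofReal (exp (-(t * b))) := by
  have h1 := mul_meas_ge_le_integral_of_nonneg (μ := gaussianVector n)
    (f := fun h => ∏ i, exp (t * f i (h i)))
    (ae_of_all _ fun h => Finset.prod_nonneg fun i _ => (exp_pos _).le)
    (Integrable.fintype_prod (f := fun i z => exp (t * f i z)) fun i => (hf i).1)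
    (exp (t * (∑ i, a i + b)))
  rw [gaussianVector, integral_fintype_prod_eq_prod (f := fun i z => exp (t * f i z))] at h1
  have h2 : ∏ i, ∫ z, exp (t * f i z) ∂(gaussianReal 0 1) ≤ exp (t * ∑ i, a i) := by
    rw [Finset.mul_sum, exp_sum]
    exact Finset.prod_le_prod (fun i _ => integral_nonneg fun z => (exp_pos _).le)
      fun i _ => (hf i).2
  have h3 := h1.trans h2
  rw [mul_add, exp_add, mul_assoc] at h3
  have h4 := le_of_mul_le_mul_left (h3.trans_eq (mul_one _).symm) (exp_pos _)
  rw [← le_div_iff₀' (exp_pos _), one_div, ← exp_neg] at h4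
  refine le_trans (measure_mono fun h hh => ?_)
    ((ENNReal.le_ofReal_iff_toReal_le (measure_ne_top _ _) (exp_pos _).le).2 h4)
  show exp _ * exp _ ≤ ∏ i, exp (t * f i (h i))
  rw [← exp_add, ← exp_sum, ← Finset.mul_sum, ← mul_add]
  exact exp_le_exp.2 (mul_le_mul_of_nonneg_left hh ht)

/-- The lower tail of the `χ²` distribution. -/
lemma exists_gaussianVector_sum_sq_le {η : ℝ} (hη : 0 < η) :
    ∃ c : ℝ, 0 < c ∧ ∀ m : ℕ, gaussianVector m {g | ∑ i, g i ^ 2 ≤ (1 - η) * m} ≤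
      ENNReal.ofReal (exp (-(c * m))) := by
  -- The lower tail is an upper tail of `-z²`, to which Chernoff's bound applies with half of the
  -- slack `η`.
  have hX := zero_mem_interior_integrableExpSet (X := fun z => -z ^ 2) (by fun_prop) (a := 0)
    zero_le_one (fun z => by rw [abs_neg, abs_of_nonneg (sq_nonneg z)]; linarith)
  have hi : ∫ z, z ^ 2 ∂(gaussianReal 0 1) = 1 := by
    have := variance_fun_id_gaussianReal (μ := 0) (v := 1)
    rw [variance_eq_integral (by fun_prop)] at this
    simpa using this
  have hm : ∫ z, -z ^ 2 ∂(gaussianReal 0 1) < -1 + η / 2 := by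
    rw [integral_neg, hi]; linarith
  obtain ⟨t, ht, ht0⟩ := ((eventually_mgf_le hX hm).and self_mem_nhdsWithin).exists
  have ht0' : 0 < t := ht0
  refine ⟨t * (η / 2), by positivity, fun m => ?_⟩
  have h1 := gaussianVector_sum_ge_le (n := m) (f := fun _ z => -z ^ 2) ht0'.le
    (a := fun _ => -1 + η / 2) (fun _ => ht) (m * (η / 2))
  refine (measure_mono fun g hg => ?_).trans (h1.trans_eq (by ring_nf))
  simp only [Finset.sum_const, Finset.card_univ, Fintype.card_fin, nsmul_eq_mul,
    Finset.sum_neg_distrib, mem_ofPred_eq] at hg ⊢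
  linarith

/-! ### Finitely many envelopes -/

/-- The supremum of `supGain` over a set of base points. -/
def envelope (q : ℝ) (γ ν : ℝ≥0) (s : Set ℝ) (h : ℝ) : ℝ≥0∞ := ⨆ y ∈ s, supGain q γ ν y h

lemma measurable_envelope (q : ℝ) (γ ν : ℝ≥0) (s : Set ℝ) : Measurable (envelope q γ ν s) :=
  (lowerSemicontinuous_biSup fun y _ => lowerSemicontinuous_supGain q γ ν y).measurable

lemma envelope_le {q : ℝ} (hq0 : 0 ≤ q) (hq1 : q ≤ 1) {γ : ℝ≥0} (hγ : 0 < γ) (ν : ℝ≥0)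
    (s : Set ℝ) (h : ℝ) :
    envelope q γ ν s h ≤ ENNReal.ofReal (gainBound γ ν h) :=
  iSup₂_le fun y _ => supGain_le hq0 hq1 hγ ν y h

/-- Along a decreasing countable basis of the filter the envelopes decrease to the limit superior,
which is `Z`; monotone convergence applies thanks to the integrable bound. -/
lemma exists_mem_lintegral_envelope_lt {q : ℝ} (hq0 : 0 ≤ q) (hq1 : q ≤ 1) {γ : ℝ≥0} (hγ : 0 < γ)
    (ν : ℝ≥0) {l : Filter ℝ} [l.NeBot] [l.IsCountablyGenerated]
    {Z : ℝ → ℝ≥0∞} (hZ : ∀ h, Tendsto (fun y => supGain q γ ν y h) l (𝓝 (Z h))) {M : ℝ≥0∞}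
    (hM : ∫⁻ h, Z h ∂(gaussianReal 0 1) < M) :
    ∃ s ∈ l, ∫⁻ h, envelope q γ ν s h ∂(gaussianReal 0 1) < M := by
  obtain ⟨s, hs⟩ := l.exists_antitone_basis
  have h1 : ∀ h, ⨅ N, envelope q γ ν (s N) h = Z h := fun h => by
    rw [← (hZ h).limsup_eq, hs.toHasBasis.limsup_eq_iInf_iSup]
    simp [envelope]
  have h2 := lintegral_iInf (μ := gaussianReal 0 1) (f := fun N => envelope q γ ν (s N))
    (fun N => measurable_envelope q γ ν _)
    (fun N N' hN h => biSup_mono fun y hy => hs.antitone hN hy)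
    ((lintegral_mono fun h => envelope_le hq0 hq1 hγ ν (s 0) h).trans_lt
      (lintegral_gainBound_lt_top γ ν)).ne
  simp_rw [h1] at h2
  rw [h2] at hM
  obtain ⟨N, hN⟩ := iInf_lt_iff.1 hM
  exact ⟨s N, hs.mem N, hN⟩

/-- The half-line `(0, ∞)` is cut into finitely many consecutive cells, on each of which the
envelope has almost the same mean as the worst point. -/
lemma exists_cells {q : ℝ} (hq0 : 0 ≤ q) (hq1 : q ≤ 1) {γ : ℝ≥0} (hγ : 0 < γ) (ν : ℝ≥0)
    {M M' : ℝ≥0∞} (hM : ∀ x, 0 < x → I₁ q γ ν x ≤ M) (hMM' : M < M') :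
    ∃ (J : ℕ) (b : ℝ → ℕ) (S : ℕ → Set ℝ), Monotone b ∧ (∀ y, b y ≤ J) ∧
      (∀ y, 0 < y → y ∈ S (b y)) ∧
      ∀ j, ∫⁻ h, envelope q γ ν (S j) h ∂(gaussianReal 0 1) < M' := by
  -- The limits at `0` and at infinity compactify the half-line: a cell at each end and a finite
  -- subdivision of the interval between suffice.
  obtain ⟨Z₀, -, hZ₀⟩ := exists_tendsto_supGain_zero hq0 hq1 hγ ν
  obtain ⟨Z₁, hZ₁⟩ := exists_tendsto_supGain_atTop hq0 hq1 hγ ν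
  obtain ⟨s₀, hs₀, hs₀'⟩ := exists_mem_lintegral_envelope_lt hq0 hq1 hγ ν hZ₀
    ((le_of_tendsto (tendsto_I₁ hq0 hq1 hγ ν hZ₀)
      (eventually_nhdsWithin_of_forall fun x hx => hM x hx)).trans_lt hMM')
  obtain ⟨s₁, hs₁, hs₁'⟩ := exists_mem_lintegral_envelope_lt hq0 hq1 hγ ν hZ₁
    ((le_of_tendsto (tendsto_I₁ hq0 hq1 hγ ν hZ₁)
      ((eventually_gt_atTop 0).mono fun x hx => hM x hx)).trans_lt hMM')
  have hloc : ∀ x : ℝ, 0 < x → ∃ s, IsOpen s ∧ x ∈ s ∧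
      ∫⁻ h, envelope q γ ν s h ∂(gaussianReal 0 1) < M' := by
    intro x hx
    obtain ⟨s, hs, hs'⟩ := exists_mem_lintegral_envelope_lt hq0 hq1 hγ ν
      (tendsto_supGain_nhds hq0 hq1 hγ ν hx) ((hM x hx).trans_lt hMM')
    obtain ⟨u, hus, hu, hxu⟩ := mem_nhds_iff.1 hs
    exact ⟨u, hu, hxu, (lintegral_mono fun h => biSup_mono fun y hy => hus hy).trans_lt hs'⟩
  obtain ⟨a, ha, has⟩ := mem_nhdsGT_iff_exists_Ioo_subset.1 hs₀
  obtain ⟨B, hB⟩ := mem_atTop_sets.1 hs₁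
  have ha' : 0 < a := ha
  set B' := max a B
  have hloc' : ∀ x : Icc a B', ∃ s, IsOpen s ∧ (x : ℝ) ∈ s ∧
      ∫⁻ h, envelope q γ ν s h ∂(gaussianReal 0 1) < M' := fun x => hloc x (ha'.trans_le x.2.1)
  choose u huo hxu hu using hloc'
  obtain ⟨t, ht0, htm, ⟨m, hm⟩, ht⟩ := exists_monotone_Icc_subset_open_cover_Icc
    (le_max_left a B) (c := fun x => Subtype.val ⁻¹' u x)
    (fun x => (huo x).preimage continuous_subtype_val)
    (fun x _ => mem_iUnion.2 ⟨x, hxu x⟩)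
  choose idx hidx using ht
  have hex : ∀ y : ℝ, ∃ j, j = m + 1 ∨ y < t j := fun y => ⟨m + 1, Or.inl rfl⟩
  -- The index of `y` is the first `j` with `y < t j`, capped at `m + 1`. Index `0` is the end cell
  -- at `0`, index `m + 1` the end cell at infinity, and index `j + 1` with `j < m` the interval
  -- from `t j` to `t (j + 1)`.
  refine ⟨m + 1, fun y => Nat.find (hex y), fun j => Nat.casesOn j s₀ fun j =>
    if j = m then s₁ else u (idx j), fun y y' hy => ?_, fun y => Nat.find_min' _ (Or.inl rfl),
    fun y hy => ?_, fun j => ?_⟩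
  · exact Nat.find_mono fun j hj => hj.imp_right fun h => hy.trans_lt h
  · have hspec := Nat.find_spec (hex y)
    have hmin := fun k => Nat.find_min (hex y) (m := k)
    beta_reduce
    generalize Nat.find (hex y) = j at hspec hmin ⊢
    rcases j with _ | j
    · rcases hspec with h | h
      · omega
      · rw [ht0] at h
        exact has ⟨hy, h⟩
    · have h1 := hmin j (Nat.lt_succ_self j)
      rw [not_or, not_lt] at h1
      show y ∈ if j = m then s₁ else u (idx j)
      split_ifs with hj
      · rw [hj, hm m le_rfl] at h1
        exact hB y ((le_max_right a B).trans h1.2)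
      · rcases hspec with h | h
        · omega
        · have hyI : y ∈ Icc a B' := ⟨(t j).2.1.trans h1.2, h.le.trans (t (j + 1)).2.2⟩
          exact hidx j (show (⟨y, hyI⟩ : Icc a B') ∈ Icc (t j) (t (j + 1)) from ⟨h1.2, h.le⟩)
  · rcases j with _ | j
    · exact hs₀'
    · show ∫⁻ h, envelope q γ ν (if j = m then s₁ else u (idx j)) h ∂(gaussianReal 0 1) < M'
      split_ifs
      · exact hs₁'
      · exact hu _

/-- A family of index vectors that is monotone in a real parameter takes few values. -/
lemma exists_finset_range_monotone {n J : ℕ} (B : ℝ → Fin n → ℕ) (hB : MonotoneOn B (Ioi 0))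
    (hJ : ∀ s i, B s i ≤ J) :
    ∃ F : Finset (Fin n → ℕ), F.card ≤ n * J + 1 ∧ (∀ v ∈ F, ∀ i, v i ≤ J) ∧
      ∀ s, 0 < s → B s ∈ F := by
  have hmaps : MapsTo (fun v : Fin n → ℕ => ∑ i, v i) (B '' Ioi 0)
      (Finset.range (n * J + 1) : Set ℕ) := by
    rintro _ ⟨s, -, rfl⟩
    rw [Finset.coe_range, mem_Iio, Nat.lt_succ_iff]
    calc ∑ i, B s i ≤ ∑ _i : Fin n, J := Finset.sum_le_sum fun i _ => hJ s i
      _ = n * J := by simp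
  -- The values form a chain in the coordinatewise order, and on a chain the coordinate sum, one of
  -- `n * J + 1` numbers, determines the vector.
  have hinj : InjOn (fun v : Fin n → ℕ => ∑ i, v i) (B '' Ioi 0) := by
    have key : ∀ s s', 0 < s → s ≤ s' → ∑ i, B s i = ∑ i, B s' i → B s = B s' := by
      intro s s' hs h he
      have hle := hB hs (hs.trans_le h) h
      funext i
      exact (Finset.sum_eq_sum_iff_of_le fun i _ => hle i).1 he i (Finset.mem_univ i)
    rintro _ ⟨s, hs, rfl⟩ _ ⟨s', hs', rfl⟩ he
    rcases le_total s s' with h | h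
    · exact key s s' hs h he
    · exact (key s' s hs' h he.symm).symm
  have hfin : (B '' Ioi 0).Finite :=
    Finite.of_injOn hmaps hinj (Finset.finite_toSet _)
  refine ⟨hfin.toFinset, ?_, fun v hv i => ?_, fun s hs => hfin.mem_toFinset.2 ⟨s, hs, rfl⟩⟩
  swap
  · obtain ⟨s, -, rfl⟩ := hfin.mem_toFinset.1 hv
    exact hJ s i
  rw [← Finset.card_range (n * J + 1)]
  exact Finset.card_le_card_of_injOn _ (by simpa using hmaps) (by simpa using hinj)

/-! ### A uniform law of large numbers -/

lemma gainBound_le (γ ν : ℝ≥0) (h : ℝ) :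
    gainBound γ ν h ≤ (ν + ν ^ 2 / (2 * γ)) + 1 / (2 * γ) * h ^ 2 := by
  have h1 : (|h| + ν) ^ 2 ≤ 2 * h ^ 2 + 2 * (ν : ℝ) ^ 2 := by
    rw [← sq_abs h]; nlinarith [sq_nonneg (|h| - ν)]
  calc gainBound γ ν h ≤ ν + (2 * h ^ 2 + 2 * (ν : ℝ) ^ 2) / (4 * γ) := by
        unfold gainBound; gcongr
    _ = _ := by
      rw [show (4 : ℝ) * γ = 2 * (2 * γ) by ring, ← mul_add, mul_div_mul_left _ _ two_ne_zero]
      ring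

lemma I₁_lt_top {q : ℝ} (hq0 : 0 ≤ q) (hq1 : q ≤ 1) {γ : ℝ≥0} (hγ : 0 < γ) (ν : ℝ≥0) (x : ℝ) :
    I₁ q γ ν x < ∞ :=
  (lintegral_mono fun h => supGain_le hq0 hq1 hγ ν x h).trans_lt (lintegral_gainBound_lt_top γ ν)

/-- Let `x` tend to `0` from the right. This covers coordinates of the allowed support that happen
to vanish. -/
lemma I₂_le_of_forall {q : ℝ} (hq0 : 0 ≤ q) (hq1 : q ≤ 1) {γ : ℝ≥0} (hγ : 0 < γ) (ν : ℝ≥0)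
    {M : ℝ≥0∞} (hM : ∀ x, 0 < x → I₁ q γ ν x ≤ M) : I₂ q γ ν ≤ M := by
  obtain ⟨Z, hZ, hlim⟩ := exists_tendsto_supGain_zero hq0 hq1 hγ ν
  rw [I₂_eq]
  exact (lintegral_mono hZ).trans (le_of_tendsto (tendsto_I₁ hq0 hq1 hγ ν hlim)
    (eventually_nhdsWithin_of_forall fun x hx => hM x hx))

lemma eventually_mgf_toReal_le {γ ν : ℝ≥0} {X : ℝ → ℝ≥0∞} (hX : Measurable X)
    (hXb : ∀ h, X h ≤ ENNReal.ofReal (gainBound γ ν h)) {a : ℝ}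
    (ha : ∫⁻ h, X h ∂(gaussianReal 0 1) < ENNReal.ofReal a) :
    ∀ᶠ t in 𝓝[>] 0, Integrable (fun z => exp (t * (X z).toReal)) (gaussianReal 0 1) ∧
      mgf (fun z => (X z).toReal) (gaussianReal 0 1) t ≤ exp (t * a) := by
  refine eventually_mgf_le (zero_mem_interior_integrableExpSet hX.ennreal_toReal
    (a := ν + ν ^ 2 / (2 * γ)) (b := 1 / (2 * γ)) (by positivity) fun z => ?_) ?_
  · rw [abs_of_nonneg ENNReal.toReal_nonneg]
    exact (ENNReal.toReal_le_of_le_ofReal (gainBound_nonneg γ ν z) (hXb z)).trans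
      (gainBound_le γ ν z)
  · rw [integral_toReal hX.aemeasurable
      (ae_of_all _ fun z => (hXb z).trans_lt ENNReal.ofReal_lt_top)]
    exact (ENNReal.lt_ofReal_iff_toReal_lt ha.ne_top).1 ha

lemma mgf_comp_neg {X : ℝ → ℝ} {t a : ℝ}
    (h : Integrable (fun z => exp (t * X z)) (gaussianReal 0 1) ∧
      mgf X (gaussianReal 0 1) t ≤ a) :
    Integrable (fun z => exp (t * X (-z))) (gaussianReal 0 1) ∧
      mgf (fun z => X (-z)) (gaussianReal 0 1) t ≤ a := by
  have hmp : MeasurePreserving (fun z : ℝ => -z) (gaussianReal 0 1) (gaussianReal 0 1) :=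
    ⟨measurable_neg, stdNormal_map_neg⟩
  have hme : MeasurableEmbedding fun z : ℝ => -z := (MeasurableEquiv.neg ℝ).measurableEmbedding
  refine ⟨(hmp.integrable_comp_emb hme).2 h.1, ?_⟩
  have := hmp.integral_comp hme fun z => exp (t * X z)
  exact this.trans_le h.2

lemma sum_ite_add_lt {n k : ℕ} (hk : k ≤ n) (a b : ℝ) :
    ∑ i : Fin n, (if (i : ℕ) + k < n then a else b) = k * b + (n - k) * a := by
  rw [Fin.sum_univ_eq_sum_range fun i => if i + k < n then a else b]
  obtain ⟨d, rfl⟩ := Nat.exists_eq_add_of_le' hk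
  rw [Finset.sum_range_add, Finset.sum_congr rfl fun i hi =>
    if_pos (show i + k < d + k by have := Finset.mem_range.1 hi; omega),
    Finset.sum_congr rfl fun i _ => if_neg (show ¬ d + i + k < d + k by omega)]
  simp
  ring

/-- With overwhelming probability the empirical mean of the gains is at most its expectation,
for all scalings of `x` at once. -/
lemma exists_gaussianVector_supGain_ge_le {q : ℝ} (hq0 : 0 ≤ q) (hq1 : q ≤ 1) {γ : ℝ≥0}
    (hγ : 0 < γ) (ν : ℝ≥0) {M : ℝ} (hM0 : 0 ≤ M)
    (hM : ∀ x, 0 < x → I₁ q γ ν x ≤ ENNReal.ofReal M) {δ : ℝ} (hδ : 0 < δ) :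
    ∃ (J : ℕ) (c : ℝ), 0 < c ∧ ∀ (n k : ℕ), k ≤ n → ∀ x : Fin n → ℝ,
      (∀ i : Fin n, (i : ℕ) + k < n → x i = 0) →
      gaussianVector n {h | ∃ s, 0 < s ∧ k * M + (n - k) * (I₂ q γ ν).toReal + δ * n ≤
        ∑ i, (supGain q γ ν (s * x i) (h i)).toReal} ≤
        ENNReal.ofReal ((n * J + 1) * exp (-(c * n))) := by
  set m₂ := (I₂ q γ ν).toReal with hm₂
  have hI₂ : I₂ q γ ν = ENNReal.ofReal m₂ := by
    rw [hm₂, ENNReal.ofReal_toReal]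
    rw [I₂_eq]; exact (I₁_lt_top hq0 hq1 hγ ν 0).ne
  have hm₂M : m₂ ≤ M :=
    ENNReal.toReal_le_of_le_ofReal hM0 (I₂_le_of_forall hq0 hq1 hγ ν hM)
  have hm₂0 : 0 ≤ m₂ := ENNReal.toReal_nonneg
  obtain ⟨J, b, S, hbm, hbJ, hbS, hS⟩ := exists_cells hq0 hq1 hγ ν hM
    (M' := ENNReal.ofReal (M + δ / 2)) ((ENNReal.ofReal_lt_ofReal_iff (by linarith)).2 (by linarith))
  -- There are finitely many cells, so one Chernoff parameter `t` serves all of them and does not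
  -- depend on `n`.
  have hev : ∀ᶠ t in 𝓝[>] (0 : ℝ), ∀ j ∈ Finset.range (J + 1),
      Integrable (fun z => exp (t * (envelope q γ ν (S j) z).toReal)) (gaussianReal 0 1) ∧
      mgf (fun z => (envelope q γ ν (S j) z).toReal) (gaussianReal 0 1) t ≤
        exp (t * (M + δ / 2)) := by
    rw [eventually_all_finset]
    exact fun j _ => eventually_mgf_toReal_le (measurable_envelope q γ ν _)
      (envelope_le hq0 hq1 hγ ν _) (hS j)
  have hev0 : ∀ᶠ t in 𝓝[>] (0 : ℝ),
      Integrable (fun z => exp (t * (supGain q γ ν 0 z).toReal)) (gaussianReal 0 1) ∧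
      mgf (fun z => (supGain q γ ν 0 z).toReal) (gaussianReal 0 1) t ≤ exp (t * (m₂ + δ / 2)) := by
    refine eventually_mgf_toReal_le (measurable_supGain q γ ν 0) (supGain_le hq0 hq1 hγ ν 0) ?_
    rw [← I₁_eq, ← I₂_eq, hI₂]
    exact (ENNReal.ofReal_lt_ofReal_iff (by linarith)).2 (by linarith)
  obtain ⟨t, ⟨ht, ht0⟩, htpos⟩ := ((hev.and hev0).and self_mem_nhdsWithin).exists
  have htpos' : 0 < t := htpos
  refine ⟨J, t * (δ / 2), by positivity, fun n k hk x hx => ?_⟩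
  obtain ⟨F, hFc, hFJ, hF⟩ := exists_finset_range_monotone (n := n) (J := J)
    (fun s i => b (s * |x i|)) (fun s _ s' _ h i => hbm (by gcongr)) (fun s i => hbJ _)
  -- Cells cover positive base points only; a negative coordinate is reflected together with its
  -- Gaussian variable.
  set f : (Fin n → ℕ) → Fin n → ℝ → ℝ := fun v i z =>
    if x i = 0 then (supGain q γ ν 0 z).toReal
    else if 0 < x i then (envelope q γ ν (S (v i)) z).toReal
    else (envelope q γ ν (S (v i)) (-z)).toReal with hf
  set a : Fin n → ℝ := fun i => (if (i : ℕ) + k < n then m₂ else M) + δ / 2 with ha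
  have hfa : ∀ v ∈ F, ∀ i, Integrable (fun z => exp (t * f v i z)) (gaussianReal 0 1) ∧
      mgf (f v i) (gaussianReal 0 1) t ≤ exp (t * a i) := by
    intro v hv i
    by_cases hxi : x i = 0
    · have e : f v i = fun z => (supGain q γ ν 0 z).toReal := by funext z; simp [hf, hxi]
      rw [e]
      refine ⟨ht0.1, ht0.2.trans (exp_le_exp.2 (mul_le_mul_of_nonneg_left ?_ htpos'.le))⟩
      simp only [ha]
      split_ifs <;> linarith
    · have hik : ¬ (i : ℕ) + k < n := fun h => hxi (hx i h)
      have hai : a i = M + δ / 2 := by simp only [ha, if_neg hik]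
      have hj := ht (v i) (Finset.mem_range.2 (Nat.lt_succ_of_le (hFJ v hv i)))
      rw [hai]
      by_cases hpos : 0 < x i
      · have e : f v i = fun z => (envelope q γ ν (S (v i)) z).toReal := by
          funext z; simp [hf, hxi, hpos]
        rw [e]; exact hj
      · have e : f v i = fun z => (envelope q γ ν (S (v i)) (-z)).toReal := by
          funext z; simp [hf, hxi, hpos]
        rw [e]; exact mgf_comp_neg hj
  have hsum : ∑ i, a i + n * (δ / 2) = k * M + (n - k) * m₂ + δ * n := by
    simp only [ha]
    rw [Finset.sum_add_distrib, sum_ite_add_lt hk]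
    simp
    ring
  have henv : ∀ (s : Set ℝ) (y z : ℝ), y ∈ s →
      (supGain q γ ν y z).toReal ≤ (envelope q γ ν s z).toReal := fun s y z hy =>
    ENNReal.toReal_mono ((envelope_le hq0 hq1 hγ ν s z).trans_lt ENNReal.ofReal_lt_top).ne
      (le_iSup₂ (f := fun y _ => supGain q γ ν y z) y hy)
  -- The scale `s` enters only through the cells of the `s * |x i|`, so the uncountable union over
  -- `s` becomes a finite one over `F`.
  have hsub : {h : Fin n → ℝ | ∃ s, 0 < s ∧ k * M + (n - k) * m₂ + δ * n ≤
        ∑ i, (supGain q γ ν (s * x i) (h i)).toReal} ⊆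
      ⋃ v ∈ F, {h | ∑ i, a i + n * (δ / 2) ≤ ∑ i, f v i (h i)} := by
    rintro h ⟨s, hs, hle⟩
    refine mem_iUnion₂.2 ⟨_, hF s hs, ?_⟩
    rw [mem_ofPred_eq, hsum]
    refine hle.trans (Finset.sum_le_sum fun i _ => ?_)
    rcases lt_trichotomy (x i) 0 with hxi | hxi | hxi
    · simp only [hf, if_neg hxi.ne, if_neg (not_lt.2 hxi.le)]
      rw [← supGain_neg_neg]
      refine henv _ _ _ ?_
      rw [← mul_neg, ← abs_of_neg hxi]
      exact hbS _ (mul_pos hs (abs_pos.2 hxi.ne))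
    · simp [hf, hxi]
    · simp only [hf, if_neg hxi.ne', if_pos hxi]
      refine henv _ _ _ ?_
      rw [abs_of_pos hxi]
      exact hbS _ (mul_pos hs hxi)
  refine (measure_mono hsub).trans ((measure_biUnion_finset_le _ _).trans ?_)
  refine (Finset.sum_le_sum fun v hv =>
    gaussianVector_sum_ge_le htpos'.le (hfa v hv) (n * (δ / 2))).trans ?_
  rw [Finset.sum_const, nsmul_eq_mul, ENNReal.ofReal_mul (by positivity)]
  have e : -(t * (n * (δ / 2))) = -(t * (δ / 2) * n) := by ring
  rw [e]
  gcongr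
  rw [← ENNReal.ofReal_natCast]
  exact ENNReal.ofReal_le_ofReal (by exact_mod_cast hFc)

/-! ### Failure of recovery and descent directions -/

variable {m n : ℕ}

lemma lqNorm_le_lqNorm_iff {q : ℝ} (hq : 0 ≤ q) (z z' : Fin n → ℝ) :
    lqNorm q z ≤ lqNorm q z' ↔ ∑ i, absPow q (z i) ≤ ∑ i, absPow q (z' i) := by
  rcases hq.eq_or_lt with rfl | hq
  · have h : ∀ z : Fin n → ℝ, lqNorm 0 z = ∑ i, absPow 0 (z i) := by
      intro z
      have h1 : ∀ i, absPow 0 (z i) = if z i ≠ 0 then 1 else 0 := fun i => by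
        by_cases hz : z i = 0 <;> simp [absPow, hz]
      simp_rw [h1, Finset.sum_boole, lqNorm]
      rw [ENNReal.ofReal_zero, PiLp.norm_eq_card]
      congr 2
      ext i
      simp
    rw [h, h]
  · have hp : (ENNReal.ofReal q).toReal = q := ENNReal.toReal_ofReal hq.le
    have h : ∀ z : Fin n → ℝ, lqNorm q z = (∑ i, absPow q (z i)) ^ (1 / q) := by
      intro z
      rw [lqNorm, PiLp.norm_eq_sum (by rw [hp]; exact hq), hp]
      congr 1
      refine Finset.sum_congr rfl fun i _ => ?_
      by_cases hz : z i = 0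
      · simp [absPow, hz, hq.ne']
      · rw [absPow_of_ne q hz, norm_eq_abs]
    rw [h, h, rpow_le_rpow_iff (Finset.sum_nonneg fun i _ => absPow_nonneg q _)
      (Finset.sum_nonneg fun i _ => absPow_nonneg q _) (by positivity)]

lemma exists_descent_of_lqSolutions_ne {q : ℝ} (hq : 0 ≤ q) {A : Matrix (Fin m) (Fin n) ℝ}
    {x : Fin n → ℝ} (h : lqSolutions q A (A *ᵥ x) ≠ {x}) :
    ∃ w, w ≠ 0 ∧ A *ᵥ w = 0 ∧ ∑ i, absPow q (x i + w i) ≤ ∑ i, absPow q (x i) := by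
  by_contra! hc
  have hlt : ∀ z, A *ᵥ z = A *ᵥ x → z ≠ x → ∑ i, absPow q (x i) < ∑ i, absPow q (z i) := by
    intro z hz hzx
    have := hc (z - x) (sub_ne_zero.2 hzx) (by rw [Matrix.mulVec_sub, hz, sub_self])
    simpa using this
  refine h (Set.eq_singleton_iff_unique_mem.2 ⟨⟨rfl, fun z hz => ?_⟩, fun z hz => ?_⟩)
  · rw [lqNorm_le_lqNorm_iff hq]
    by_cases hzx : z = x
    · rw [hzx]
    · exact (hlt z hz hzx).le
  · by_contra hzx
    have h1 := (lqNorm_le_lqNorm_iff hq _ _).1 (hz.2 x rfl)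
    exact absurd (hlt z hz.1 hzx) (not_lt.2 h1)

/-- Unit vectors `w` such that moving from `x` along `-w` can decrease the objective. -/
def descentSet (q : ℝ) (x : Fin n → ℝ) : Set (Fin n → ℝ) :=
  {w | ∑ j, w j ^ 2 = 1 ∧
    ∃ r : ℝ, 0 < r ∧ ∑ i, absPow q (x i - r * w i) ≤ ∑ i, absPow q (x i)}

lemma exists_mem_descentSet_of_lqSolutions_ne {q : ℝ} (hq : 0 ≤ q) {A : Matrix (Fin m) (Fin n) ℝ}
    {x : Fin n → ℝ} (h : lqSolutions q A (A *ᵥ x) ≠ {x}) :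
    ∃ w ∈ descentSet q x, A *ᵥ w = 0 := by
  obtain ⟨w, hw0, hAw, hw⟩ := exists_descent_of_lqSolutions_ne hq h
  have hpos : 0 < ∑ j, w j ^ 2 := by
    obtain ⟨j, hj⟩ := Function.ne_iff.1 hw0
    exact Finset.sum_pos' (fun i _ => sq_nonneg _) ⟨j, Finset.mem_univ j, sq_pos_of_ne_zero hj⟩
  set r := √(∑ j, w j ^ 2) with hr
  have hr0 : 0 < r := sqrt_pos.2 hpos
  have hr2 : r ^ 2 = ∑ j, w j ^ 2 := sq_sqrt hpos.le
  -- The sign is flipped so that a small `⟨h, w⟩` in Gordon's inequality corresponds to a large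
  -- reward along the actual move `-w`.
  refine ⟨-r⁻¹ • w, ⟨?_, r, hr0, ?_⟩, by rw [Matrix.mulVec_smul, hAw, smul_zero]⟩
  · simp only [Pi.smul_apply, smul_eq_mul, mul_pow, neg_sq]
    rw [← Finset.mul_sum, ← hr2]
    field_simp
  · refine le_trans (le_of_eq (Finset.sum_congr rfl fun i _ => ?_)) hw
    congr 1
    simp only [Pi.smul_apply, smul_eq_mul]
    field_simp
    ring

/-- A descent direction has small correlation with any vector `h`. -/
lemma exists_scale_of_mem_descentSet {q : ℝ} (hq0 : 0 ≤ q) (hq1 : q ≤ 1) {γ : ℝ≥0} (hγ : 0 < γ)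
    (ν : ℝ≥0) (hn : 0 < n) {x w : Fin n → ℝ} (hw : w ∈ descentSet q x) :
    ∃ s : ℝ, 0 < s ∧ ∀ h : Fin n → ℝ,
      -(√n * (h ⬝ᵥ w)) ≤ ∑ i, (supGain q γ ν (s * x i) (h i)).toReal + γ * n := by
  obtain ⟨hw1, r, hr, hd⟩ := hw
  have hn' : (0 : ℝ) < n := by exact_mod_cast hn
  have hsn : 0 < √(n : ℝ) := sqrt_pos.2 hn'
  -- This scale turns the move from `x` into one of length `√n`, so the quadratic penalty totals
  -- exactly `γ * n`. Homogeneity of `|·|^q` preserves descent, and descent makes the `ν` terms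
  -- nonnegative in total.
  refine ⟨√n / r, by positivity, fun h => ?_⟩
  set s := √(n : ℝ) / r with hs
  have hs0 : 0 < s := by positivity
  set ω : Fin n → ℝ := fun i => -(√n * w i) with hω
  have h1 : ∑ i, absPow q (s * x i + ω i) ≤ ∑ i, absPow q (s * x i) := by
    have e : ∀ i, s * x i + ω i = s * (x i - r * w i) := fun i => by
      simp only [hω, hs]; field_simp; ring
    simp_rw [e, absPow_mul q hs0, ← Finset.mul_sum]
    exact mul_le_mul_of_nonneg_left hd (by positivity)
  have h2 : ∑ i, ω i ^ 2 = n := by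
    simp only [hω, neg_sq, mul_pow]
    rw [← Finset.mul_sum, hw1, sq_sqrt hn'.le, mul_one]
  have h3 : ∀ i, gain q γ ν (s * x i) (h i) (ω i) ≤ (supGain q γ ν (s * x i) (h i)).toReal :=
    fun i => (ENNReal.ofReal_le_iff_le_toReal
      ((supGain_le hq0 hq1 hγ ν _ _).trans_lt ENNReal.ofReal_lt_top).ne).1
      (ofReal_gain_le q γ ν _ _ _)
  have h4 := Finset.sum_le_sum fun i (_ : i ∈ Finset.univ) => h3 i
  have h5 : ∑ i, gain q γ ν (s * x i) (h i) (ω i) = -(√n * (h ⬝ᵥ w)) -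
      ν * ∑ i, absPow q (s * x i + ω i) + ν * ∑ i, absPow q (s * x i) - γ * ∑ i, ω i ^ 2 := by
    simp only [gain, dotProduct, Finset.mul_sum, Finset.sum_add_distrib, Finset.sum_sub_distrib,
      ← Finset.sum_neg_distrib]
    congr 3
    exact Finset.sum_congr rfl fun i _ => by simp only [hω]; ring
  rw [h5, h2] at h4
  have h6 := mul_le_mul_of_nonneg_left h1 ν.coe_nonneg
  linarith

/-- A non-asymptotic failure bound. -/
lemma gaussianMatrix_lqSolutions_ne_le {q : ℝ} (hq0 : 0 ≤ q) (hq1 : q ≤ 1) {γ : ℝ≥0} (hγ : 0 < γ)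
    (ν : ℝ≥0) (hn : 0 < n) (x : Fin n → ℝ) {a b : ℝ}
    (hab : 3 * √n + (a + γ * n) < √n * b) :
    gaussianMatrix m n {A | lqSolutions q (Matrix.of A) (Matrix.of A *ᵥ x) ≠ {x}} ≤
      2 * (gaussianVector m {g | ∑ i, g i ^ 2 ≤ b ^ 2} +
        gaussianVector n {h | ∃ s, 0 < s ∧ a ≤ ∑ i, (supGain q γ ν (s * x i) (h i)).toReal}) := by
  refine (measure_mono fun A hA => exists_mem_descentSet_of_lqSolutions_ne hq0 hA).trans
    ((measure_exists_mulVec_eq_zero_le (descentSet q x) fun w hw => hw.1).trans ?_)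
  gcongr
  set G : Set (Fin m → ℝ) := {g | ∑ i, g i ^ 2 ≤ b ^ 2}
  set H : Set (Fin n → ℝ) :=
    {h | ∃ s, 0 < s ∧ a ≤ ∑ i, (supGain q γ ν (s * x i) (h i)).toReal}
  have hsub : {p : (Fin m → ℝ) × (Fin n → ℝ) |
      ∃ w ∈ descentSet q x, ‖WithLp.toLp 2 p.1‖ + p.2 ⬝ᵥ w ≤ 3} ⊆ G ×ˢ univ ∪ univ ×ˢ H := by
    rintro ⟨g, h⟩ ⟨w, hw, hle⟩
    by_contra hc
    rw [mem_union, not_or] at hc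
    have hg : b ^ 2 < ∑ i, g i ^ 2 := by
      by_contra hg; exact hc.1 ⟨not_lt.1 hg, mem_univ _⟩
    obtain ⟨s, hs, hsw⟩ := exists_scale_of_mem_descentSet hq0 hq1 hγ ν hn hw
    have hh : ∑ i, (supGain q γ ν (s * x i) (h i)).toReal < a := by
      by_contra hh; exact hc.2 ⟨mem_univ _, s, hs, not_lt.1 hh⟩
    have h1 : b ≤ ‖WithLp.toLp 2 g‖ := by
      refine le_of_sq_le_sq ?_ (norm_nonneg _)
      rw [EuclideanSpace.norm_sq_eq]
      simpa using hg.le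
    have h2 := hsw h
    have h3 : √(n : ℝ) * (‖WithLp.toLp 2 g‖ + h ⬝ᵥ w) ≤ √n * 3 :=
      mul_le_mul_of_nonneg_left hle (sqrt_nonneg _)
    have h4 := mul_le_mul_of_nonneg_left h1 (sqrt_nonneg (n : ℝ))
    rw [mul_add] at h3
    linarith
  refine (measure_mono hsub).trans ((measure_union_le _ _).trans ?_)
  rw [Measure.prod_prod, Measure.prod_prod, measure_univ, measure_univ, mul_one, one_mul]

/-! ### Choice of constants and the exponential bound. -/

/-- The multipliers and the resulting bound on `I₁`, in real numbers. -/
lemma exists_multipliers {q β : ℝ} (hq0 : 0 ≤ q) (hq1 : q ≤ 1) (hβ0 : 0 < β) (hβ1 : β ≤ 1) {a : ℝ}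
    (h : weakBound q β < ENNReal.ofReal a) :
    ∃ (γ ν : ℝ≥0) (M t : ℝ), 0 < γ ∧ 0 ≤ M ∧ t < a ∧
      (∀ x, 0 < x → I₁ q γ ν x ≤ ENNReal.ofReal M) ∧
      β * M + (1 - β) * (I₂ q γ ν).toReal + γ = t := by
  obtain ⟨s, hs, hsa⟩ := exists_between h
  have hs' : s ≠ ∞ := hsa.ne_top
  obtain ⟨γ, ν, hγ, hle⟩ := exists_forall_weakFun_le hq0 hq1 hβ0 hs hs'
  have hI₂ : I₂ q γ ν ≠ ∞ := by rw [I₂_eq]; exact (I₁_lt_top hq0 hq1 hγ ν 0).ne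
  -- The largest value of `I₁` compatible with `weakFun ≤ s`; with it the weighted sum equals `s`
  -- exactly.
  set M : ℝ := (s.toReal - γ - (1 - β) * (I₂ q γ ν).toReal) / β with hM
  have hreal : ∀ x, 0 < x → (I₁ q γ ν x).toReal ≤ M := by
    intro x hx
    have hI₁ : I₁ q γ ν x ≠ ∞ := (I₁_lt_top hq0 hq1 hγ ν x).ne
    have h1 := ENNReal.toReal_mono hs' (hle x hx)
    rw [weakFun, ENNReal.toReal_add (by finiteness) (by finiteness),
      ENNReal.toReal_add (by finiteness) (by finiteness), ENNReal.toReal_mul, ENNReal.toReal_mul,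
      ENNReal.toReal_ofReal hβ0.le, ENNReal.toReal_ofReal (by linarith), ENNReal.coe_toReal] at h1
    rw [hM, le_div_iff₀ hβ0]
    linarith
  refine ⟨γ, ν, M, s.toReal, hγ, ENNReal.toReal_nonneg.trans (hreal 1 one_pos),
    (ENNReal.lt_ofReal_iff_toReal_lt hs').1 hsa, fun x hx => ?_, ?_⟩
  · rw [ENNReal.le_ofReal_iff_toReal_le (I₁_lt_top hq0 hq1 hγ ν x).ne
      (ENNReal.toReal_nonneg.trans (hreal 1 one_pos))]
    exact hreal x hx
  · rw [hM]; field_simp; ring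

/-- Half of the exponential rate absorbs the linear factor coming from the union bound. -/
lemma nat_mul_exp_neg_le {c : ℝ} (hc : 0 < c) (n : ℕ) :
    n * exp (-(c * n)) ≤ 2 / c * exp (-(c / 2 * n)) := by
  have h1 : c / 2 * n ≤ exp (c / 2 * n) := (le_add_of_nonneg_right zero_le_one).trans
    (add_one_le_exp _)
  have h2 : exp (c / 2 * n) * exp (-(c * n)) = exp (-(c / 2 * n)) := by
    rw [← exp_add]; congr 1; ring
  rw [← h2, ← mul_assoc]
  refine mul_le_mul_of_nonneg_right ?_ (exp_pos _).le
  calc (n : ℝ) = 2 / c * (c / 2 * n) := by field_simp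
    _ ≤ _ := by gcongr

/-- Exponentially small failure probability below the threshold. -/
theorem exists_gaussianMatrix_lqSolutions_ne_le (q α β : ℝ) (hq0 : 0 ≤ q) (hq1 : q ≤ 1)
    (hα0 : 0 < α) (hβ0 : 0 < β) (hβ1 : β ≤ 1) (hbound : weakBound q β < ENNReal.ofReal (√α)) :
    ∃ C c : ℝ, 0 < C ∧ 0 < c ∧
      ∀ m n k : ℕ, (m : ℝ) = α * n → (k : ℝ) = β * n →
        ∀ x : Fin n → ℝ, (∀ i : Fin n, (i : ℕ) + k < n → x i = 0) →
          gaussianMatrix m n {A | lqSolutions q (Matrix.of A) (Matrix.of A *ᵥ x) ≠ {x}}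
            ≤ ENNReal.ofReal (C * Real.exp (-(c * n))) := by
  obtain ⟨γ, ν, M, t, hγ, hM0, hta, hM, hMt⟩ := exists_multipliers hq0 hq1 hβ0 hβ1 hbound
  have hα : 0 < √α := sqrt_pos.2 hα0
  have ht0 : 0 ≤ t := by
    rw [← hMt]
    have h1 : 0 ≤ 1 - β := by linarith
    have h2 : 0 ≤ (I₂ q γ ν).toReal := ENNReal.toReal_nonneg
    positivity
  -- The gap is shared equally by the fluctuation of the gains, the fluctuation of `‖g‖` and the
  -- additive term `3 * √n`.
  set δ : ℝ := (√α - t) / 3 with hδ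
  have hδ0 : 0 < δ := by rw [hδ]; linarith
  have hδα : δ < √α := by rw [hδ]; linarith
  -- Chosen so that `(1 - η) * m` is the square of `(√α - δ) * √n`.
  set η : ℝ := 1 - ((√α - δ) / √α) ^ 2 with hη
  have hη0 : 0 < η := by
    have h1 : (√α - δ) / √α < 1 := by rw [div_lt_one hα]; linarith
    have h2 : 0 ≤ (√α - δ) / √α := div_nonneg (by linarith) hα.le
    have := pow_lt_one₀ h2 h1 two_ne_zero
    rw [hη]; linarith
  obtain ⟨c₁, hc₁, hchi⟩ := exists_gaussianVector_sum_sq_le hη0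
  obtain ⟨J, c₂, hc₂, hgain⟩ := exists_gaussianVector_supGain_ge_le hq0 hq1 hγ ν hM0 hM hδ0
  set c : ℝ := min (c₁ * α) (c₂ / 2) with hc
  have hc0 : 0 < c := lt_min (by positivity) (by positivity)
  -- Above `N` one has `3 < δ * √n`; for smaller `n` the constant `exp (c * N)` makes the claimed
  -- bound at least `1`.
  set N : ℝ := (3 / δ) ^ 2 with hN
  refine ⟨max (2 * (2 + J * (2 / c₂))) (exp (c * N)), c, lt_max_of_lt_right (exp_pos _), hc0,
    fun m n k hm hk x hx => ?_⟩
  rcases le_or_gt (n : ℝ) N with hn | hn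
  · refine prob_le_one.trans ?_
    rw [← ENNReal.ofReal_one]
    refine ENNReal.ofReal_le_ofReal ?_
    calc (1 : ℝ) ≤ exp (c * N) * exp (-(c * n)) := by
          rw [← exp_add, one_le_exp_iff]
          nlinarith
      _ ≤ _ := by gcongr; exact le_max_right _ _
  have hn0 : (0 : ℝ) < n := (sq_nonneg _).trans_lt hn
  have hkn : k ≤ n := by
    have : (k : ℝ) ≤ n := by rw [hk]; exact mul_le_of_le_one_left hn0.le hβ1
    exact_mod_cast this
  have hsn : 3 < δ * √n := by
    have := lt_sqrt_of_sq_lt hn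
    rw [div_lt_iff₀ hδ0] at this
    linarith
  have hsq : √(n : ℝ) * √n = n := mul_self_sqrt hn0.le
  set a : ℝ := k * M + (n - k) * (I₂ q γ ν).toReal + δ * n with ha
  have hγa : a + γ * n = (t + δ) * n := by
    rw [ha, hk, ← hMt]; ring
  have hab : 3 * √n + (a + γ * n) < √n * ((√α - δ) * √n) := by
    have h1 : √α - δ = t + δ + δ := by rw [hδ]; ring
    have h2 := mul_lt_mul_of_pos_right hsn (sqrt_pos.2 hn0)
    have h3 : √n * ((√α - δ) * √n) = (t + δ) * (√(n : ℝ) * √n) + δ * √n * √n := by rw [h1]; ring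
    rw [h3, hγa, hsq]
    linarith
  have hb : ((√α - δ) * √n) ^ 2 = (1 - η) * m := by
    rw [hη, hm, mul_pow, sq_sqrt hn0.le, div_pow, sq_sqrt hα0.le]
    field_simp
    ring
  refine (gaussianMatrix_lqSolutions_ne_le hq0 hq1 hγ ν (by exact_mod_cast hn0) x hab).trans ?_
  rw [hb]
  have h1 : exp (-(c₁ * m)) ≤ exp (-(c * n)) := by
    rw [exp_le_exp, hm, neg_le_neg_iff, ← mul_assoc]
    gcongr
    exact min_le_left _ _
  have h2 : (n * J + 1) * exp (-(c₂ * n)) ≤ (J * (2 / c₂) + 1) * exp (-(c * n)) := by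
    have h3 := nat_mul_exp_neg_le hc₂ n
    have h4 : exp (-(c₂ / 2 * n)) ≤ exp (-(c * n)) := by
      rw [exp_le_exp, neg_le_neg_iff]
      gcongr
      exact min_le_right _ _
    have h5 : exp (-(c₂ * n)) ≤ exp (-(c₂ / 2 * n)) := by
      rw [exp_le_exp, neg_le_neg_iff]
      gcongr
      linarith
    calc (n * J + 1) * exp (-(c₂ * n)) = J * (n * exp (-(c₂ * n))) + exp (-(c₂ * n)) := by ring
      _ ≤ J * (2 / c₂ * exp (-(c₂ / 2 * n))) + exp (-(c₂ / 2 * n)) := by gcongr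
      _ = (J * (2 / c₂) + 1) * exp (-(c₂ / 2 * n)) := by ring
      _ ≤ _ := by gcongr
  calc _ ≤ 2 * (ENNReal.ofReal (exp (-(c * n))) +
        ENNReal.ofReal ((J * (2 / c₂) + 1) * exp (-(c * n)))) := by
        gcongr
        · exact (hchi m).trans (ENNReal.ofReal_le_ofReal h1)
        · exact (hgain n k hkn x hx).trans (ENNReal.ofReal_le_ofReal h2)
    _ = ENNReal.ofReal (2 * (2 + J * (2 / c₂)) * exp (-(c * n))) := by
        rw [← ENNReal.ofReal_add (by positivity) (by positivity),
          ← ENNReal.ofReal_ofNat 2, ← ENNReal.ofReal_mul (by norm_num)]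
        congr 1
        ring
    _ ≤ _ := by
        refine ENNReal.ofReal_le_ofReal ?_
        gcongr
        exact le_max_left _ _

end

end WeakThreshold

theorem mainTheorem3 (q α β : ℝ) (hq0 : 0 ≤ q) (hq1 : q ≤ 1) (hα0 : 0 < α) (hα1 : α ≤ 1)
    (hβ0 : 0 < β) (hβ1 : β ≤ 1)
    (hbound : WeakThreshold.weakBound q β < ENNReal.ofReal (√α)) :
    ∃ C c : ℝ, 0 < C ∧ 0 < c ∧
      ∀ m n k : ℕ, (m : ℝ) = α * n → (k : ℝ) = β * n →
        ∀ x : Fin n → ℝ, (∀ i : Fin n, (i : ℕ) + k < n → x i = 0) →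
          WeakThreshold.gaussianMatrix m n
              {A | WeakThreshold.lqSolutions q (Matrix.of A) (Matrix.of A *ᵥ x) ≠ {x}}
            ≤ ENNReal.ofReal (C * Real.exp (-(c * n))) :=
  WeakThreshold.exists_gaussianMatrix_lqSolutions_ne_le q α β hq0 hq1 hα0 hβ0 hβ1 hbound
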